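/- **Notation.** Write $I_\delta=\,]-\delta,\delta[$, let $\|\cdot\|$ be the norm of $L^2(\mathbb R^2)$, and let $P_m$ be the set of real polynomials $\varphi(x,y)$ of degree $\le m$. For $\varphi\in P_m$ and $\lambda\in\mathbb R$ put $$\mathcal L_1=\partial_x+\lambda(\partial_x\varphi),\qquad \mathcal L_2=\partial_y+\lambda(\partial_y\varphi).$$ A real function $f$ *changes sign from $-$ to $+$* on an interval $I$ if there are $a<b$ in $I$ with $f(a)<0<f(b)$; it *changes sign from $-$ to $+$ only at* $r\in I$ if there are such $a,b$ and all of them satisfy $a<r<b$. **Assumption $H_1(\alpha)$** in $\Omega=\Omega_x\times\Omega_y$ ($\Omega_x,\Omega_y$ open intervals, $\alpha>0$): there are finitely many pairwise disjoint open sets $\omega_1,\dots,\omega_N\subset\mathbb R$ and $C^1$ functions $r_j:\omega_j\to\mathbb R$ such that 1. $\bigcup_{j}\overline{\omega_j}=\overline{\Omega_y}$; 2. for every $j$ and every $y\in\omega_j$, either $s\mapsto\partial_x\varphi(s,y)$ does not change sign from $-$ to $+$ on $\Omega_x$, or it changes sign from $-$ to $+$ on $\Omega_x$ only at $r_j(y)$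 and $s\mapsto(\partial_y\varphi)(r_j(y),s)$ does not change sign from $-$ to $+$ on $\Omega_y$; 3. $|r_j'|\ge\alpha$ on $\omega_j$ for every $j$. **Assumption $H_2(\alpha)$** is the same with the roles of $x$ and $y$ exchanged. **Theorem 1.1.** For every integer $m\ge 0$ there is $\delta>0$, depending only on $m$, and for every $\alpha>0$ there are $\lambda_0>0$ and $C>0$, depending only on $m$ and $\alpha$, such that for all $\varphi\in P_m$, all real $\lambda\ge\lambda_0$ and all complex-valued $u\in C_0^\infty(I_\delta\times I_\delta)$: * if $\varphi$ satisfies $H_1(\alpha)$ in $I_\delta\times I_\delta$, then $$\|\partial_xu\|+\|\lambda(\partial_x\varphi)u\|\le C\big(\|\mathcal L_1u\|+\|\mathcal L_2u\|\big);$$ * if $\varphi$ satisfies $H_2(\alpha)$ in $I_\delta\times I_\delta$, then $$\|\partial_yu\|+\|\lambda(\partial_y\varphi)u\|\le C\big(\|\mathcal L_1u\|+\|\mathcal L_2u\|\big).$$ -/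

import Mathlib

open MeasureTheory
open scoped ContDiff ENNReal

noncomputable section

/-- The partial derivative `∂ₓφ`, as a function of `(x, y)`, of a real polynomial `φ` in two
variables (variable `0` is `x`, variable `1` is `y`). -/
def polyDx (φ : MvPolynomial (Fin 2) ℝ) (x y : ℝ) : ℝ :=
  MvPolynomial.eval ![x, y] (MvPolynomial.pderiv 0 φ)

/-- The partial derivative `∂_yφ`, as a function of `(x, y)`. -/
def polyDy (φ : MvPolynomial (Fin 2) ℝ) (x y : ℝ) : ℝ :=
  MvPolynomial.eval ![x, y] (MvPolynomial.pderiv 1 φ)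

/-- `f` does not change sign from `-` to `+` as its argument increases in the interval `I`. -/
def NoSignChange (f : ℝ → ℝ) (I : Set ℝ) : Prop :=
  ∀ a ∈ I, ∀ b ∈ I, a < b → f a < 0 → f b ≤ 0

/-- As its argument increases in the interval `I`, `f` changes sign from `-` to `+`, and it does so
only at the point `r` of `I`: any two points of `I` between which `f` passes from a negative to a
positive value lie on the two sides of `r`. -/
def SignChangeOnlyAt (f : ℝ → ℝ) (I : Set ℝ) (r : ℝ) : Prop :=
  r ∈ I ∧ ¬ NoSignChange f I ∧
    ∀ a ∈ I, ∀ b ∈ I, a < b → f a < 0 → 0 < f b → a < r ∧ r < b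

/-- Assumption `H₁(α)` for the polynomial `φ` in `Ωx × Ωy`. -/
def AssumptionH1 (α : ℝ) (φ : MvPolynomial (Fin 2) ℝ) (Ωx Ωy : Set ℝ) : Prop :=
  ∃ (N : ℕ) (W : Fin N → Set ℝ) (r : Fin N → ℝ → ℝ),
    (∀ j, IsOpen (W j)) ∧
    (∀ i j, i ≠ j → Disjoint (W i) (W j)) ∧
    (∀ j, ContDiffOn ℝ 1 (r j) (W j)) ∧
    (⋃ j, closure (W j)) = closure Ωy ∧
    (∀ j, ∀ y ∈ W j,
      NoSignChange (fun s => polyDx φ s y) Ωx ∨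
        (SignChangeOnlyAt (fun s => polyDx φ s y) Ωx (r j y) ∧
          NoSignChange (fun s => polyDy φ (r j y) s) Ωy)) ∧
    (∀ j, ∀ y ∈ W j, α ≤ |deriv (r j) y|)

/-- Assumption `H₂(α)` for the polynomial `φ` in `Ωx × Ωy`: the roles of `x` and `y` are
exchanged. -/
def AssumptionH2 (α : ℝ) (φ : MvPolynomial (Fin 2) ℝ) (Ωx Ωy : Set ℝ) : Prop :=
  ∃ (N : ℕ) (U : Fin N → Set ℝ) (τ : Fin N → ℝ → ℝ),
    (∀ j, IsOpen (U j)) ∧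
    (∀ i j, i ≠ j → Disjoint (U i) (U j)) ∧
    (∀ j, ContDiffOn ℝ 1 (τ j) (U j)) ∧
    (⋃ j, closure (U j)) = closure Ωx ∧
    (∀ j, ∀ x ∈ U j,
      NoSignChange (fun s => polyDy φ x s) Ωy ∨
        (SignChangeOnlyAt (fun s => polyDy φ x s) Ωy (τ j x) ∧
          NoSignChange (fun s => polyDx φ s (τ j x)) Ωx)) ∧
    (∀ j, ∀ x ∈ U j, α ≤ |deriv (τ j) x|)

/-- `u ∈ C₀^∞(Ω)`: complex-valued smooth functions with compact support contained in `Ω`. -/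
def IsTestFunction (Ω : Set (ℝ × ℝ)) (u : ℝ × ℝ → ℂ) : Prop :=
  ContDiff ℝ ∞ u ∧ HasCompactSupport u ∧ tsupport u ⊆ Ω

/-- The partial derivative `∂ₓu`. -/
def funDx (u : ℝ × ℝ → ℂ) (z : ℝ × ℝ) : ℂ := fderiv ℝ u z (1, 0)

/-- The partial derivative `∂_yu`. -/
def funDy (u : ℝ × ℝ → ℂ) (z : ℝ × ℝ) : ℂ := fderiv ℝ u z (0, 1)

/-- `λ (∂ₓφ) u`. -/
def mulDx (φ : MvPolynomial (Fin 2) ℝ) (lam : ℝ) (u : ℝ × ℝ → ℂ) (z : ℝ × ℝ) : ℂ :=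
  ((lam * polyDx φ z.1 z.2 : ℝ) : ℂ) * u z

/-- `λ (∂_yφ) u`. -/
def mulDy (φ : MvPolynomial (Fin 2) ℝ) (lam : ℝ) (u : ℝ × ℝ → ℂ) (z : ℝ × ℝ) : ℂ :=
  ((lam * polyDy φ z.1 z.2 : ℝ) : ℂ) * u z

/-- The operator `L₁ = ∂ₓ + λ (∂ₓφ)`. -/
def opL1 (φ : MvPolynomial (Fin 2) ℝ) (lam : ℝ) (u : ℝ × ℝ → ℂ) (z : ℝ × ℝ) : ℂ :=
  funDx u z + mulDx φ lam u z

/-- The operator `L₂ = ∂_y + λ (∂_yφ)`. -/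
def opL2 (φ : MvPolynomial (Fin 2) ℝ) (lam : ℝ) (u : ℝ × ℝ → ℂ) (z : ℝ × ℝ) : ℂ :=
  funDy u z + mulDy φ lam u z

/-- The norm of `L²(ℝ²)` for Lebesgue measure, with values in `[0, ∞]`. -/
def normL2 (f : ℝ × ℝ → ℂ) : ℝ≥0∞ := eLpNorm f 2 volume

end

/-- `f` is the function of a real polynomial of degree at most `m`. -/
def PolyLE (m : ℕ) (f : ℝ → ℝ) : Prop :=
  ∃ P : Polynomial ℝ, P.natDegree ≤ m ∧ ∀ x, f x = P.eval x

namespace PolyLE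

variable {m : ℕ} {f : ℝ → ℝ}

theorem contDiff (hf : PolyLE m f) : ContDiff ℝ ∞ f := by
  obtain ⟨P, -, h⟩ := hf
  obtain rfl : f = fun x => P.eval x := funext h
  simp only [Polynomial.eval_eq_sum_range]
  fun_prop

theorem continuous (hf : PolyLE m f) : Continuous f := hf.contDiff.continuous

theorem differentiable (hf : PolyLE m f) : Differentiable ℝ f :=
  hf.contDiff.differentiable (by simp)

theorem deriv (hf : PolyLE m f) : PolyLE m (_root_.deriv f) := by
  obtain ⟨P, hP, h⟩ := hf
  obtain rfl : f = fun x => P.eval x := funext h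
  exact ⟨P.derivative, (Polynomial.natDegree_derivative_le P).trans (by omega), fun x => by simp⟩

theorem comp_affine (hf : PolyLE m f) (a b : ℝ) : PolyLE m (fun x => f (a + b * x)) := by
  obtain ⟨P, hP, h⟩ := hf
  refine ⟨P.comp (Polynomial.C a + Polynomial.C b * Polynomial.X), ?_, fun x => by simp [h]⟩
  have : (Polynomial.C a + Polynomial.C b * Polynomial.X : Polynomial ℝ).natDegree ≤ 1 := by
    compute_degree
  calc _ ≤ P.natDegree * 1 := Polynomial.natDegree_comp_le.trans (Nat.mul_le_mul_left _ this)
    _ ≤ m := by omega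

theorem sub (hf : PolyLE m f) {g : ℝ → ℝ} (hg : PolyLE m g) : PolyLE m (fun x => f x - g x) := by
  obtain ⟨P, hP, h⟩ := hf
  obtain ⟨Q, hQ, h'⟩ := hg
  exact ⟨P - Q, (Polynomial.natDegree_sub_le P Q).trans (max_le hP hQ), fun x => by simp [h, h']⟩

theorem const (m : ℕ) (c : ℝ) : PolyLE m (fun _ => c) :=
  ⟨Polynomial.C c, by simp, by simp⟩

/-- A polynomial function is zero, or has at most `m` zeros. -/
theorem card_zeros_le (hf : PolyLE m f) (h0 : ∃ x, f x ≠ 0) (s : Finset ℝ)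
    (hs : ∀ x ∈ s, f x = 0) : s.card ≤ m := by
  obtain ⟨P, hP, h⟩ := hf
  have hP0 : P ≠ 0 := by
    rintro rfl
    obtain ⟨x, hx⟩ := h0
    exact hx (by simp [h])
  refine le_trans ?_ (P.card_roots'.trans hP)
  have : s ⊆ P.roots.toFinset := by
    intro x hx
    simp [hP0, ← h x, hs x hx]
  exact (Finset.card_le_card this).trans (Multiset.toFinset_card_le _)

theorem finite_zeros (hf : PolyLE m f) (h0 : ∃ x, f x ≠ 0) : {x | f x = 0}.Finite := by
  by_contra hinf
  obtain ⟨s, hs, hc⟩ := Set.Infinite.exists_subset_card_eq hinf (m + 1)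
  have := hf.card_zeros_le h0 s (fun x hx => hs hx)
  omega

/-- Between any two points there is a point where a nonzero polynomial does not vanish. -/
theorem exists_ne_zero (hf : PolyLE m f) (h0 : ∃ x, f x ≠ 0) {a b : ℝ} (hab : a < b) :
    ∃ x ∈ Set.Ioo a b, f x ≠ 0 := by
  by_contra! h
  exact (Set.Ioo_infinite hab) ((hf.finite_zeros h0).subset fun x hx => h x hx)

theorem exists_coeff_bound (m : ℕ) : ∃ κ : ℝ, 0 < κ ∧ ∀ c : Fin (m + 1) → ℝ, ∀ i,
    κ * |c i| ≤ ∫ s in (0 : ℝ)..1, |∑ i, c i * s ^ (i : ℕ)| := by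
  set N : (Fin (m + 1) → ℝ) → ℝ := fun c => ∫ s in (0 : ℝ)..1, |∑ i, c i * s ^ (i : ℕ)| with hN
  have hcont : Continuous N := by
    apply intervalIntegral.continuous_parametric_intervalIntegral_of_continuous' (μ := volume)
    fun_prop
  have hpos : ∀ c, c ≠ 0 → 0 < N c := by
    intro c hc
    set P : Polynomial ℝ := ∑ i, Polynomial.C (c i) * Polynomial.X ^ (i : ℕ) with hP
    have hev : ∀ s, P.eval s = ∑ i, c i * s ^ (i : ℕ) := by
      intro s; simp [hP, Polynomial.eval_finsetSum]
    have hP0 : P ≠ 0 := by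
      obtain ⟨i, hi⟩ := Function.ne_iff.1 hc
      intro h
      apply hi
      have := congrArg (fun Q => Q.coeff (i : ℕ)) h
      simpa [hP, Polynomial.finsetSum_coeff, Polynomial.coeff_X_pow, Fin.val_inj] using this
    have hPL : PolyLE P.natDegree (fun s => P.eval s) := ⟨P, le_rfl, fun _ => rfl⟩
    have h0 : ∃ x, P.eval x ≠ 0 := by
      by_contra! h
      exact hP0 (Polynomial.funext (by simpa using h))
    obtain ⟨x, hx, hx0⟩ := hPL.exists_ne_zero h0 (zero_lt_one (α := ℝ))
    apply intervalIntegral.integral_pos zero_lt_one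
    · fun_prop
    · intros; positivity
    · exact ⟨x, ⟨hx.1.le, hx.2.le⟩, by rw [← hev]; exact abs_pos.2 hx0⟩
  have hhom : ∀ (a : ℝ) c, N (a • c) = |a| * N c := by
    intro a c
    simp only [hN, Pi.smul_apply, smul_eq_mul, mul_assoc, ← Finset.mul_sum, abs_mul]
    rw [intervalIntegral.integral_const_mul]
  obtain ⟨c₀, hc₀, hmin⟩ := (isCompact_sphere (0 : Fin (m + 1) → ℝ) 1).exists_isMinOn
    (NormedSpace.sphere_nonempty.2 zero_le_one) hcont.continuousOn
  refine ⟨N c₀, hpos _ (by rintro rfl; simp at hc₀), fun c i => ?_⟩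
  rcases eq_or_ne c 0 with rfl | hc
  · simp
  have hn : 0 < ‖c‖ := norm_pos_iff.2 hc
  have h1 : N c₀ ≤ N (‖c‖⁻¹ • c) := hmin (by simp [norm_smul, hn.ne'])
  rw [hhom, abs_of_pos (inv_pos.2 hn)] at h1
  have h2 : N c₀ * ‖c‖ ≤ N c := by
    calc N c₀ * ‖c‖ ≤ (‖c‖⁻¹ * N c) * ‖c‖ := by gcongr
      _ = N c := by field_simp
  refine le_trans ?_ h2
  have : |c i| ≤ ‖c‖ := norm_le_pi_norm c i
  have := (hpos c₀ (by rintro rfl; simp at hc₀)).le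
  gcongr

theorem exists_unit_bound (m : ℕ) : ∃ K : ℝ, 1 ≤ K ∧ ∀ f, PolyLE m f → ∀ L : ℝ, 1 ≤ L →
    ∀ x, |x| ≤ L → |f x| ≤ K * L ^ m * ∫ s in (0 : ℝ)..1, |f s| := by
  obtain ⟨κ, hκ, h⟩ := exists_coeff_bound m
  refine ⟨max 1 ((m + 1) * κ⁻¹), le_max_left _ _, ?_⟩
  rintro f ⟨P, hP, hf⟩ L hL x hx
  have hf' : ∀ x, f x = ∑ i : Fin (m + 1), P.coeff i * x ^ (i : ℕ) := by
    intro x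
    rw [hf, P.eval_eq_sum_range' (Nat.lt_succ_of_le hP), Finset.sum_range]
  have h1 := h (fun i => P.coeff i)
  simp only [← hf'] at h1
  set I := ∫ s in (0 : ℝ)..1, |f s|
  have hI : 0 ≤ I := intervalIntegral.integral_nonneg zero_le_one (fun _ _ => abs_nonneg _)
  have h2 : ∀ i : Fin (m + 1), |P.coeff i * x ^ (i : ℕ)| ≤ κ⁻¹ * I * L ^ m := by
    intro i
    rw [abs_mul, abs_pow]
    have : |x| ^ (i : ℕ) ≤ L ^ m := (pow_le_pow_left₀ (abs_nonneg _) hx _).trans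
      (pow_le_pow_right₀ hL (by omega))
    have h3 : |P.coeff i| ≤ κ⁻¹ * I := by
      rw [inv_mul_eq_div, le_div_iff₀ hκ, mul_comm]; exact h1 i
    gcongr
  calc |f x| ≤ ∑ i : Fin (m + 1), |P.coeff i * x ^ (i : ℕ)| := by
        rw [hf']; exact Finset.abs_sum_le_sum_abs _ _
    _ ≤ ∑ _i : Fin (m + 1), κ⁻¹ * I * L ^ m := Finset.sum_le_sum fun i _ => h2 i
    _ = ((m + 1) * κ⁻¹) * L ^ m * I := by simp; ring
    _ ≤ _ := by gcongr; exact le_max_right _ _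

/-- Values of a polynomial are controlled by its mean on an interval. -/
theorem exists_value_bound (m : ℕ) : ∃ K : ℝ, 1 ≤ K ∧ ∀ f, PolyLE m f → ∀ a b : ℝ, a < b →
    ∀ L : ℝ, 1 ≤ L → ∀ x, |x - a| ≤ L * (b - a) →
      |f x| ≤ K * L ^ m * ((b - a)⁻¹ * ∫ s in a..b, |f s|) := by
  obtain ⟨K, hK, h⟩ := exists_unit_bound m
  refine ⟨K, hK, fun f hf a b hab L hL x hx => ?_⟩
  have hd : 0 < b - a := sub_pos.2 hab
  have h1 := h _ (hf.comp_affine a (b - a)) L hL ((x - a) / (b - a)) (by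
    rw [abs_div, abs_of_pos hd, div_le_iff₀ hd]; exact hx)
  have e1 : a + (b - a) * ((x - a) / (b - a)) = x := by field_simp; ring
  have e2 := intervalIntegral.integral_comp_add_mul (fun s => |f s|) hd.ne' a (a := 0) (b := 1)
  simp only [mul_zero, add_zero, mul_one, add_sub_cancel, smul_eq_mul] at e2
  rw [e1, e2] at h1
  exact h1

/-- The variation of a polynomial is controlled by its oscillation, and the derivative by the
variation. -/
theorem exists_deriv_bound (m : ℕ) : ∃ K : ℝ, 1 ≤ K ∧ ∀ f, PolyLE m f → ∀ a b : ℝ, a < b →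
    ∀ B c : ℝ, (∀ s ∈ Set.Icc a b, |f s - c| ≤ B) →
      (∀ x ∈ Set.Icc a b, |_root_.deriv f x| * (b - a) ≤ K * B) := by
  obtain ⟨κ, hκ, h⟩ := exists_coeff_bound m
  refine ⟨max 1 ((m + 1) * (m * κ⁻¹)), le_max_left _ _, ?_⟩
  intro f hf a b hab B c hB x hx
  have hd : 0 < b - a := sub_pos.2 hab
  obtain ⟨P, hP, hPe⟩ := (hf.sub (const m c)).comp_affine a (b - a)
  have hP' : ∀ x, P.eval x = ∑ i : Fin (m + 1), P.coeff i * x ^ (i : ℕ) := by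
    intro x
    rw [P.eval_eq_sum_range' (Nat.lt_succ_of_le hP), Finset.sum_range]
  have h1 := h (fun i => P.coeff i)
  simp only [← hP'] at h1
  have hB0 : 0 ≤ B := (abs_nonneg _).trans (hB a ⟨le_rfl, hab.le⟩)
  have hI : ∫ s in (0 : ℝ)..1, |P.eval s| ≤ B := by
    calc _ ≤ ∫ s in (0 : ℝ)..1, B := by
          apply intervalIntegral.integral_mono_on zero_le_one
          · exact (by fun_prop : Continuous fun s => |P.eval s|).intervalIntegrable _ _
          · simp
          · intro s hs
            rw [← hPe]
            apply hB
            constructor <;> nlinarith [hs.1, hs.2]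
      _ = B := by simp
  set y := (x - a) / (b - a)
  have hy : |y| ≤ 1 := by
    rw [abs_div, abs_of_pos hd, abs_of_nonneg (sub_nonneg.2 hx.1), div_le_one hd]
    linarith [hx.2]
  have e1 : a + (b - a) * y = x := by simp only [y]; field_simp; ring
  have hder : P.derivative.eval y = _root_.deriv f x * (b - a) := by
    have h3 : HasDerivAt (fun s => P.eval s) (_root_.deriv f x * (b - a)) y := by
      have : HasDerivAt (fun s => f (a + (b - a) * s) - c) (_root_.deriv f x * (b - a)) y := by
        apply HasDerivAt.sub_const
        have h4 : HasDerivAt f (_root_.deriv f x) (a + (b - a) * y) := by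
          rw [e1]; exact (hf.differentiable x).hasDerivAt
        have h5 : HasDerivAt (fun s => a + (b - a) * s) (b - a) y := by
          simpa using ((hasDerivAt_id y).const_mul (b - a)).const_add a
        exact h4.comp y h5
      exact this.congr_of_eventuallyEq (Filter.Eventually.of_forall fun s => (hPe s).symm)
    exact (P.hasDerivAt y).unique h3
  have h2 : ∀ i : Fin (m + 1), |P.coeff i * (i * y ^ ((i : ℕ) - 1))| ≤ m * κ⁻¹ * B := by
    intro i
    rw [abs_mul, abs_mul, abs_pow]
    have h5 : |y| ^ ((i : ℕ) - 1) ≤ 1 := pow_le_one₀ (abs_nonneg _) hy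
    have h3 : |P.coeff i| ≤ κ⁻¹ * B := by
      rw [inv_mul_eq_div, le_div_iff₀ hκ, mul_comm]; exact (h1 i).trans hI
    have h4 : |((i : ℕ) : ℝ)| ≤ m := by
      rw [Nat.abs_cast]; exact_mod_cast Nat.lt_succ_iff.1 i.2
    calc _ ≤ (κ⁻¹ * B) * (m * 1) := by gcongr
      _ = _ := by ring
  have h6 : P.derivative.eval y = ∑ i : Fin (m + 1), P.coeff i * (i * y ^ ((i : ℕ) - 1)) := by
    conv_lhs => rw [P.as_sum_range' (m + 1) (Nat.lt_succ_of_le hP)]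
    rw [Polynomial.derivative_sum, Polynomial.eval_finsetSum, Finset.sum_range]
    refine Finset.sum_congr rfl fun i _ => ?_
    simp [Polynomial.derivative_monomial, Polynomial.eval_monomial]
    ring
  calc |_root_.deriv f x| * (b - a) = |P.derivative.eval y| := by
        rw [hder, abs_mul, abs_of_pos hd]
    _ ≤ ∑ i : Fin (m + 1), |P.coeff i * (i * y ^ ((i : ℕ) - 1))| := by
        rw [h6]; exact Finset.abs_sum_le_sum_abs _ _
    _ ≤ ∑ _i : Fin (m + 1), m * κ⁻¹ * B := Finset.sum_le_sum fun i _ => h2 i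
    _ = ((m + 1) * (m * κ⁻¹)) * B := by simp; ring
    _ ≤ _ := by gcongr; exact le_max_right _ _

end PolyLE

theorem sq_lintegral_le {α : Type*} [MeasurableSpace α] (μ : Measure α) {F : α → ℝ≥0∞}
    (hF : AEMeasurable F μ) : (∫⁻ a, F a ∂μ) ^ 2 ≤ μ Set.univ * ∫⁻ a, F a ^ 2 ∂μ := by
  have h := ENNReal.lintegral_mul_le_Lp_mul_Lq μ Real.HolderConjugate.two_two
    (aemeasurable_const (b := (1 : ℝ≥0∞))) hF
  have h2 : ∫⁻ a, F a ∂μ ≤ (μ Set.univ) ^ (1 / 2 : ℝ) * (∫⁻ a, F a ^ 2 ∂μ) ^ (1 / 2 : ℝ) := by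
    simpa using h
  calc (∫⁻ a, F a ∂μ) ^ 2
      ≤ ((μ Set.univ) ^ (1 / 2 : ℝ) * (∫⁻ a, F a ^ 2 ∂μ) ^ (1 / 2 : ℝ)) ^ 2 := by gcongr
    _ = _ := by
        rw [mul_pow, ← ENNReal.rpow_natCast, ← ENNReal.rpow_natCast, ← ENNReal.rpow_mul,
          ← ENNReal.rpow_mul]
        norm_num

theorem sq_lintegral_mul_le {α : Type*} [MeasurableSpace α] (μ : Measure α) {k F : α → ℝ≥0∞}
    (hk : Measurable k) (hF : Measurable F) :
    (∫⁻ a, k a * F a ∂μ) ^ 2 ≤ (∫⁻ a, k a ∂μ) * ∫⁻ a, k a * F a ^ 2 ∂μ := by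
  have h := sq_lintegral_le (μ.withDensity k) hF.aemeasurable
  rw [lintegral_withDensity_eq_lintegral_mul _ hk hF,
    lintegral_withDensity_eq_lintegral_mul _ hk (hF.pow_const 2)] at h
  simpa using h

/-- Schur's test with a weight. -/
theorem schur_test {k : ℝ → ℝ → ℝ≥0∞} (hk : Measurable (Function.uncurry k)) {w F : ℝ → ℝ≥0∞}
    (hw : Measurable w) (hF : Measurable F) {A B : ℝ≥0∞} (h1 : ∀ x, w x * ∫⁻ s, k x s ≤ A)
    (h2 : ∀ s, ∫⁻ x, w x * k x s ≤ B) :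
    ∫⁻ x, (w x * ∫⁻ s, k x s * F s) ^ 2 ≤ A * B * ∫⁻ s, F s ^ 2 := by
  have hkx : ∀ x, Measurable (k x) := fun x => hk.comp measurable_prodMk_left
  have step : ∀ x, (w x * ∫⁻ s, k x s * F s) ^ 2 ≤ A * ∫⁻ s, w x * k x s * F s ^ 2 := by
    intro x
    calc (w x * ∫⁻ s, k x s * F s) ^ 2
        = w x * w x * (∫⁻ s, k x s * F s) ^ 2 := by ring
      _ ≤ w x * w x * ((∫⁻ s, k x s) * ∫⁻ s, k x s * F s ^ 2) := by
          gcongr; exact sq_lintegral_mul_le _ (hkx x) hF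
      _ = (w x * ∫⁻ s, k x s) * (w x * ∫⁻ s, k x s * F s ^ 2) := by ring
      _ ≤ A * (w x * ∫⁻ s, k x s * F s ^ 2) := by gcongr; exact h1 x
      _ = A * ∫⁻ s, w x * k x s * F s ^ 2 := by
          congr 1
          simp only [mul_assoc]
          exact (lintegral_const_mul _ ((hkx x).mul (hF.pow_const 2))).symm
  have hm : Measurable (Function.uncurry fun x s => w x * k x s * F s ^ 2) :=
    ((hw.comp measurable_fst).mul hk).mul ((hF.comp measurable_snd).pow_const 2)
  calc ∫⁻ x, (w x * ∫⁻ s, k x s * F s) ^ 2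
      ≤ ∫⁻ x, A * ∫⁻ s, w x * k x s * F s ^ 2 := lintegral_mono step
    _ = A * ∫⁻ x, ∫⁻ s, w x * k x s * F s ^ 2 := by
        exact lintegral_const_mul _ hm.lintegral_prod_right'
    _ = A * ∫⁻ s, ∫⁻ x, w x * k x s * F s ^ 2 := by
        rw [lintegral_lintegral_swap hm.aemeasurable]
    _ ≤ A * ∫⁻ s, B * F s ^ 2 := by
        gcongr with s
        rw [lintegral_mul_const]
        · gcongr; exact h2 s
        · exact hw.mul (hk.comp measurable_prodMk_right)
    _ = _ := by rw [lintegral_const_mul _ (hF.pow_const 2), mul_assoc]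

theorem lintegral_exp_neg_abs_lt_top {c : ℝ} (hc : 0 < c) :
    ∫⁻ t : ℝ, ENNReal.ofReal (Real.exp (-(c * |t|))) < ⊤ := by
  have h1 : IntegrableOn (fun t : ℝ => Real.exp (-(c * |t|))) (Set.Ioi 0) := by
    refine (integrableOn_exp_mul_Ioi (neg_lt_zero.2 hc) 0).congr_fun (fun t ht => ?_)
      measurableSet_Ioi
    simp only [abs_of_pos (Set.mem_Ioi.1 ht)]; ring_nf
  have h2 : IntegrableOn (fun t : ℝ => Real.exp (-(c * |t|))) (Set.Iic 0) := by
    refine (integrableOn_exp_mul_Iic hc 0).congr_fun (fun t ht => ?_) measurableSet_Iic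
    simp only [abs_of_nonpos (Set.mem_Iic.1 ht)]; ring_nf
  have h3 := h2.union h1
  rw [Set.Iic_union_Ioi, integrableOn_univ] at h3
  exact h3.lintegral_lt_top

theorem lintegral_deriv_mul_comp_le {N n : ℝ → ℝ} (hN : ∀ x, HasDerivAt N (n x) x)
    (hn : ∀ x, 0 ≤ n x) (g : ℝ → ℝ≥0∞) :
    ∫⁻ x, ENNReal.ofReal (n x) * g (N x) ≤ ∫⁻ t, g t := by
  have hmono : Monotone N := monotone_of_deriv_nonneg (fun x => (hN x).differentiableAt)
    (fun x => by rw [(hN x).deriv]; exact hn x)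
  have h := lintegral_image_eq_lintegral_deriv_mul_of_monotoneOn MeasurableSet.univ
    (fun x _ => (hN x).hasDerivWithinAt) (hmono.monotoneOn _) g
  rw [Measure.restrict_univ] at h
  rw [← h]
  exact setLIntegral_le_lintegral _ _

section Kernel

variable {p p' : ℝ → ℝ} {v v' : ℝ → ℂ}

/-- Solving the equation `v' + p' v = f` from the point `z` to the point `x`. -/
theorem enorm_le_exp_kernel (hp : ∀ s, HasDerivAt p (p' s) s) (hv : ∀ s, HasDerivAt v (v' s) s)
    (hp'c : Continuous p') (hv'c : Continuous v') (x z : ℝ) :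
    ‖v x‖ₑ ≤ ENNReal.ofReal (Real.exp (p z - p x)) * ‖v z‖ₑ +
      ∫⁻ s in Set.uIoc x z, ENNReal.ofReal (Real.exp (p s - p x)) * ‖v' s + p' s * v s‖ₑ := by
  have hpc : Continuous p := continuous_iff_continuousAt.2 fun s => (hp s).continuousAt
  have hvc : Continuous v := continuous_iff_continuousAt.2 fun s => (hv s).continuousAt
  set w : ℝ → ℂ := fun s => ((Real.exp (p s - p x) : ℝ) : ℂ) * v s
  set w' : ℝ → ℂ := fun s => ((Real.exp (p s - p x) : ℝ) : ℂ) * (v' s + p' s * v s)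
  have hw : ∀ s, HasDerivAt w (w' s) s := by
    intro s
    have h1 : HasDerivAt (fun s => ((Real.exp (p s - p x) : ℝ) : ℂ))
        ((Real.exp (p s - p x) * p' s : ℝ) : ℂ) s := (((hp s).sub_const _).exp).ofReal_comp
    have h2 := h1.mul (hv s)
    refine h2.congr_deriv ?_
    simp only [w']; push_cast; ring
  have hw'c : Continuous w' := by fun_prop
  have hi := intervalIntegral.integral_eq_sub_of_hasDerivAt (a := x) (b := z)
    (fun s _ => hw s) (hw'c.intervalIntegrable _ _)
  have e1 : v x = w z - ∫ s in x..z, w' s := by rw [hi]; simp [w]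
  have he : ∀ s (c : ℂ), ‖((Real.exp (p s - p x) : ℝ) : ℂ) * c‖ₑ =
      ENNReal.ofReal (Real.exp (p s - p x)) * ‖c‖ₑ := by
    intro s c
    rw [enorm_mul]
    congr 1
    rw [← ofReal_norm, Complex.norm_real, Real.norm_of_nonneg (Real.exp_pos _).le]
  calc ‖v x‖ₑ = ‖w z - ∫ s in x..z, w' s‖ₑ := by rw [← e1]
    _ ≤ ‖w z‖ₑ + ‖∫ s in x..z, w' s‖ₑ := enorm_sub_le
    _ ≤ _ := by
      gcongr
      · exact (he z _).le
      · have : ‖∫ s in x..z, w' s‖ₑ = ‖∫ s in Set.uIoc x z, w' s‖ₑ := by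
          rw [← ofReal_norm, intervalIntegral.norm_integral_eq_norm_integral_uIoc,
            ofReal_norm]
        rw [this]
        refine (enorm_integral_le_lintegral_enorm _).trans (le_of_eq ?_)
        exact lintegral_congr fun s => he s _

theorem enorm_le_of_le_add (hp : ∀ s, HasDerivAt p (p' s) s) (hv : ∀ s, HasDerivAt v (v' s) s)
    (hp'c : Continuous p') (hv'c : Continuous v') {x z h : ℝ}
    (hle : ∀ s ∈ Set.uIcc x z, p s ≤ p x + h) :
    ‖v x‖ₑ ≤ ENNReal.ofReal (Real.exp h) * (‖v z‖ₑ +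
      ∫⁻ s in Set.uIoc x z, ‖v' s + p' s * v s‖ₑ) := by
  refine (enorm_le_exp_kernel hp hv hp'c hv'c x z).trans ?_
  rw [mul_add]
  gcongr
  · exact sub_le_iff_le_add'.2 (hle z Set.right_mem_uIcc)
  · rw [← lintegral_const_mul' _ _ ENNReal.ofReal_ne_top]
    refine setLIntegral_mono' measurableSet_uIoc fun s hs => ?_
    gcongr
    exact sub_le_iff_le_add'.2 (hle s (Set.uIoc_subset_uIcc hs))

/-- On `(a, b)`, no local minimum of `p` is separated from the two ends by barriers that are both
higher than `h`. -/
def NoDeepValley (p : ℝ → ℝ) (h a b : ℝ) : Prop :=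
  ∀ s x t, a < s → s < x → x < t → t < b → min (p s) (p t) ≤ p x + h

theorem NoDeepValley.left_or_right {h a b : ℝ} (H : NoDeepValley p h a b) (x : ℝ) :
    (∀ s, a < s → s < x → p s ≤ p x + h) ∨ (∀ t, x < t → t < b → p t ≤ p x + h) := by
  by_contra! hc
  obtain ⟨⟨s, h1, h2, h3⟩, t, h4, h5, h6⟩ := hc
  exact absurd (H s x t h1 h2 h4 h5) (not_le.2 (lt_min h3 h6))

/-- Without deep valleys, a drop of a polynomial is bounded by its variation up to a constant. -/
theorem NoDeepValley.exp_le (m : ℕ) : ∃ c : ℝ, 0 < c ∧ ∀ p : ℝ → ℝ, PolyLE m p →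
    ∀ a b h : ℝ, 0 ≤ h → NoDeepValley p h a b → ∀ s x, a < s → s < b → a < x → x < b →
      (∀ t, min s x < t → t < max s x → p t ≤ p x + h) → p s ≤ p x + h →
        p s - p x ≤ 3 * h - c * |(∫ t in s..x, |deriv p t|)| := by
  obtain ⟨K, hK, hder⟩ := PolyLE.exists_deriv_bound m
  refine ⟨K⁻¹, by positivity, ?_⟩
  intro p hp a b h hh H s x has hsb hax hxb hle hsx
  rcases eq_or_ne s x with rfl | hne
  · simp; linarith
  have hlt : min s x < max s x := by
    rcases lt_or_gt_of_ne hne with h | h <;> simp [h]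
  have hosc : ∀ t ∈ Set.Icc (min s x) (max s x), |p t - p s| ≤ p x - p s + 3 * h := by
    intro t ht
    rcases eq_or_ne t s with rfl | hts
    · simp; linarith
    rcases eq_or_ne t x with rfl | htx
    · rw [abs_le]; constructor <;> linarith
    have hlt' : min s x < t ∧ t < max s x := by
      rcases lt_or_gt_of_ne hne with h | h
      · rw [min_eq_left h.le, max_eq_right h.le] at *
        exact ⟨lt_of_le_of_ne ht.1 hts.symm, lt_of_le_of_ne ht.2 htx⟩
      · rw [min_eq_right h.le, max_eq_left h.le] at *
        exact ⟨lt_of_le_of_ne ht.1 htx.symm, lt_of_le_of_ne ht.2 hts⟩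
    have h1 := hle t hlt'.1 hlt'.2
    have h2 : min (p s) (p x) ≤ p t + h := by
      rcases lt_or_gt_of_ne hne with h | h
      · rw [min_eq_left h.le, max_eq_right h.le] at hlt'
        exact H s t x has hlt'.1 hlt'.2 hxb
      · rw [min_eq_right h.le, max_eq_left h.le] at hlt'
        rw [min_comm]
        exact H x t s hax hlt'.1 hlt'.2 hsb
    have h3 : p s - h ≤ min (p s) (p x) := le_min (by linarith) (by linarith)
    rw [abs_le]; constructor <;> linarith
  have hd := hder p hp _ _ hlt _ _ hosc
  have hpos : 0 < max s x - min s x := sub_pos.2 hlt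
  have hint : |(∫ t in s..x, |deriv p t|)| ≤ K * (p x - p s + 3 * h) := by
    have e : |(∫ t in s..x, |deriv p t|)| = ∫ t in (min s x)..(max s x), |deriv p t| := by
      rw [intervalIntegral.abs_integral_eq_abs_integral_uIoc, intervalIntegral.integral_of_le
        hlt.le, abs_of_nonneg]
      · rfl
      · exact integral_nonneg fun _ => abs_nonneg _
    rw [e]
    calc _ ≤ ∫ t in (min s x)..(max s x), K * (p x - p s + 3 * h) / (max s x - min s x) := by
          apply intervalIntegral.integral_mono_on hlt.le
          · exact (hp.deriv.continuous.abs).intervalIntegrable _ _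
          · simp
          · intro t ht
            rw [le_div_iff₀ hpos]
            exact hd t ht
      _ = _ := by simp; field_simp
  have : K⁻¹ * |(∫ t in s..x, |deriv p t|)| ≤ p x - p s + 3 * h := by
    rw [inv_mul_le_iff₀ (by positivity)]; exact hint
  linarith

/-- The weighted estimate for `d/dx + p'` on an interval where `p` has no deep valley. -/
theorem NoDeepValley.lintegral_le (m : ℕ) : ∃ C : ℝ≥0∞, C ≠ ⊤ ∧ ∀ p : ℝ → ℝ, PolyLE m p →
    ∀ a b : ℝ, NoDeepValley p 1 a b → ∀ v v' : ℝ → ℂ, (∀ s, HasDerivAt v (v' s) s) →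
      Continuous v' → (∀ s, s ∉ Set.Ioo a b → v s = 0) →
        ∫⁻ x, (‖deriv p x‖ₑ * ‖v x‖ₑ) ^ 2 ≤
          C * ∫⁻ x, ‖v' x + deriv p x * v x‖ₑ ^ 2 := by
  obtain ⟨c, hc, hexp⟩ := NoDeepValley.exp_le m
  obtain ⟨K, hK, hval⟩ := PolyLE.exists_value_bound m
  have hK0 : 0 < K := by positivity
  set A := ∫⁻ t : ℝ, ENNReal.ofReal (Real.exp (-((c / K) * |t|)))
  set B := ∫⁻ t : ℝ, ENNReal.ofReal (Real.exp (-(c * |t|)))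
  have hA : A < ⊤ := lintegral_exp_neg_abs_lt_top (by positivity)
  have hB : B < ⊤ := lintegral_exp_neg_abs_lt_top hc
  refine ⟨ENNReal.ofReal (Real.exp 3) ^ 2 * (A * B),
    ENNReal.mul_ne_top (by simp) (ENNReal.mul_ne_top hA.ne hB.ne), ?_⟩
  intro p hp a b H v v' hv hv'c hv0
  set q := deriv p with hq
  have hqP : PolyLE m q := hp.deriv
  have hqc : Continuous q := hqP.continuous
  have hpd : ∀ s, HasDerivAt p (q s) s := fun s => (hp.differentiable s).hasDerivAt
  have hvc : Continuous v := continuous_iff_continuousAt.2 fun s => (hv s).continuousAt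
  set N : ℝ → ℝ := fun x => ∫ t in (0 : ℝ)..x, |q t| with hN
  have hNd : ∀ x, HasDerivAt N |q x| x := fun x =>
    intervalIntegral.integral_hasDerivAt_right (hqc.abs.intervalIntegrable _ _)
      hqc.abs.aestronglyMeasurable.stronglyMeasurableAtFilter hqc.abs.continuousAt
  have hNc : Continuous N := continuous_iff_continuousAt.2 fun s => (hNd s).continuousAt
  have hNsub : ∀ s x, ∫ t in s..x, |q t| = N x - N s := fun s x => by
    rw [hN, intervalIntegral.integral_interval_sub_left] <;>
      exact hqc.abs.intervalIntegrable _ _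
  set k : ℝ → ℝ → ℝ≥0∞ := fun x s => ENNReal.ofReal (Real.exp (-(c * |N x - N s|))) with hk
  set F : ℝ → ℝ≥0∞ := fun s => ‖v' s + q s * v s‖ₑ
  have hpoint : ∀ x, ‖v x‖ₑ ≤ ENNReal.ofReal (Real.exp 3) * ∫⁻ s, k x s * F s := by
    intro x
    by_cases hx : x ∈ Set.Ioo a b
    swap
    · simp [hv0 x hx]
    have key : ∀ z, v z = 0 → (∀ s, s ∈ Set.uIoo x z → a < s ∧ s < b ∧ p s ≤ p x + 1) →
        ‖v x‖ₑ ≤ ENNReal.ofReal (Real.exp 3) * ∫⁻ s, k x s * F s := by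
      intro z hz hle
      have h1 := enorm_le_exp_kernel hpd hv hqc hv'c x z
      rw [hz, enorm_zero, mul_zero, zero_add] at h1
      refine h1.trans ?_
      have e : ∀ f : ℝ → ℝ≥0∞, ∫⁻ s in Set.uIoc x z, f s = ∫⁻ s in Set.uIoo x z, f s :=
        fun f => setLIntegral_congr (Ioo_ae_eq_Ioc.symm)
      rw [e, ← lintegral_const_mul' _ _ ENNReal.ofReal_ne_top]
      refine le_trans ?_ (setLIntegral_le_lintegral (Set.uIoo x z) _)
      refine setLIntegral_mono' measurableSet_Ioo fun s hs => ?_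
      rw [← mul_assoc]
      gcongr
      rw [hk, ← ENNReal.ofReal_mul (Real.exp_pos _).le, ← Real.exp_add]
      apply ENNReal.ofReal_le_ofReal
      apply Real.exp_le_exp.2
      obtain ⟨h2, h3, h4⟩ := hle s hs
      have h5 := hexp p hp a b 1 zero_le_one H s x h2 h3 hx.1 hx.2 (fun t ht1 ht2 => by
        refine (hle t ?_).2.2
        rcases le_total x z with hxz | hxz
        · rw [Set.uIoo_of_le hxz] at hs ⊢
          rw [max_eq_left hs.1.le] at ht2
          rw [min_eq_right hs.1.le] at ht1
          exact ⟨ht1, ht2.trans hs.2⟩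
        · rw [Set.uIoo_of_ge hxz] at hs ⊢
          rw [max_eq_right hs.2.le] at ht2
          rw [min_eq_left hs.2.le] at ht1
          exact ⟨hs.1.trans ht1, ht2⟩) h4
      rw [← hq, hNsub] at h5
      linarith
    rcases H.left_or_right x with h | h
    · refine key a (hv0 a (by simp)) fun s hs => ?_
      rw [Set.uIoo_of_ge hx.1.le] at hs
      exact ⟨hs.1, hs.2.trans hx.2, h s hs.1 hs.2⟩
    · refine key b (hv0 b (by simp)) fun s hs => ?_
      rw [Set.uIoo_of_le hx.2.le] at hs
      exact ⟨hx.1.trans hs.1, hs.2, h s hs.1 hs.2⟩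
  have hkm : Measurable (Function.uncurry k) := by
    apply Continuous.measurable
    simp only [hk, Function.uncurry_def]
    exact ENNReal.continuous_ofReal.comp (by fun_prop)
  have hFm : Measurable F := by
    apply Continuous.measurable
    fun_prop
  have hwe : ∀ x, ‖q x‖ₑ = ENNReal.ofReal |q x| := fun x => Real.enorm_eq_ofReal_abs _
  have hS := schur_test hkm (w := fun x => ‖q x‖ₑ) (by fun_prop) hFm (A := A) (B := B) ?_ ?_
  · calc ∫⁻ x, (‖q x‖ₑ * ‖v x‖ₑ) ^ 2
        ≤ ∫⁻ x, ENNReal.ofReal (Real.exp 3) ^ 2 * (‖q x‖ₑ * ∫⁻ s, k x s * F s) ^ 2 := by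
          refine lintegral_mono fun x => ?_
          rw [← mul_pow]
          refine pow_le_pow_left' ?_ 2
          calc _ ≤ ‖q x‖ₑ * (ENNReal.ofReal (Real.exp 3) * ∫⁻ s, k x s * F s) := by
                gcongr; exact hpoint x
            _ = _ := by ring
      _ = ENNReal.ofReal (Real.exp 3) ^ 2 * ∫⁻ x, (‖q x‖ₑ * ∫⁻ s, k x s * F s) ^ 2 := by
          rw [lintegral_const_mul' _ _ (by simp)]
      _ ≤ ENNReal.ofReal (Real.exp 3) ^ 2 * (A * B * ∫⁻ x, F x ^ 2) := by gcongr
      _ = _ := by rw [← mul_assoc]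
  · intro x
    have hb : ∀ s, k x s ≤ ENNReal.ofReal (Real.exp (-((c / K) * |(|q x| * (s - x))|))) := by
      intro s
      apply ENNReal.ofReal_le_ofReal
      apply Real.exp_le_exp.2
      have : |q x| * |s - x| ≤ K * |N x - N s| := by
        rcases lt_trichotomy s x with h | h | h
        · have h1 := hval q hqP s x h 1 le_rfl x (by rw [abs_of_pos (sub_pos.2 h), one_mul])
          rw [hNsub] at h1
          have h2 : 0 < x - s := sub_pos.2 h
          rw [abs_sub_comm, abs_of_pos h2]
          calc _ ≤ (K * 1 ^ m * ((x - s)⁻¹ * (N x - N s))) * (x - s) := by gcongr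
            _ = K * (N x - N s) := by field_simp; simp
            _ ≤ _ := by gcongr; exact le_abs_self _
        · simp [h]
        · have h1 := hval q hqP x s h 1 le_rfl x (by simp; exact h.le)
          rw [hNsub] at h1
          have h2 : 0 < s - x := sub_pos.2 h
          rw [abs_of_pos h2]
          calc _ ≤ (K * 1 ^ m * ((s - x)⁻¹ * (N s - N x))) * (s - x) := by gcongr
            _ = K * (N s - N x) := by field_simp; simp
            _ ≤ _ := by gcongr; rw [abs_sub_comm]; exact le_abs_self _
      rw [abs_mul, abs_abs, neg_le_neg_iff, div_mul_eq_mul_div, div_le_iff₀ hK0]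
      nlinarith
    calc ‖q x‖ₑ * ∫⁻ s, k x s = ∫⁻ s, ENNReal.ofReal |q x| * k x s := by
          rw [hwe, lintegral_const_mul' _ _ ENNReal.ofReal_ne_top]
      _ ≤ ∫⁻ s, ENNReal.ofReal |q x| *
            ENNReal.ofReal (Real.exp (-((c / K) * |(|q x| * (s - x))|))) := by
          gcongr with s; exact hb s
      _ ≤ A := by
          refine lintegral_deriv_mul_comp_le (N := fun s => |q x| * (s - x)) (fun s => ?_)
            (fun _ => abs_nonneg _) (fun t => ENNReal.ofReal (Real.exp (-((c / K) * |t|))))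
          simpa using ((hasDerivAt_id s).sub_const x).const_mul |q x|
  · intro s
    calc ∫⁻ x, ‖q x‖ₑ * k x s = ∫⁻ x, ENNReal.ofReal |q x| * k x s := by simp only [hwe]
      _ ≤ B := by
          refine (lintegral_deriv_mul_comp_le (N := fun x => N x - N s)
            (fun x => (hNd x).sub_const _) (fun _ => abs_nonneg _)
            (fun t => ENNReal.ofReal (Real.exp (-(c * |t|)))))

end Kernel

theorem exists_smoothTransition_deriv_bound :
    ∃ B : ℝ, 0 < B ∧ ∀ x, |deriv Real.smoothTransition x| ≤ B := by
  have hc : Continuous (deriv Real.smoothTransition) :=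
    (Real.smoothTransition.contDiff (n := 1)).continuous_deriv le_rfl
  obtain ⟨B, hB⟩ := (isCompact_Icc (a := (0 : ℝ)) (b := 1)).exists_bound_of_continuousOn
    hc.continuousOn
  refine ⟨max B 1, by positivity, fun x => ?_⟩
  by_cases hx : x ∈ Set.Icc (0 : ℝ) 1
  · exact (hB x hx).trans (le_max_left _ _)
  · have : deriv Real.smoothTransition x = 0 := by
      rw [Set.mem_Icc, not_and_or, not_le, not_le] at hx
      rcases hx with h | h
      · have : Real.smoothTransition =ᶠ[nhds x] fun _ => 0 := by
          filter_upwards [Iio_mem_nhds h] with y hy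
          exact Real.smoothTransition.zero_of_nonpos (le_of_lt hy)
        rw [this.deriv_eq]; simp
      · have : Real.smoothTransition =ᶠ[nhds x] fun _ => 1 := by
          filter_upwards [Ioi_mem_nhds h] with y hy
          exact Real.smoothTransition.one_of_one_le (le_of_lt hy)
        rw [this.deriv_eq]; simp
    rw [this]; simp

theorem ENNReal.add_sq_le (a b : ℝ≥0∞) : (a + b) ^ 2 ≤ 2 * (a ^ 2 + b ^ 2) := by
  have h := ENNReal.rpow_add_le_mul_rpow_add_rpow a b (p := 2) (by norm_num)
  have e : (2 : ℝ≥0∞) ^ ((2 : ℝ) - 1) = 2 := by norm_num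
  rw [e] at h
  exact_mod_cast h

/-- The weighted estimate for a function cut off near the bottom of the valley. -/
theorem lintegral_cutoff_le {v v' : ℝ → ℂ} (hv : ∀ s, HasDerivAt v (v' s) s) (hv'c : Continuous v')
    {q χ χ' : ℝ → ℝ} (hq : Continuous q) (hχ : ∀ s, HasDerivAt χ (χ' s) s) (hχ'c : Continuous χ')
    (h01 : ∀ s, |χ s| ≤ 1) {J : Set ℝ} (hJ : MeasurableSet J) {B : ℝ} (hB : ∀ s, |χ' s| ≤ B)
    (hB0 : ∀ s, s ∉ J → χ' s = 0) {C : ℝ≥0∞}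
    (hC : ∀ w w' : ℝ → ℂ, (∀ s, HasDerivAt w (w' s) s) → Continuous w' →
      (∀ s, w s = χ s * v s) →
        ∫⁻ x, (‖q x‖ₑ * ‖w x‖ₑ) ^ 2 ≤ C * ∫⁻ x, ‖w' x + q x * w x‖ₑ ^ 2) :
    ∫⁻ x, (‖q x‖ₑ * ‖(χ x : ℂ) * v x‖ₑ) ^ 2 ≤ C * (2 * (∫⁻ x, ‖v' x + q x * v x‖ₑ ^ 2) +
      2 * (ENNReal.ofReal B ^ 2 * ∫⁻ x in J, ‖v x‖ₑ ^ 2)) := by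
  have hvc : Continuous v := continuous_iff_continuousAt.2 fun s => (hv s).continuousAt
  have hχc : Continuous χ := continuous_iff_continuousAt.2 fun s => (hχ s).continuousAt
  refine (hC (fun x => χ x * v x) (fun x => χ' x * v x + χ x * v' x)
    (fun s => (hχ s).ofReal_comp.mul (hv s)) (by fun_prop) (fun _ => rfl)).trans ?_
  gcongr
  have e : ∀ x, ‖(χ' x * v x + χ x * v' x) + q x * (χ x * v x)‖ₑ ^ 2 ≤
      2 * ‖v' x + q x * v x‖ₑ ^ 2 +
        J.indicator (fun x => 2 * (ENNReal.ofReal B ^ 2 * ‖v x‖ₑ ^ 2)) x := by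
    intro x
    have h1 : (χ' x * v x + χ x * v' x) + q x * (χ x * v x) =
      (χ x : ℂ) * (v' x + q x * v x) + χ' x * v x := by ring
    have h2 : ‖(χ x : ℂ)‖ₑ ≤ 1 := by
      rw [← ofReal_norm, Complex.norm_real, Real.norm_eq_abs]
      simpa using h01 x
    have h3 : ‖(χ' x : ℂ)‖ₑ ≤ ENNReal.ofReal B := by
      rw [← ofReal_norm, Complex.norm_real, Real.norm_eq_abs]
      exact ENNReal.ofReal_le_ofReal (hB x)
    rw [h1]
    by_cases hx : x ∈ J
    · rw [Set.indicator_of_mem hx, ← mul_add]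
      calc _ ≤ (‖(χ x : ℂ) * (v' x + q x * v x)‖ₑ + ‖(χ' x : ℂ) * v x‖ₑ) ^ 2 := by
            gcongr; exact enorm_add_le _ _
        _ ≤ (1 * ‖v' x + q x * v x‖ₑ + ENNReal.ofReal B * ‖v x‖ₑ) ^ 2 := by
            rw [enorm_mul, enorm_mul]; gcongr
        _ ≤ _ := by
            rw [one_mul, ← mul_pow]
            exact ENNReal.add_sq_le _ _
    · rw [Set.indicator_of_notMem hx, hB0 x hx]
      simp only [Complex.ofReal_zero, zero_mul, add_zero]
      rw [enorm_mul]
      calc _ ≤ (1 * ‖v' x + q x * v x‖ₑ) ^ 2 := by gcongr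
        _ ≤ _ := by rw [one_mul]; exact le_mul_of_one_le_left (by simp) (by norm_num)
  refine (lintegral_mono e).trans (le_of_eq ?_)
  rw [lintegral_add_left, lintegral_indicator hJ, lintegral_const_mul', lintegral_const_mul',
    lintegral_const_mul']
  · exact ENNReal.pow_ne_top ENNReal.ofReal_ne_top
  · simp
  · simp
  · exact (Measurable.pow_const (Continuous.measurable (by fun_prop)) 2).const_mul 2

/-- The weighted estimate for `d/dx + p'` when the only deep valley of `p` is at `r`. -/
theorem lintegral_valley_le (m : ℕ) : ∃ C : ℝ≥0∞, C ≠ ⊤ ∧ ∀ p : ℝ → ℝ, PolyLE m p →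
    ∀ a r b ρ : ℝ, NoDeepValley p 1 a r → NoDeepValley p 1 r b → 0 < ρ →
      ∫ s in (r - ρ)..(r + ρ), |deriv p s| ≤ 1 →
      ∀ v v' : ℝ → ℂ, (∀ s, HasDerivAt v (v' s) s) →
        Continuous v' → (∀ s, s ∉ Set.Ioo a b → v s = 0) →
          ∫⁻ x, (‖deriv p x‖ₑ * ‖v x‖ₑ) ^ 2 ≤
            C * ((∫⁻ x, ‖v' x + deriv p x * v x‖ₑ ^ 2) +
              ENNReal.ofReal ρ⁻¹ ^ 2 * ∫⁻ x in Set.Icc (r - ρ) (r + ρ), ‖v x‖ₑ ^ 2) := by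
  obtain ⟨C, hC, h⟩ := NoDeepValley.lintegral_le m
  obtain ⟨K, hK, hval⟩ := PolyLE.exists_value_bound m
  obtain ⟨B, hB0, hB⟩ := exists_smoothTransition_deriv_bound
  refine ⟨4 * C + (4 * C * ENNReal.ofReal B ^ 2 + ENNReal.ofReal K ^ 2), ?_, ?_⟩
  · simp [hC, ENNReal.add_eq_top, ENNReal.mul_eq_top]
  intro p hp a r b ρ H1 H2 hρ hint v v' hv hv'c hv0
  set q := deriv p with hq
  have hqP : PolyLE m q := hp.deriv
  have hqc : Continuous q := hqP.continuous
  have hvc : Continuous v := continuous_iff_continuousAt.2 fun s => (hv s).continuousAt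
  set J := Set.Icc (r - ρ) (r + ρ) with hJ
  set V := ∫⁻ x, ‖v' x + q x * v x‖ₑ ^ 2
  set S := ∫⁻ x in J, ‖v x‖ₑ ^ 2
  have hcut : ∀ σ : ℝ, (σ = 1 ∨ σ = -1) →
      ∫⁻ x, (‖q x‖ₑ * ‖((Real.smoothTransition (σ * (x - r) / ρ) : ℝ) : ℂ) * v x‖ₑ) ^ 2 ≤
        C * (2 * V + 2 * (ENNReal.ofReal (B / ρ) ^ 2 * S)) := by
    intro σ hσ
    have hσ1 : |σ| = 1 := by rcases hσ with rfl | rfl <;> simp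
    have hd : ∀ s, HasDerivAt (fun x => Real.smoothTransition (σ * (x - r) / ρ))
        (deriv Real.smoothTransition (σ * (s - r) / ρ) * (σ / ρ)) s := by
      intro s
      have h1 : HasDerivAt Real.smoothTransition
          (deriv Real.smoothTransition (σ * (s - r) / ρ)) (σ * (s - r) / ρ) :=
        ((Real.smoothTransition.contDiff (n := 1)).differentiable (by simp) _).hasDerivAt
      have h2 : HasDerivAt (fun x => σ * (x - r) / ρ) (σ / ρ) s := by
        simpa using (((hasDerivAt_id s).sub_const r).const_mul σ).div_const ρ
      exact h1.comp s h2
    refine lintegral_cutoff_le hv hv'c hqc hd ?_ ?_ (J := J) measurableSet_Icc (B := B / ρ)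
      ?_ ?_ ?_
    · have : Continuous (deriv Real.smoothTransition) :=
        (Real.smoothTransition.contDiff (n := 1)).continuous_deriv le_rfl
      fun_prop
    · intro s
      rw [abs_of_nonneg (Real.smoothTransition.nonneg _)]
      exact Real.smoothTransition.le_one _
    · intro s
      rw [abs_mul, abs_div, hσ1, abs_of_pos hρ, mul_one_div]
      gcongr
      exact hB _
    · intro s hs
      have hs' : ¬ |s - r| ≤ ρ := by
        rw [abs_le]; rintro ⟨h1, h2⟩; exact hs ⟨by linarith, by linarith⟩
      have : deriv Real.smoothTransition (σ * (s - r) / ρ) = 0 := by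
        have h3 : 1 < |σ * (s - r) / ρ| := by
          rw [abs_div, abs_mul, hσ1, one_mul, abs_of_pos hρ, one_lt_div hρ]
          exact not_le.1 hs'
        rcases lt_abs.1 h3 with h4 | h4
        · have : Real.smoothTransition =ᶠ[nhds (σ * (s - r) / ρ)] fun _ => 1 := by
            filter_upwards [Ioi_mem_nhds h4] with y hy
            exact Real.smoothTransition.one_of_one_le (le_of_lt hy)
          rw [this.deriv_eq]; simp
        · have : Real.smoothTransition =ᶠ[nhds (σ * (s - r) / ρ)] fun _ => 0 := by
            filter_upwards [Iio_mem_nhds (show σ * (s - r) / ρ < 0 by linarith)] with y hy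
            exact Real.smoothTransition.zero_of_nonpos (le_of_lt hy)
          rw [this.deriv_eq]; simp
      rw [this, zero_mul]
    · intro w w' hw hw'c hwe
      rcases hσ with rfl | rfl
      · refine h p hp r b H2 w w' hw hw'c fun s hs => ?_
        rw [hwe]
        by_cases h1 : r < s
        · rw [hv0 s (fun h2 => hs ⟨h1, h2.2⟩), mul_zero]
        · rw [Real.smoothTransition.zero_of_nonpos, Complex.ofReal_zero, zero_mul]
          exact div_nonpos_of_nonpos_of_nonneg (by linarith) hρ.le
      · refine h p hp a r H1 w w' hw hw'c fun s hs => ?_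
        rw [hwe]
        by_cases h1 : s < r
        · rw [hv0 s (fun h2 => hs ⟨h2.1, h1⟩), mul_zero]
        · rw [Real.smoothTransition.zero_of_nonpos, Complex.ofReal_zero, zero_mul]
          exact div_nonpos_of_nonpos_of_nonneg (by linarith) hρ.le
  have hsplit : ∀ x, (‖q x‖ₑ * ‖v x‖ₑ) ^ 2 ≤
      ((‖q x‖ₑ * ‖((Real.smoothTransition (1 * (x - r) / ρ) : ℝ) : ℂ) * v x‖ₑ) ^ 2 +
      (‖q x‖ₑ * ‖((Real.smoothTransition (-1 * (x - r) / ρ) : ℝ) : ℂ) * v x‖ₑ) ^ 2) +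
      J.indicator (fun x => ENNReal.ofReal (K / ρ) ^ 2 * ‖v x‖ₑ ^ 2) x := by
    intro x
    by_cases hx : x ∈ J
    · rw [Set.indicator_of_mem hx]
      refine le_add_left ?_
      rw [← mul_pow]
      gcongr
      rw [Real.enorm_eq_ofReal_abs]
      apply ENNReal.ofReal_le_ofReal
      have h1 := hval q hqP (r - ρ) (r + ρ) (by linarith) 1 le_rfl x (by
        rw [abs_of_nonneg (by linarith [hx.1])]; linarith [hx.2])
      have h2 : r + ρ - (r - ρ) = 2 * ρ := by ring
      rw [h2] at h1
      calc |q x| ≤ K * 1 ^ m * ((2 * ρ)⁻¹ * ∫ s in (r - ρ)..(r + ρ), |q s|) := h1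
        _ ≤ K * 1 ^ m * ((2 * ρ)⁻¹ * 1) := by gcongr
        _ = (K / ρ) / 2 := by rw [one_pow]; field_simp
        _ ≤ K / ρ := half_le_self (by positivity)
    · refine le_add_right ?_
      have hx' : ¬ |x - r| ≤ ρ := by
        rw [abs_le]; rintro ⟨h1, h2⟩; exact hx ⟨by linarith, by linarith⟩
      rcases lt_abs.1 (not_le.1 hx') with h4 | h4
      · refine le_add_right (le_of_eq ?_)
        rw [Real.smoothTransition.one_of_one_le, Complex.ofReal_one, one_mul]
        rw [one_mul, one_le_div hρ]; exact h4.le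
      · refine le_add_left (le_of_eq ?_)
        rw [Real.smoothTransition.one_of_one_le, Complex.ofReal_one, one_mul]
        rw [one_le_div hρ]; linarith
  have hst : Continuous Real.smoothTransition :=
    (Real.smoothTransition.contDiff (n := 0)).continuous
  have hm : ∀ σ : ℝ, Measurable fun x =>
      (‖q x‖ₑ * ‖((Real.smoothTransition (σ * (x - r) / ρ) : ℝ) : ℂ) * v x‖ₑ) ^ 2 := by
    intro σ
    have h1 : Measurable fun x => ‖q x‖ₑ := Continuous.measurable (by fun_prop)
    have h2 : Measurable fun x =>
        ‖((Real.smoothTransition (σ * (x - r) / ρ) : ℝ) : ℂ) * v x‖ₑ :=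
      Continuous.measurable (by fun_prop)
    exact (h1.mul h2).pow_const 2
  have hmulB : ENNReal.ofReal (B / ρ) = ENNReal.ofReal B * ENNReal.ofReal ρ⁻¹ := by
    rw [← ENNReal.ofReal_mul hB0.le]; rfl
  have hmulK : ENNReal.ofReal (K / ρ) = ENNReal.ofReal K * ENNReal.ofReal ρ⁻¹ := by
    rw [← ENNReal.ofReal_mul (by positivity)]; rfl
  set R := ENNReal.ofReal ρ⁻¹
  calc ∫⁻ x, (‖q x‖ₑ * ‖v x‖ₑ) ^ 2
      ≤ C * (2 * V + 2 * (ENNReal.ofReal (B / ρ) ^ 2 * S)) +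
        C * (2 * V + 2 * (ENNReal.ofReal (B / ρ) ^ 2 * S)) +
        ENNReal.ofReal (K / ρ) ^ 2 * S := by
        refine (lintegral_mono hsplit).trans ?_
        have hm2 := (hm 1).add (hm (-1))
        simp only [Pi.add_def] at hm2
        rw [lintegral_add_left hm2, lintegral_add_left (hm 1),
          lintegral_indicator measurableSet_Icc, lintegral_const_mul']
        · gcongr
          · exact hcut 1 (Or.inl rfl)
          · exact hcut (-1) (Or.inr rfl)
        · exact ENNReal.pow_ne_top ENNReal.ofReal_ne_top
    _ = 4 * C * V + (4 * C * ENNReal.ofReal B ^ 2 + ENNReal.ofReal K ^ 2) * (R ^ 2 * S) := by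
        rw [hmulB, hmulK]; ring
    _ ≤ _ := by
        rw [mul_add]
        exact add_le_add (mul_le_mul' le_self_add le_rfl) (mul_le_mul' le_add_self le_rfl)

/-- Bounded open intervals with rational endpoints and length at most `8`. -/
abbrev RatInterval : Type := {p : ℚ × ℚ // p.1 < p.2 ∧ p.2 ≤ p.1 + 8}

namespace RatInterval

/-- The interval as a set of reals. -/
def toSet (i : RatInterval) : Set ℝ := Set.Ioo (i.1.1 : ℝ) i.1.2

/-- The length of the interval. -/
noncomputable def length (i : RatInterval) : ℝ := i.1.2 - i.1.1

theorem length_pos (i : RatInterval) : 0 < i.length := by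
  have : (i.1.1 : ℝ) < i.1.2 := by exact_mod_cast i.2.1
  simpa [length] using this

theorem length_le (i : RatInterval) : i.length ≤ 8 := by
  have : (i.1.2 : ℝ) ≤ i.1.1 + 8 := by exact_mod_cast i.2.2
  simp only [length]; linarith

theorem toSet_eq_ball (i : RatInterval) :
    i.toSet = Metric.ball (((i.1.1 : ℝ) + i.1.2) / 2) (i.length / 2) := by
  rw [Real.ball_eq_Ioo, toSet, length]
  congr 1 <;> ring

theorem measurableSet (i : RatInterval) : MeasurableSet i.toSet := measurableSet_Ioo

end RatInterval

/-- The Hardy-Littlewood maximal function over intervals of bounded length. -/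
noncomputable def maxFn (f : ℝ → ℝ≥0∞) (y : ℝ) : ℝ≥0∞ :=
  ⨆ i : RatInterval, i.toSet.indicator
    (fun _ => (∫⁻ s in i.toSet, f s) / ENNReal.ofReal i.length) y

theorem measurable_maxFn (f : ℝ → ℝ≥0∞) : Measurable (maxFn f) :=
  Measurable.iSup fun i => measurable_const.indicator i.measurableSet

theorem setLIntegral_le_maxFn (f : ℝ → ℝ≥0∞) {a b y : ℝ} (hab : a < b) (h4 : b - a ≤ 4)
    (hy : y ∈ Set.Icc a b) :
    ∫⁻ s in Set.Icc a b, f s ≤ ENNReal.ofReal (2 * (b - a)) * maxFn f y := by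
  obtain ⟨p, hp1, hp2⟩ := exists_rat_btwn (show a - (b - a) / 2 < a by linarith)
  obtain ⟨q, hq1, hq2⟩ := exists_rat_btwn (show b < b + (b - a) / 2 by linarith)
  have h1 : p < q := by exact_mod_cast (show (p : ℝ) < q by linarith)
  have h2 : q ≤ p + 8 := by exact_mod_cast (show (q : ℝ) ≤ p + 8 by linarith)
  set i : RatInterval := ⟨(p, q), h1, h2⟩
  have hl : i.length = q - p := rfl
  have hle : (∫⁻ s in i.toSet, f s) / ENNReal.ofReal i.length ≤ maxFn f y := by
    refine le_trans ?_ (le_iSup _ i)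
    rw [Set.indicator_of_mem]
    exact ⟨hp2.trans_le hy.1, hy.2.trans_lt hq1⟩
  rw [ENNReal.div_le_iff (by simpa using i.length_pos) ENNReal.ofReal_ne_top] at hle
  calc ∫⁻ s in Set.Icc a b, f s ≤ ∫⁻ s in i.toSet, f s :=
        lintegral_mono_set (Set.Icc_subset_Ioo hp2 hq1)
    _ ≤ maxFn f y * ENNReal.ofReal i.length := hle
    _ ≤ _ := by
        rw [mul_comm]
        gcongr
        rw [hl]; linarith

theorem meas_maxFn_lt_le {f : ℝ → ℝ≥0∞} (hf : Measurable f) {l : ℝ} (hl : 0 < l) :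
    ENNReal.ofReal l * volume {y | ENNReal.ofReal l < maxFn f y} ≤
      8 * ∫⁻ y, {y | ENNReal.ofReal (l / 2) < f y}.indicator f y := by
  set g := {y | ENNReal.ofReal (l / 2) < f y}.indicator f with hg
  have hgm : Measurable g := hf.indicator (measurableSet_lt measurable_const hf)
  set t : Set RatInterval :=
    {i | ENNReal.ofReal l < (∫⁻ s in i.toSet, f s) / ENNReal.ofReal i.length}
  obtain ⟨u, hut, hdisj, hcov⟩ := Vitali.exists_disjoint_subfamily_covering_enlargement_ball t
    (fun i : RatInterval => ((i.1.1 : ℝ) + i.1.2) / 2) (fun i => i.length / 2) 4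
    (fun i _ => by linarith [i.length_le]) 4 (by norm_num)
  simp only [← RatInterval.toSet_eq_ball] at hdisj hcov
  have hsub : {y | ENNReal.ofReal l < maxFn f y} ⊆
      ⋃ i ∈ u, Metric.ball (((i.1.1 : ℝ) + i.1.2) / 2) (4 * (i.length / 2)) := by
    intro y hy
    obtain ⟨i, hi⟩ := lt_iSup_iff.1 (show ENNReal.ofReal l < maxFn f y from hy)
    have hyi : y ∈ i.toSet := by
      by_contra h
      rw [Set.indicator_of_notMem h] at hi
      simp at hi
    rw [Set.indicator_of_mem hyi] at hi
    obtain ⟨j, hj, hij⟩ := hcov i hi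
    exact Set.mem_biUnion hj (hij hyi)
  have hone : ∀ i ∈ u, ENNReal.ofReal l * volume (Metric.ball (((i.1.1 : ℝ) + i.1.2) / 2)
      (4 * (i.length / 2))) ≤ 8 * ∫⁻ s in i.toSet, g s := by
    intro i hi
    have h1 : ENNReal.ofReal l * ENNReal.ofReal i.length < ∫⁻ s in i.toSet, f s := by
      have := hut hi
      exact (ENNReal.lt_div_iff_mul_lt (Or.inl (by simpa using i.length_pos))
        (Or.inl ENNReal.ofReal_ne_top)).1 this
    have h2 : ∫⁻ s in i.toSet, f s ≤ (∫⁻ s in i.toSet, g s) +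
        ENNReal.ofReal (l / 2) * ENNReal.ofReal i.length := by
      have : ∀ s, f s ≤ g s + ENNReal.ofReal (l / 2) := by
        intro s
        by_cases h : ENNReal.ofReal (l / 2) < f s
        · rw [hg, Set.indicator_of_mem (by exact h)]; exact le_self_add
        · exact (not_lt.1 h).trans le_add_self
      calc _ ≤ ∫⁻ s in i.toSet, (g s + ENNReal.ofReal (l / 2)) := lintegral_mono this
        _ = _ := by
          rw [lintegral_add_left hgm, setLIntegral_const]
          congr 2
          rw [RatInterval.toSet, Real.volume_Ioo]; rfl
    have h3 : ENNReal.ofReal l = ENNReal.ofReal (l / 2) + ENNReal.ofReal (l / 2) := by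
      rw [← ENNReal.ofReal_add (by positivity) (by positivity)]; ring_nf
    have h4 : ENNReal.ofReal (l / 2) * ENNReal.ofReal i.length ≤ ∫⁻ s in i.toSet, g s := by
      have h5 := h1.le.trans h2
      rw [h3, add_mul] at h5
      exact (ENNReal.add_le_add_iff_right
        (ENNReal.mul_ne_top ENNReal.ofReal_ne_top ENNReal.ofReal_ne_top)).1 h5
    rw [Real.volume_ball]
    calc _ = 8 * (ENNReal.ofReal (l / 2) * ENNReal.ofReal i.length) := by
          rw [← ENNReal.ofReal_mul hl.le, ← ENNReal.ofReal_mul (by positivity),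
            show (8 : ℝ≥0∞) = ENNReal.ofReal 8 by norm_num, ← ENNReal.ofReal_mul (by norm_num)]
          congr 1; ring
      _ ≤ _ := by gcongr
  have hc : u.Countable := Set.to_countable u
  calc ENNReal.ofReal l * volume {y | ENNReal.ofReal l < maxFn f y}
      ≤ ENNReal.ofReal l * ∑' i : u, volume (Metric.ball (((i.1.1.1 : ℝ) + i.1.1.2) / 2)
          (4 * (i.1.length / 2))) := by
        gcongr
        exact (measure_mono hsub).trans (measure_biUnion_le _ hc _)
    _ = ∑' i : u, ENNReal.ofReal l * volume (Metric.ball (((i.1.1.1 : ℝ) + i.1.1.2) / 2)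
          (4 * (i.1.length / 2))) := ENNReal.tsum_mul_left.symm
    _ ≤ ∑' i : u, 8 * ∫⁻ s in i.1.toSet, g s := ENNReal.tsum_le_tsum fun i => hone i.1 i.2
    _ = 8 * ∑' i : u, ∫⁻ s in i.1.toSet, g s := ENNReal.tsum_mul_left
    _ = 8 * ∫⁻ s in ⋃ i ∈ u, RatInterval.toSet i, g s := by
        rw [lintegral_biUnion hc (fun i _ => i.measurableSet) hdisj]
    _ ≤ _ := by gcongr; exact Measure.restrict_le_self

theorem sq_le_lintegral_layer (a : ℝ≥0∞) :
    a ^ 2 ≤ ∫⁻ l in Set.Ioi (0 : ℝ), ENNReal.ofReal (2 * l) *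
      {l : ℝ | ENNReal.ofReal l < a}.indicator 1 l := by
  have key : ∀ A : NNReal, (A : ℝ≥0∞) ≤ a → (A : ℝ≥0∞) ^ 2 ≤
      ∫⁻ l in Set.Ioi (0 : ℝ), ENNReal.ofReal (2 * l) *
        {l : ℝ | ENNReal.ofReal l < a}.indicator 1 l := by
    intro A hA
    have h1 : ∫ l in Set.Ioo (0 : ℝ) A, 2 * l = (A : ℝ) ^ 2 := by
      rw [← integral_Ioc_eq_integral_Ioo, ← intervalIntegral.integral_of_le A.coe_nonneg,
        intervalIntegral.integral_const_mul, integral_id]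
      ring
    have h2 : (A : ℝ≥0∞) ^ 2 = ∫⁻ l in Set.Ioo (0 : ℝ) A, ENNReal.ofReal (2 * l) := by
      rw [← ofReal_integral_eq_lintegral_ofReal, h1, ENNReal.ofReal_pow A.coe_nonneg,
        ENNReal.ofReal_coe_nnreal]
      · exact (Continuous.integrableOn_Icc (by fun_prop)).mono_set Set.Ioo_subset_Icc_self
      · filter_upwards [ae_restrict_mem measurableSet_Ioo] with l hl
        have := hl.1
        simp; linarith
    rw [h2]
    calc _ = ∫⁻ l in Set.Ioo (0 : ℝ) A, ENNReal.ofReal (2 * l) *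
          {l : ℝ | ENNReal.ofReal l < a}.indicator 1 l := by
          refine setLIntegral_congr_fun measurableSet_Ioo fun l hl => ?_
          have : ENNReal.ofReal l < a := by
            refine lt_of_lt_of_le ?_ hA
            rw [← ENNReal.ofReal_coe_nnreal]
            exact (ENNReal.ofReal_lt_ofReal_iff (hl.1.trans hl.2)).2 hl.2
          simp [this]
      _ ≤ _ := lintegral_mono_set fun l hl => hl.1
  rcases eq_or_ne a ⊤ with rfl | ha
  · have : ∫⁻ l in Set.Ioi (0 : ℝ), ENNReal.ofReal (2 * l) *
        {l : ℝ | ENNReal.ofReal l < ⊤}.indicator 1 l = ⊤ := by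
      refine ENNReal.eq_top_of_forall_nnreal_le fun r => ?_
      refine le_trans ?_ (key (r + 1) le_top)
      have : r ≤ (r + 1) ^ 2 := by nlinarith [r.2]
      exact_mod_cast this
    rw [this]; exact le_top
  · lift a to NNReal using ha
    exact key a le_rfl

theorem lintegral_indicator_half_lt_le (a : ℝ≥0∞) :
    ∫⁻ l in Set.Ioi (0 : ℝ), {l : ℝ | ENNReal.ofReal (l / 2) < a}.indicator 1 l ≤ 2 * a := by
  rcases eq_or_ne a ⊤ with rfl | ha
  · simp
  lift a to NNReal using ha
  rw [lintegral_indicator_one]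
  · rw [Measure.restrict_apply']
    · calc _ ≤ volume (Set.Ioo (0 : ℝ) (2 * a)) := by
            refine measure_mono fun l hl => ⟨hl.2, ?_⟩
            have h1 : ENNReal.ofReal (l / 2) < a := hl.1
            have h2 : 0 < l := hl.2
            rw [← ENNReal.ofReal_coe_nnreal] at h1
            have := (ENNReal.ofReal_lt_ofReal_iff_of_nonneg (by positivity)).1 h1
            linarith
        _ = _ := by
            rw [Real.volume_Ioo, sub_zero, ENNReal.ofReal_mul (by norm_num)]; simp
    · exact measurableSet_Ioi
  · exact measurableSet_lt (by fun_prop) measurable_const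

/-- The maximal function is bounded on `L²`. -/
theorem lintegral_maxFn_sq_le {f : ℝ → ℝ≥0∞} (hf : Measurable f) :
    ∫⁻ y, maxFn f y ^ 2 ≤ 32 * ∫⁻ y, f y ^ 2 := by
  have hM := measurable_maxFn f
  have m1 : Measurable (Function.uncurry fun (y l : ℝ) => ENNReal.ofReal (2 * l) *
      {l : ℝ | ENNReal.ofReal l < maxFn f y}.indicator (1 : ℝ → ℝ≥0∞) l) := by
    refine Measurable.mul (by fun_prop) ?_
    have : (fun z : ℝ × ℝ => {l : ℝ | ENNReal.ofReal l < maxFn f z.1}.indicator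
        (1 : ℝ → ℝ≥0∞) z.2) =
        {z : ℝ × ℝ | ENNReal.ofReal z.2 < maxFn f z.1}.indicator 1 := by
      ext z; simp [Set.indicator]
    rw [this]
    exact measurable_one.indicator (measurableSet_lt (by fun_prop) (hM.comp measurable_fst))
  have m2 : Measurable (Function.uncurry fun (l y : ℝ) =>
      {y : ℝ | ENNReal.ofReal (l / 2) < f y}.indicator f y) := by
    have : (fun z : ℝ × ℝ => {y : ℝ | ENNReal.ofReal (z.1 / 2) < f y}.indicator f z.2) =
        {z : ℝ × ℝ | ENNReal.ofReal (z.1 / 2) < f z.2}.indicator (fun z => f z.2) := by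
      ext z; simp [Set.indicator]
    rw [show (Function.uncurry fun (l y : ℝ) =>
      {y : ℝ | ENNReal.ofReal (l / 2) < f y}.indicator f y) = _ from this]
    exact (hf.comp measurable_snd).indicator
      (measurableSet_lt (by fun_prop) (hf.comp measurable_snd))
  calc ∫⁻ y, maxFn f y ^ 2
      ≤ ∫⁻ y, ∫⁻ l in Set.Ioi (0 : ℝ), ENNReal.ofReal (2 * l) *
          {l : ℝ | ENNReal.ofReal l < maxFn f y}.indicator 1 l :=
        lintegral_mono fun y => sq_le_lintegral_layer _
    _ = ∫⁻ l in Set.Ioi (0 : ℝ), ∫⁻ y, ENNReal.ofReal (2 * l) *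
          {l : ℝ | ENNReal.ofReal l < maxFn f y}.indicator 1 l :=
        lintegral_lintegral_swap m1.aemeasurable
    _ ≤ ∫⁻ l in Set.Ioi (0 : ℝ), 16 * ∫⁻ y, {y | ENNReal.ofReal (l / 2) < f y}.indicator f y := by
        refine setLIntegral_mono' measurableSet_Ioi fun l hl => ?_
        rw [lintegral_const_mul' _ _ ENNReal.ofReal_ne_top]
        have e : ∫⁻ y, {l : ℝ | ENNReal.ofReal l < maxFn f y}.indicator (1 : ℝ → ℝ≥0∞) l =
            volume {y | ENNReal.ofReal l < maxFn f y} := by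
          rw [← lintegral_indicator_one (measurableSet_lt measurable_const hM)]
          refine lintegral_congr fun y => ?_
          simp [Set.indicator]
        rw [e, ENNReal.ofReal_mul (by norm_num), mul_assoc]
        calc _ ≤ ENNReal.ofReal 2 * (8 * ∫⁻ y, {y | ENNReal.ofReal (l / 2) < f y}.indicator f y) :=
              mul_le_mul' le_rfl (meas_maxFn_lt_le hf hl)
          _ = _ := by rw [← mul_assoc]; norm_num
    _ = 16 * ∫⁻ y, ∫⁻ l in Set.Ioi (0 : ℝ), {y | ENNReal.ofReal (l / 2) < f y}.indicator f y := by
        rw [lintegral_const_mul' _ _ (by norm_num), lintegral_lintegral_swap m2.aemeasurable]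
    _ ≤ 16 * ∫⁻ y, 2 * f y ^ 2 := by
        gcongr with y
        have e : ∀ l : ℝ, {y | ENNReal.ofReal (l / 2) < f y}.indicator f y =
            f y * {l : ℝ | ENNReal.ofReal (l / 2) < f y}.indicator 1 l := by
          intro l; simp [Set.indicator]
        simp only [e]
        rw [lintegral_const_mul]
        · calc _ ≤ f y * (2 * f y) := by gcongr; exact lintegral_indicator_half_lt_le _
            _ = _ := by ring
        · exact measurable_one.indicator (measurableSet_lt (by fun_prop) measurable_const)
    _ = 32 * ∫⁻ y, f y ^ 2 := by
        rw [lintegral_const_mul' _ _ (by norm_num), ← mul_assoc]; norm_num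

theorem exists_separable_part_fraction {R : Type*} [CommRing R] [IsDomain R] [CharZero R]
    {Q : Polynomial R} (hQ : Q ≠ 0) :
    ∃ (G A B H : Polynomial R) (c e : R) (n : ℕ), c ≠ 0 ∧ e ≠ 0 ∧
      A * G + B * Polynomial.derivative G = Polynomial.C c ∧
      Q * H = Polynomial.C e * G ^ n := by
  classical
  set K := FractionRing R
  have hinj : Function.Injective (Polynomial.map (algebraMap R K)) :=
    Polynomial.map_injective _ (IsFractionRing.injective R K)
  have hQK : Q.map (algebraMap R K) ≠ 0 := by
    rw [Ne, ← Polynomial.map_zero (algebraMap R K)]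
    exact fun h => hQ (hinj h)
  set g := UniqueFactorizationMonoid.radical (Q.map (algebraMap R K)) with hg
  have hsep : g.Separable := PerfectField.separable_iff_squarefree.2
    UniqueFactorizationMonoid.squarefree_radical
  obtain ⟨n, h, hh⟩ := UniqueFactorizationMonoid.exists_dvd_radical_self_pow hQK
  obtain ⟨a, b, hab⟩ := hsep
  have norm : ∀ p : Polynomial K, ∃ (P : Polynomial R) (k : R), k ≠ 0 ∧
      P.map (algebraMap R K) = Polynomial.C (algebraMap R K k) * p := by
    intro p
    obtain ⟨k, hk0, hk⟩ := IsLocalization.integerNormalization_spec (nonZeroDivisors R) p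
    refine ⟨IsLocalization.integerNormalization (nonZeroDivisors R) p, k,
      nonZeroDivisors.ne_zero hk0, ?_⟩
    rw [hk, ← Polynomial.smul_eq_C_mul, ← algebraMap_smul K]
  obtain ⟨G, k, hk, hG⟩ := norm g
  obtain ⟨A, i, hi, hA⟩ := norm a
  obtain ⟨B, j, hj, hB⟩ := norm b
  obtain ⟨H, l, hl, hH⟩ := norm h
  refine ⟨G, Polynomial.C j * A, Polynomial.C i * B, Polynomial.C (k ^ n) * H, i * j * k,
    l, n, by simp [hi, hj, hk], hl, hinj ?_, hinj ?_⟩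
  · have hG' : (Polynomial.derivative G).map (algebraMap R K) =
        Polynomial.C (algebraMap R K k) * Polynomial.derivative g := by
      rw [← Polynomial.derivative_map, hG, Polynomial.derivative_C_mul]
    simp only [Polynomial.map_add, Polynomial.map_mul, Polynomial.map_C, hG, hA, hB, hG', map_mul]
    linear_combination (Polynomial.C (algebraMap R K i) * Polynomial.C (algebraMap R K j) *
      Polynomial.C (algebraMap R K k)) * hab
  · simp only [Polynomial.map_mul, Polynomial.map_C, Polynomial.map_pow, hG, hH, map_pow]
    rw [← hg] at hh
    linear_combination (-(Polynomial.C (algebraMap R K l) *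
      Polynomial.C (algebraMap R K k) ^ n)) * hh

/-- Off the zeros of a nonzero polynomial in `y`, the zeros of `Q(·, y)` are simple zeros of some
polynomial `G(·, y)`. -/
theorem exists_simple_zeros {Q : Polynomial (Polynomial ℝ)} (hQ : Q ≠ 0) :
    ∃ (G : Polynomial (Polynomial ℝ)) (c : Polynomial ℝ), c ≠ 0 ∧
      ∀ y, c.eval y ≠ 0 → ∀ x, Q.evalEval y x = 0 →
        G.evalEval y x = 0 ∧ (Polynomial.derivative G).evalEval y x ≠ 0 := by
  obtain ⟨G, A, B, H, c, e, n, hc, he, h1, h2⟩ := exists_separable_part_fraction hQ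
  refine ⟨G, c * e, mul_ne_zero hc he, fun y hy x hQ0 => ?_⟩
  rw [Polynomial.eval_mul] at hy
  have hc0 := left_ne_zero_of_mul hy
  have he0 := right_ne_zero_of_mul hy
  have h1' := congrArg (Polynomial.evalEval y x) h1
  have h2' := congrArg (Polynomial.evalEval y x) h2
  simp only [Polynomial.evalEval_add, Polynomial.evalEval_mul, Polynomial.evalEval_C,
    Polynomial.evalEval_pow] at h1' h2'
  have hG0 : G.evalEval y x = 0 := by
    rw [hQ0, zero_mul, eq_comm, mul_eq_zero, or_iff_right he0] at h2'
    exact eq_zero_of_pow_eq_zero h2'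
  refine ⟨hG0, fun h => hc0 ?_⟩
  rw [← h1', hG0, h, mul_zero, mul_zero, add_zero]

theorem contDiff_evalEval (G : Polynomial (Polynomial ℝ)) :
    ContDiff ℝ ∞ fun z : ℝ × ℝ => G.evalEval z.1 z.2 := by
  have : (fun z : ℝ × ℝ => G.evalEval z.1 z.2) = fun z : ℝ × ℝ =>
      ∑ i ∈ Finset.range (G.natDegree + 1), (∑ j ∈ Finset.range ((G.coeff i).natDegree + 1),
        (G.coeff i).coeff j * z.1 ^ j) * z.2 ^ i := by
    ext z
    rw [Polynomial.evalEval, Polynomial.eval_eq_sum_range (p := G), Polynomial.eval_finsetSum]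
    refine Finset.sum_congr rfl fun i _ => ?_
    rw [Polynomial.eval_mul, Polynomial.eval_pow, Polynomial.eval_C, Polynomial.eval_eq_sum_range]
  rw [this]
  fun_prop

/-- A continuous curve of simple zeros is differentiable, and a lower bound for the slope on a
dense set is a lower bound everywhere. -/
theorem exists_hasDerivAt_of_simple_zeros (G : Polynomial (Polynomial ℝ)) {r : ℝ → ℝ} {t₀ α : ℝ}
    (hr : ∀ᶠ t in nhds t₀, ContinuousAt r t) (h0 : ∀ᶠ t in nhds t₀, G.evalEval t (r t) = 0)
    (hne : (Polynomial.derivative G).evalEval t₀ (r t₀) ≠ 0)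
    (hα : ∃ᶠ t in nhds t₀, ∃ d, HasDerivAt r d t ∧ α ≤ |d|) :
    ∃ d, HasDerivAt r d t₀ ∧ α ≤ |d| := by
  set f : ℝ × ℝ → ℝ := fun z => G.evalEval z.1 z.2 with hf
  have hfc : ContDiff ℝ ∞ f := contDiff_evalEval G
  have hfd : Differentiable ℝ f := hfc.differentiable (by simp)
  have hslice : ∀ t x, fderiv ℝ f (t, x) (0, 1) = (Polynomial.derivative G).evalEval t x := by
    intro t x
    have h1 : HasDerivAt (fun x => f (t, x)) (fderiv ℝ f (t, x) (0, 1)) x := by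
      have h2 : HasDerivAt (fun x : ℝ => (t, x)) ((0 : ℝ), (1 : ℝ)) x :=
        (hasDerivAt_const x t).prodMk (hasDerivAt_id x)
      exact (hfd (t, x)).hasFDerivAt.comp_hasDerivAt x h2
    have h3 : HasDerivAt (fun x => f (t, x)) ((Polynomial.derivative G).evalEval t x) x := by
      have e : (fun x => f (t, x)) = fun x => (G.map (Polynomial.evalRingHom t)).eval x := by
        ext x; simp only [hf]; rw [← Polynomial.map_evalRingHom_eval]
      rw [e, ← Polynomial.map_evalRingHom_eval, ← Polynomial.derivative_map]
      exact Polynomial.hasDerivAt _ x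
    exact h1.unique h3
  have hr0 : ContinuousAt r t₀ := hr.self_of_nhds
  have hstrict : HasStrictFDerivAt f (fderiv ℝ f (t₀, r t₀)) (t₀, r t₀) :=
    hfc.contDiffAt.hasStrictFDerivAt (by simp)
  have hinv : (fderiv ℝ f (t₀, r t₀) ∘L ContinuousLinearMap.inr ℝ ℝ ℝ).IsInvertible := by
    refine ⟨ContinuousLinearEquiv.unitsEquivAut ℝ (Units.mk0 _ hne), ?_⟩
    ext
    simp [hslice]
  have hloc := hstrict.eventually_apply_eq_iff_implicitFunctionOfProdDomain hinv
  have hcurve : Filter.Tendsto (fun t => (t, r t)) (nhds t₀) (nhds (t₀, r t₀)) :=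
    (continuousAt_id.prodMk hr0).tendsto
  have hd0 : DifferentiableAt ℝ r t₀ := by
    have h1 := (hstrict.hasStrictFDerivAt_implicitFunctionOfProdDomain hinv).hasFDerivAt
    refine h1.differentiableAt.congr_of_eventuallyEq ?_
    filter_upwards [hcurve.eventually hloc, h0] with t ht h0t
    refine (ht.1 ?_).symm
    rw [hf]; simp only
    rw [h0t, h0.self_of_nhds]
  have hchain : ∀ t d, (∀ᶠ s in nhds t, f (s, r s) = 0) → HasDerivAt r d t →
      fderiv ℝ f (t, r t) (1, 0) + d * fderiv ℝ f (t, r t) (0, 1) = 0 := by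
    intro t d h hd
    have h2 : HasDerivAt (fun s : ℝ => (s, r s)) ((1 : ℝ), d) t := (hasDerivAt_id t).prodMk hd
    have h3 := (hfd (t, r t)).hasFDerivAt.comp_hasDerivAt t h2
    have h4 : HasDerivAt (fun _ : ℝ => (0 : ℝ)) (fderiv ℝ f (t, r t) (1, d)) t :=
      h3.congr_of_eventuallyEq (by filter_upwards [h] with s hs; exact hs.symm)
    have h5 := h4.unique (hasDerivAt_const t (0 : ℝ))
    have h6 : ((1 : ℝ), d) = (1, 0) + d • ((0 : ℝ), (1 : ℝ)) := by ext <;> simp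
    rw [h6, map_add, map_smul, smul_eq_mul] at h5
    exact h5
  have hcont : ∀ e : ℝ × ℝ, Filter.Tendsto (fun t => |fderiv ℝ f (t, r t) e|) (nhds t₀)
      (nhds |fderiv ℝ f (t₀, r t₀) e|) := by
    intro e
    have : Continuous fun z => |fderiv ℝ f z e| :=
      ((hfc.continuous_fderiv (by simp)).clm_apply continuous_const).abs
    exact (this.tendsto (t₀, r t₀)).comp hcurve
  have hlim : α * |fderiv ℝ f (t₀, r t₀) (0, 1)| ≤ |fderiv ℝ f (t₀, r t₀) (1, 0)| := by
    refine le_of_tendsto_of_tendsto_of_frequently ((hcont (0, 1)).const_mul α) (hcont (1, 0)) ?_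
    refine (hα.and_eventually h0.eventually_nhds).mono ?_
    rintro t ⟨⟨d, hd, hαd⟩, ht⟩
    have := hchain t d ht hd
    rw [show fderiv ℝ f (t, r t) (1, 0) = -(d * fderiv ℝ f (t, r t) (0, 1)) by linarith,
      abs_neg, abs_mul]
    gcongr
  refine ⟨deriv r t₀, hd0.hasDerivAt, ?_⟩
  have := hchain t₀ _ h0 hd0.hasDerivAt
  rw [show fderiv ℝ f (t₀, r t₀) (1, 0) = -(deriv r t₀ * fderiv ℝ f (t₀, r t₀) (0, 1)) by linarith,
      abs_neg, abs_mul, hslice] at hlim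
  exact le_of_mul_le_mul_right hlim (abs_pos.2 hne)

/-- The length of the image of a curve with slopes at least `α` and bounded multiplicity. -/
theorem length_le_of_slope {r : ℝ → ℝ} {a b c d α : ℝ} {m : ℕ} {E Z : Set ℝ} (hab : a < b)
    (hcd : c ≤ d) (hα : 0 ≤ α) (hr : ContinuousOn r (Set.Icc a b)) (hE : E.Finite) (hZ : Z.Finite)
    (hmaps : Set.MapsTo r (Set.Icc a b) (Set.Icc c d))
    (hder : ∀ t ∈ Set.Ioo a b, t ∉ E → ∃ e, HasDerivAt r e t ∧ α ≤ |e|)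
    (hmult : ∀ x ∉ Z, ∀ s : Finset ℝ, (∀ t ∈ s, t ∈ Set.Icc a b ∧ r t = x) → s.card ≤ m) :
    α * (b - a) ≤ m * (d - c) := by
  classical
  have key : ∀ N : ℕ, 0 < N → ((N : ℝ) - E.ncard) * (α * ((b - a) / N)) ≤ m * (d - c) := by
    intro N hN
    have hN' : (0 : ℝ) < N := by exact_mod_cast hN
    set h := (b - a) / N with hh
    have hpos : 0 < h := div_pos (sub_pos.2 hab) hN'
    set P : ℕ → ℝ := fun k => a + k * h with hP
    have hPb : ∀ k, k ≤ N → P k ≤ b := by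
      intro k hk
      have : (k : ℝ) ≤ N := by exact_mod_cast hk
      calc P k ≤ a + N * h := by simp only [hP]; gcongr
        _ = b := by simp only [hh]; field_simp; ring
    have hPa : ∀ k, a ≤ P k := fun k => by simp only [hP]; nlinarith [(Nat.cast_nonneg k : (0:ℝ) ≤ k)]
    have hPs : ∀ k, P (k + 1) = P k + h := fun k => by simp only [hP]; push_cast; ring
    have hPmono : Monotone P := monotone_nat_of_le_succ fun k => by rw [hPs]; linarith
    have hdisj : ∀ k l t, t ∈ Set.Ioo (P k) (P (k + 1)) → t ∈ Set.Ioo (P l) (P (l + 1)) →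
        k = l := by
      intro k l t hk hl
      by_contra hne
      rcases Nat.lt_or_gt_of_ne hne with h1 | h1
      · exact absurd (hPmono (Nat.succ_le_of_lt h1)) (not_le.2 (hl.1.trans hk.2))
      · exact absurd (hPmono (Nat.succ_le_of_lt h1)) (not_le.2 (hk.1.trans hl.2))
    set good := (Finset.range N).filter fun k => ∀ t ∈ Set.Ioo (P k) (P (k + 1)), t ∉ E
      with hgood
    have hcard : N ≤ good.card + E.ncard := by
      have h1 : (Finset.range N \ good).card ≤ E.ncard := by
        have h2 : ∀ k ∈ Finset.range N \ good, ∃ t, t ∈ Set.Ioo (P k) (P (k + 1)) ∧ t ∈ E := by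
          intro k hk
          rw [Finset.mem_sdiff, hgood, Finset.mem_filter] at hk
          by_contra! h
          exact hk.2 ⟨hk.1, h⟩
        choose! τ hτ1 hτ2 using h2
        rw [Set.ncard_eq_toFinset_card E hE]
        refine Finset.card_le_card_of_injOn τ (fun k hk => by simpa using hτ2 k hk) ?_
        intro k hk l hl hkl
        have h3 := hτ1 k hk
        rw [hkl] at h3
        exact hdisj k l _ h3 (hτ1 l hl)
      have h3 := Finset.card_sdiff_add_card_eq_card
        (show good ⊆ Finset.range N from Finset.filter_subset _ _)
      rw [Finset.card_range] at h3
      omega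
    set S : ℕ → Set ℝ := fun k => Set.uIoo (r (P k)) (r (P (k + 1))) with hS
    have hsubI : ∀ k ∈ good, Set.Icc (P k) (P (k + 1)) ⊆ Set.Icc a b := by
      intro k hk
      have := Finset.mem_range.1 (Finset.mem_filter.1 hk).1
      exact Set.Icc_subset_Icc (hPa k) (hPb _ this)
    have hvol : ∀ k ∈ good, ENNReal.ofReal (α * h) ≤ volume (S k) := by
      intro k hk
      have hlt : P k < P (k + 1) := by rw [hPs]; linarith
      have h1 : ∀ t ∈ Set.Ioo (P k) (P (k + 1)), HasDerivAt r (deriv r t) t ∧ α ≤ |deriv r t| := by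
        intro t ht
        have hI := hsubI k hk
        obtain ⟨e, he, hαe⟩ := hder t
          ⟨(hPa k).trans_lt ht.1, ht.2.trans_le (hI ⟨hlt.le, le_rfl⟩).2⟩
          ((Finset.mem_filter.1 hk).2 t ht)
        rw [he.deriv]; exact ⟨he, hαe⟩
      obtain ⟨ξ, hξ, hξe⟩ := exists_hasDerivAt_eq_slope r (deriv r) hlt
        (hr.mono (hsubI k hk)) (fun t ht => (h1 t ht).1)
      have h2 := (h1 ξ hξ).2
      rw [hξe, hPs, add_sub_cancel_left, abs_div, abs_of_pos hpos, le_div_iff₀ hpos, ← hPs] at h2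
      rw [hS]
      simp only [Set.uIoo, Real.volume_Ioo]
      rw [max_sub_min_eq_abs]
      exact ENNReal.ofReal_le_ofReal h2
    have hpre : ∀ k ∈ good, ∀ x ∈ S k, ∃ t ∈ Set.Ioo (P k) (P (k + 1)), r t = x := by
      intro k hk x hx
      have hlt : P k < P (k + 1) := by rw [hPs]; linarith
      have h1 := intermediate_value_uIcc (a := P k) (b := P (k + 1)) (f := r)
        (by rw [Set.uIcc_of_le hlt.le]; exact hr.mono (hsubI k hk))
      obtain ⟨t, ht, hrt⟩ := h1 (Set.uIoo_subset_uIcc_self hx)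
      rw [Set.uIcc_of_le hlt.le] at ht
      refine ⟨t, ⟨lt_of_le_of_ne ht.1 ?_, lt_of_le_of_ne ht.2 ?_⟩, hrt⟩
      · rintro rfl
        rw [← hrt] at hx
        simp [hS] at hx
      · rintro rfl
        rw [← hrt] at hx
        simp [hS] at hx
    have hcount : ∀ x ∉ Z, ∑ k ∈ good, (S k).indicator (1 : ℝ → ℝ≥0∞) x ≤
        (Set.Icc c d).indicator (fun _ => (m : ℝ≥0∞)) x := by
      intro x hx
      have e1 : ∑ k ∈ good, (S k).indicator (1 : ℝ → ℝ≥0∞) x =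
          ((good.filter fun k => x ∈ S k).card : ℝ≥0∞) := by
        rw [Finset.card_filter]
        push_cast
        refine Finset.sum_congr rfl fun k _ => ?_
        by_cases hk : x ∈ S k <;> simp [hk]
      rw [e1]
      have h2 : ∀ k ∈ good.filter fun k => x ∈ S k, ∃ t ∈ Set.Ioo (P k) (P (k + 1)), r t = x :=
        fun k hk => hpre k (Finset.mem_filter.1 hk).1 x (Finset.mem_filter.1 hk).2
      choose! τ hτ1 hτ2 using h2
      have hI : ∀ k ∈ good.filter fun k => x ∈ S k, τ k ∈ Set.Icc a b := fun k hk =>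
        hsubI k (Finset.mem_filter.1 hk).1 (Set.Ioo_subset_Icc_self (hτ1 k hk))
      rcases (good.filter fun k => x ∈ S k).eq_empty_or_nonempty with h3 | ⟨k₀, hk₀⟩
      · rw [h3]; simp
      · have hxc : x ∈ Set.Icc c d := by
          rw [← hτ2 k₀ hk₀]; exact hmaps (hI k₀ hk₀)
        rw [Set.indicator_of_mem hxc]
        have hinj : Set.InjOn τ (good.filter fun k => x ∈ S k) := by
          intro k hk l hl hkl
          have h3 := hτ1 k hk
          rw [hkl] at h3
          exact hdisj k l _ h3 (hτ1 l hl)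
        rw [← Finset.card_image_of_injOn hinj]
        have := hmult x hx ((good.filter fun k => x ∈ S k).image τ) (by
          intro t ht
          obtain ⟨k, hk, rfl⟩ := Finset.mem_image.1 ht
          exact ⟨hI k hk, hτ2 k hk⟩)
        exact_mod_cast this
    have hfin : (good.card : ℝ≥0∞) * ENNReal.ofReal (α * h) ≤ m * ENNReal.ofReal (d - c) := by
      calc (good.card : ℝ≥0∞) * ENNReal.ofReal (α * h)
          = ∑ _k ∈ good, ENNReal.ofReal (α * h) := by simp
        _ ≤ ∑ k ∈ good, volume (S k) := Finset.sum_le_sum hvol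
        _ = ∑ k ∈ good, ∫⁻ x, (S k).indicator 1 x := by
            refine Finset.sum_congr rfl fun k _ => ?_
            exact (lintegral_indicator_one measurableSet_Ioo).symm
        _ = ∫⁻ x, ∑ k ∈ good, (S k).indicator 1 x := by
            rw [lintegral_finsetSum]
            exact fun k _ => measurable_one.indicator measurableSet_Ioo
        _ ≤ ∫⁻ x, (Set.Icc c d).indicator (fun _ => (m : ℝ≥0∞)) x := by
            refine lintegral_mono_ae ?_
            filter_upwards [hZ.countable.ae_notMem volume] with x hx using hcount x hx
        _ = _ := by
            rw [lintegral_indicator_const measurableSet_Icc, Real.volume_Icc]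
    have hreal : (good.card : ℝ) * (α * h) ≤ m * (d - c) := by
      rw [← ENNReal.ofReal_natCast, ← ENNReal.ofReal_natCast, ← ENNReal.ofReal_mul (by positivity),
        ← ENNReal.ofReal_mul (by positivity)] at hfin
      exact (ENNReal.ofReal_le_ofReal_iff (mul_nonneg (by positivity) (sub_nonneg.2 hcd))).1 hfin
    refine le_trans ?_ hreal
    have : (N : ℝ) - E.ncard ≤ good.card := by
      have : (N : ℝ) ≤ good.card + E.ncard := by exact_mod_cast hcard
      linarith
    gcongr
  have hlim : Filter.Tendsto (fun N : ℕ => ((N : ℝ) - E.ncard) * (α * ((b - a) / N)))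
      Filter.atTop (nhds (α * (b - a))) := by
    have h1 : Filter.Tendsto (fun N : ℕ => α * (b - a) - (E.ncard * (α * (b - a))) / (N : ℝ))
        Filter.atTop (nhds (α * (b - a) - 0)) :=
      tendsto_const_nhds.sub (tendsto_const_div_atTop_nhds_zero_nat _)
    rw [sub_zero] at h1
    refine h1.congr' ?_
    filter_upwards [Filter.eventually_gt_atTop 0] with N hN
    have : (N : ℝ) ≠ 0 := by exact_mod_cast hN.ne'
    field_simp
  exact le_of_tendsto hlim (by filter_upwards [Filter.eventually_gt_atTop 0] with N hN using key N hN)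

/-- `q` and `w` are the partial derivatives of the function `Ψ`, which is polynomial of degree at
most `m` in each variable. -/
structure IsPhase (m : ℕ) (Ψ q w : ℝ → ℝ → ℝ) : Prop where
  hasDerivAt_fst : ∀ x t, HasDerivAt (fun x => Ψ x t) (q x t) x
  hasDerivAt_snd : ∀ x t, HasDerivAt (fun t => Ψ x t) (w x t) t
  poly_fst : ∀ t, PolyLE m fun x => Ψ x t
  poly_snd : ∀ x, PolyLE m fun t => Ψ x t
  poly_q : ∀ x, PolyLE m fun t => q x t
  poly_w : ∀ t, PolyLE m fun x => w x t
  cont_q : Continuous fun z : ℝ × ℝ => q z.1 z.2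
  cont_w : Continuous fun z : ℝ × ℝ => w z.1 z.2

/-- `Vx` and `Vt` are the continuous partial derivatives of `V`. -/
structure IsAmplitude (V Vx Vt : ℝ → ℝ → ℂ) : Prop where
  hasDerivAt_fst : ∀ x t, HasDerivAt (fun x => V x t) (Vx x t) x
  hasDerivAt_snd : ∀ x t, HasDerivAt (fun t => V x t) (Vt x t) t
  cont : Continuous fun z : ℝ × ℝ => V z.1 z.2
  cont_fst : Continuous fun z : ℝ × ℝ => Vx z.1 z.2
  cont_snd : Continuous fun z : ℝ × ℝ => Vt z.1 z.2

/-- The `L²` norm over `X` of the function `x ↦ g x t`. -/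
noncomputable def sliceNorm (X : Set ℝ) (g : ℝ → ℝ → ℂ) (t : ℝ) : ℝ≥0∞ :=
  (∫⁻ x in X, ‖g x t‖ₑ ^ 2) ^ (1 / 2 : ℝ)

theorem sliceNorm_sq (X : Set ℝ) (g : ℝ → ℝ → ℂ) (t : ℝ) :
    sliceNorm X g t ^ 2 = ∫⁻ x in X, ‖g x t‖ₑ ^ 2 := by
  rw [sliceNorm, ← ENNReal.rpow_natCast, ← ENNReal.rpow_mul]; norm_num

theorem ENNReal.le_of_sq_le_sq {a b : ℝ≥0∞} (h : a ^ 2 ≤ b ^ 2) : a ≤ b :=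
  (ENNReal.pow_le_pow_left_iff two_ne_zero).1 h

theorem ENNReal.sqrt_sq (a : ℝ≥0∞) : (a ^ (1 / 2 : ℝ)) ^ 2 = a := by
  rw [← ENNReal.rpow_natCast, ← ENNReal.rpow_mul]; norm_num

theorem lintegral_le_sliceNorm {S X : Set ℝ} (hS : S ⊆ X) {g : ℝ → ℝ → ℂ} {t L : ℝ}
    (hg : Continuous fun x => g x t) (hL : volume S ≤ ENNReal.ofReal L) :
    ∫⁻ x in S, ‖g x t‖ₑ ≤ ENNReal.ofReal L ^ (1 / 2 : ℝ) * sliceNorm X g t := by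
  apply ENNReal.le_of_sq_le_sq
  rw [mul_pow, sliceNorm_sq, ENNReal.sqrt_sq]
  refine (sq_lintegral_le _ (Continuous.measurable (by fun_prop)).aemeasurable).trans ?_
  rw [Measure.restrict_apply_univ]
  exact mul_le_mul' hL (lintegral_mono_set hS)

theorem abs_sub_le_integral_abs_deriv {p p' : ℝ → ℝ} (hp : ∀ s, HasDerivAt p (p' s) s)
    (hc : Continuous p') {a b x z : ℝ} (hx : x ∈ Set.Icc a b) (hz : z ∈ Set.Icc a b) :
    |p z - p x| ≤ ∫ s in a..b, |p' s| := by
  have hab : a ≤ b := hx.1.trans hx.2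
  rw [← intervalIntegral.integral_eq_sub_of_hasDerivAt (fun s _ => hp s)
    (hc.intervalIntegrable _ _)]
  rw [intervalIntegral.abs_integral_eq_abs_integral_uIoc]
  refine abs_integral_le_integral_abs.trans ?_
  rw [intervalIntegral.integral_of_le hab]
  refine setIntegral_mono_set ((hc.abs.integrableOn_Icc).mono_set Set.Ioc_subset_Icc_self)
    (Filter.Eventually.of_forall fun _ => abs_nonneg _) (Filter.Eventually.of_forall ?_)
  intro s hs
  have hs' : s ∈ Set.uIoc x z := hs
  change s ∈ Set.Ioc a b
  rw [Set.mem_uIoc] at hs'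
  rcases hs' with h | h
  · exact ⟨hx.1.trans_lt h.1, h.2.trans hz.2⟩
  · exact ⟨hz.1.trans_lt h.1, h.2.trans hx.2⟩

section Local

variable {m : ℕ} {Ψ q w : ℝ → ℝ → ℝ} {V Vx Vt : ℝ → ℝ → ℂ}

theorem IsPhase.cont_q_fst (hΨ : IsPhase m Ψ q w) (t : ℝ) : Continuous fun x => q x t :=
  hΨ.cont_q.comp (by fun_prop : Continuous fun x : ℝ => (x, t))

theorem IsPhase.cont_w_snd (hΨ : IsPhase m Ψ q w) (x : ℝ) : Continuous fun t => w x t :=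
  hΨ.cont_w.comp (by fun_prop : Continuous fun t : ℝ => (x, t))

theorem IsPhase.deriv_fst (hΨ : IsPhase m Ψ q w) (t : ℝ) :
    deriv (fun x => Ψ x t) = fun x => q x t :=
  funext fun x => (hΨ.hasDerivAt_fst x t).deriv

theorem IsPhase.poly_q_fst (hΨ : IsPhase m Ψ q w) (t : ℝ) : PolyLE m fun x => q x t := by
  rw [← hΨ.deriv_fst]; exact (hΨ.poly_fst t).deriv

theorem IsPhase.poly_w_snd (hΨ : IsPhase m Ψ q w) (x : ℝ) : PolyLE m fun t => w x t := by
  have : deriv (fun t => Ψ x t) = fun t => w x t :=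
    funext fun t => (hΨ.hasDerivAt_snd x t).deriv
  rw [← this]; exact (hΨ.poly_snd x).deriv

theorem IsAmplitude.cont_v_fst (hV : IsAmplitude V Vx Vt) (t : ℝ) : Continuous fun x => V x t :=
  hV.cont.comp (by fun_prop : Continuous fun x : ℝ => (x, t))

theorem IsAmplitude.cont_vx_fst (hV : IsAmplitude V Vx Vt) (t : ℝ) : Continuous fun x => Vx x t :=
  hV.cont_fst.comp (by fun_prop : Continuous fun x : ℝ => (x, t))

theorem IsAmplitude.cont_vt_snd (hV : IsAmplitude V Vx Vt) (x : ℝ) : Continuous fun t => Vt x t :=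
  hV.cont_snd.comp (by fun_prop : Continuous fun t : ℝ => (x, t))

theorem IsPhase.cont_op_fst (hΨ : IsPhase m Ψ q w) (hV : IsAmplitude V Vx Vt) :
    Continuous fun z : ℝ × ℝ => Vx z.1 z.2 + q z.1 z.2 * V z.1 z.2 := by
  have := hΨ.cont_q; have := hV.cont; have := hV.cont_fst
  fun_prop

theorem IsPhase.cont_op_snd (hΨ : IsPhase m Ψ q w) (hV : IsAmplitude V Vx Vt) :
    Continuous fun z : ℝ × ℝ => Vt z.1 z.2 + w z.1 z.2 * V z.1 z.2 := by
  have := hΨ.cont_w; have := hV.cont; have := hV.cont_snd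
  fun_prop

/-- Where the phase has small variation, all values of the amplitude on an interval are
comparable up to the integral of `∂ₓV + (∂ₓΨ)V`. -/
theorem IsPhase.enorm_le_horizontal (hΨ : IsPhase m Ψ q w) (hV : IsAmplitude V Vx Vt)
    {a b x z t : ℝ} (hint : ∫ s in a..b, |q s t| ≤ 1) (hx : x ∈ Set.Icc a b)
    (hz : z ∈ Set.Icc a b) :
    ‖V x t‖ₑ ≤ ENNReal.ofReal (Real.exp 1) *
      (‖V z t‖ₑ + ∫⁻ s in Set.Icc a b, ‖Vx s t + q s t * V s t‖ₑ) := by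
  have hsub : Set.uIcc x z ⊆ Set.Icc a b := Set.uIcc_subset_Icc hx hz
  refine (enorm_le_of_le_add (p := fun s => Ψ s t) (fun s => hΨ.hasDerivAt_fst s t)
    (fun s => hV.hasDerivAt_fst s t) (hΨ.cont_q_fst t) (hV.cont_vx_fst t) (h := 1) (x := x)
    (z := z) fun s hs => ?_).trans ?_
  · have := abs_sub_le_integral_abs_deriv (fun s => hΨ.hasDerivAt_fst s t) (hΨ.cont_q_fst t) hx
      (hsub hs)
    linarith [le_abs_self (Ψ s t - Ψ x t)]
  · gcongr
    exact Set.uIoc_subset_uIcc.trans hsub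

theorem IsPhase.enorm_le_vertical (hΨ : IsPhase m Ψ q w) (hV : IsAmplitude V Vx Vt)
    {z t t₁ h : ℝ} (ht : t ∈ Set.Icc 0 t₁) (hle : ∀ s ∈ Set.Icc 0 t₁, Ψ z s ≤ Ψ z 0 + h) :
    ‖V z 0‖ₑ ≤ ENNReal.ofReal (Real.exp h) *
      (‖V z t‖ₑ + ∫⁻ s in Set.Icc 0 t₁, ‖Vt z s + w z s * V z s‖ₑ) := by
  have hsub : Set.uIcc 0 t ⊆ Set.Icc 0 t₁ :=
    Set.uIcc_subset_Icc ⟨le_rfl, ht.1.trans ht.2⟩ ht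
  refine (enorm_le_of_le_add (p := fun s => Ψ z s) (fun s => hΨ.hasDerivAt_snd z s)
    (fun s => hV.hasDerivAt_snd z s) (hΨ.cont_w_snd z) (hV.cont_vt_snd z) (h := h) (x := 0)
    (z := t) fun s hs => hle s (hsub hs)).trans ?_
  gcongr
  exact Set.uIoc_subset_uIcc.trans hsub

theorem IsPhase.abs_sub_le (hΨ : IsPhase m Ψ q w) {a b x z t : ℝ} (hx : x ∈ Set.Icc a b)
    (hz : z ∈ Set.Icc a b) : |Ψ z t - Ψ x t| ≤ ∫ s in a..b, |q s t| :=
  abs_sub_le_integral_abs_deriv (fun s => hΨ.hasDerivAt_fst s t) (hΨ.cont_q_fst t) hx hz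

theorem lintegral_lintegral_le_sliceNorm {S T X : Set ℝ} (hS : S ⊆ X)
    {g : ℝ → ℝ → ℂ} (hg : Continuous fun z : ℝ × ℝ => g z.1 z.2) {L : ℝ}
    (hL : volume S ≤ ENNReal.ofReal L) :
    ∫⁻ x in S, ∫⁻ t in T, ‖g x t‖ₑ ≤
      ENNReal.ofReal L ^ (1 / 2 : ℝ) * ∫⁻ t in T, sliceNorm X g t := by
  rw [lintegral_lintegral_swap (Continuous.measurable (by
    simp only [Function.uncurry_def]; fun_prop)).aemeasurable,
    ← lintegral_const_mul' _ _ (ENNReal.rpow_ne_top_of_nonneg (by norm_num) ENNReal.ofReal_ne_top)]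
  exact lintegral_mono fun t => lintegral_le_sliceNorm hS
    (hg.comp (by fun_prop : Continuous fun x : ℝ => (x, t))) hL

/-- Bounding values at time `0` by a mean over a subinterval, transported to time `t`. -/
theorem IsPhase.enorm_le_transport (hΨ : IsPhase m Ψ q w) (hV : IsAmplitude V Vx Vt)
    {r ρ c d t t₁ h : ℝ} (hint : ∫ s in (r - ρ)..(r + ρ), |q s 0| ≤ 1)
    (hcd : c < d) (hc : r - ρ ≤ c) (hd : d ≤ r + ρ) (ht : t ∈ Set.Icc 0 t₁)
    (hle : ∀ z ∈ Set.Icc c d, ∀ s ∈ Set.Icc 0 t₁, Ψ z s ≤ Ψ z 0 + h) {x : ℝ}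
    (hx : x ∈ Set.Icc (r - ρ) (r + ρ)) :
    ‖V x 0‖ₑ ≤ ENNReal.ofReal (Real.exp 1) * (ENNReal.ofReal (2 * ρ) ^ (1 / 2 : ℝ) *
        sliceNorm Set.univ (fun x t => Vx x t + q x t * V x t) 0) +
      ENNReal.ofReal (Real.exp 1) * ENNReal.ofReal (Real.exp h) * ENNReal.ofReal (d - c)⁻¹ *
        ((∫⁻ z in Set.Icc c d, ‖V z t‖ₑ) + ENNReal.ofReal (2 * ρ) ^ (1 / 2 : ℝ) *
          ∫⁻ s in Set.Icc 0 t₁, sliceNorm Set.univ (fun x t => Vt x t + w x t * V x t) s) := by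
  have hvJ : volume (Set.Icc (r - ρ) (r + ρ)) ≤ ENNReal.ofReal (2 * ρ) := by
    rw [Real.volume_Icc]; ring_nf; rfl
  have hsub : Set.Icc c d ⊆ Set.Icc (r - ρ) (r + ρ) := Set.Icc_subset_Icc hc hd
  set E := ENNReal.ofReal (Real.exp 1)
  set H := ENNReal.ofReal (Real.exp h)
  set I₁ := ∫⁻ s in Set.Icc (r - ρ) (r + ρ), ‖Vx s 0 + q s 0 * V s 0‖ₑ
  have hI₁ : I₁ ≤ ENNReal.ofReal (2 * ρ) ^ (1 / 2 : ℝ) *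
      sliceNorm Set.univ (fun x t => Vx x t + q x t * V x t) 0 :=
    lintegral_le_sliceNorm (g := fun x t => Vx x t + q x t * V x t) (Set.subset_univ _)
      ((hΨ.cont_op_fst hV).comp (by fun_prop : Continuous fun x : ℝ => (x, (0 : ℝ)))) hvJ
  have h1 : ∀ z ∈ Set.Icc c d, ‖V x 0‖ₑ ≤ E * I₁ + E * H *
      (‖V z t‖ₑ + ∫⁻ s in Set.Icc 0 t₁, ‖Vt z s + w z s * V z s‖ₑ) := by
    intro z hz
    calc ‖V x 0‖ₑ ≤ E * (‖V z 0‖ₑ + I₁) := hΨ.enorm_le_horizontal hV hint hx (hsub hz)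
      _ ≤ E * (H * (‖V z t‖ₑ + ∫⁻ s in Set.Icc 0 t₁, ‖Vt z s + w z s * V z s‖ₑ) + I₁) := by
          gcongr
          exact hΨ.enorm_le_vertical hV ht (hle z hz)
      _ = _ := by ring
  have hdc : 0 < d - c := sub_pos.2 hcd
  have hvol : volume (Set.Icc c d) = ENNReal.ofReal (d - c) := Real.volume_Icc
  have hmz : Measurable fun z => ‖V z t‖ₑ := Continuous.measurable (by
    have := hV.cont_v_fst t; fun_prop)
  have h2 : ENNReal.ofReal (d - c) * ‖V x 0‖ₑ ≤ ENNReal.ofReal (d - c) * (E * I₁) +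
      E * H * ((∫⁻ z in Set.Icc c d, ‖V z t‖ₑ) +
        ∫⁻ z in Set.Icc c d, ∫⁻ s in Set.Icc 0 t₁, ‖Vt z s + w z s * V z s‖ₑ) := by
    calc ENNReal.ofReal (d - c) * ‖V x 0‖ₑ = ∫⁻ _z in Set.Icc c d, ‖V x 0‖ₑ := by
          rw [setLIntegral_const, hvol, mul_comm]
      _ ≤ ∫⁻ z in Set.Icc c d, (E * I₁ + E * H *
          (‖V z t‖ₑ + ∫⁻ s in Set.Icc 0 t₁, ‖Vt z s + w z s * V z s‖ₑ)) :=
          setLIntegral_mono' measurableSet_Icc h1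
      _ = _ := by
          rw [lintegral_add_left measurable_const, setLIntegral_const, hvol,
            lintegral_const_mul' _ _ (ENNReal.mul_ne_top ENNReal.ofReal_ne_top
              ENNReal.ofReal_ne_top), lintegral_add_left hmz, mul_comm (E * I₁)]
  have h3 : ∫⁻ z in Set.Icc c d, ∫⁻ s in Set.Icc 0 t₁, ‖Vt z s + w z s * V z s‖ₑ ≤
      ENNReal.ofReal (2 * ρ) ^ (1 / 2 : ℝ) *
        ∫⁻ s in Set.Icc 0 t₁, sliceNorm Set.univ (fun x t => Vt x t + w x t * V x t) s :=
    lintegral_lintegral_le_sliceNorm (g := fun x t => Vt x t + w x t * V x t)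
      (Set.subset_univ _) (hΨ.cont_op_snd hV)
      ((measure_mono hsub).trans hvJ)
  have h4 : ENNReal.ofReal (d - c)⁻¹ * ENNReal.ofReal (d - c) = 1 := by
    rw [← ENNReal.ofReal_mul (by positivity), inv_mul_cancel₀ hdc.ne', ENNReal.ofReal_one]
  calc ‖V x 0‖ₑ = ENNReal.ofReal (d - c)⁻¹ * (ENNReal.ofReal (d - c) * ‖V x 0‖ₑ) := by
        rw [← mul_assoc, h4, one_mul]
    _ ≤ ENNReal.ofReal (d - c)⁻¹ * (ENNReal.ofReal (d - c) * (E * I₁) +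
      E * H * ((∫⁻ z in Set.Icc c d, ‖V z t‖ₑ) +
        ∫⁻ z in Set.Icc c d, ∫⁻ s in Set.Icc 0 t₁, ‖Vt z s + w z s * V z s‖ₑ)) := by gcongr
    _ = (ENNReal.ofReal (d - c)⁻¹ * ENNReal.ofReal (d - c)) * (E * I₁) +
      E * H * ENNReal.ofReal (d - c)⁻¹ * ((∫⁻ z in Set.Icc c d, ‖V z t‖ₑ) +
        ∫⁻ z in Set.Icc c d, ∫⁻ s in Set.Icc 0 t₁, ‖Vt z s + w z s * V z s‖ₑ) := by ring
    _ ≤ _ := by rw [h4, one_mul]; gcongr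

end Local

/-- The mean of `g` over `[0, t₁]`. -/
noncomputable def timeMean (t₁ : ℝ) (g : ℝ → ℝ≥0∞) : ℝ≥0∞ :=
  ENNReal.ofReal t₁⁻¹ * ∫⁻ s in Set.Icc 0 t₁, g s

theorem lintegral_Icc_enorm_eq {f : ℝ → ℝ} (hf : Continuous f) {a b : ℝ} (hab : a ≤ b) :
    ∫⁻ s in Set.Icc a b, ‖f s‖ₑ = ENNReal.ofReal (∫ s in a..b, |f s|) := by
  rw [intervalIntegral.integral_of_le hab, ← integral_Icc_eq_integral_Ioc,
    ofReal_integral_eq_lintegral_ofReal]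
  · simp only [Real.enorm_eq_ofReal_abs]
  · exact hf.abs.integrableOn_Icc
  · exact Filter.Eventually.of_forall fun _ => abs_nonneg _

theorem PolyLE.exists_value_bound_enorm (m : ℕ) : ∃ K : ℝ, 1 ≤ K ∧ ∀ f, PolyLE m f →
    ∀ a b : ℝ, a < b → ∀ L : ℝ, 1 ≤ L → ∀ x, |x - a| ≤ L * (b - a) →
      ‖f x‖ₑ * ENNReal.ofReal (b - a) ≤
        ENNReal.ofReal (K * L ^ m) * ∫⁻ s in Set.Icc a b, ‖f s‖ₑ := by
  obtain ⟨K, hK, h⟩ := PolyLE.exists_value_bound m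
  refine ⟨K, hK, fun f hf a b hab L hL x hx => ?_⟩
  have hd : 0 < b - a := sub_pos.2 hab
  have h1 := h f hf a b hab L hL x hx
  rw [lintegral_Icc_enorm_eq hf.continuous hab.le, Real.enorm_eq_ofReal_abs,
    ← ENNReal.ofReal_mul (abs_nonneg _), ← ENNReal.ofReal_mul (by positivity)]
  apply ENNReal.ofReal_le_ofReal
  calc |f x| * (b - a) ≤ (K * L ^ m * ((b - a)⁻¹ * ∫ s in a..b, |f s|)) * (b - a) := by gcongr
    _ = _ := by field_simp

theorem ENNReal.ofReal_two_mul_sqrt_le (ρ : ℝ) :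
    ENNReal.ofReal (2 * ρ) ^ (1 / 2 : ℝ) ≤ 2 * ENNReal.ofReal ρ ^ (1 / 2 : ℝ) := by
  rw [ENNReal.ofReal_mul (by norm_num), ENNReal.mul_rpow_of_nonneg _ _ (by norm_num)]
  gcongr
  rw [ENNReal.ofReal_ofNat]
  calc (2 : ℝ≥0∞) ^ (1 / 2 : ℝ) ≤ 2 ^ (1 : ℝ) :=
        ENNReal.rpow_le_rpow_of_exponent_le (by norm_num) (by norm_num)
    _ = 2 := by simp

section Local

variable {m : ℕ} {Ψ q w : ℝ → ℝ → ℝ} {V Vx Vt : ℝ → ℝ → ℂ}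

/-- Estimate when the amplitude vanishes somewhere in the interval. -/
theorem IsPhase.enorm_le_of_eq_zero (hΨ : IsPhase m Ψ q w) (hV : IsAmplitude V Vx Vt)
    {r ρ x z : ℝ} (hint : ∫ s in (r - ρ)..(r + ρ), |q s 0| ≤ 1)
    (hz : z ∈ Set.Icc (r - ρ) (r + ρ)) (hVz : V z 0 = 0) (hx : x ∈ Set.Icc (r - ρ) (r + ρ)) :
    ‖V x 0‖ₑ ≤ ENNReal.ofReal ρ ^ (1 / 2 : ℝ) * (ENNReal.ofReal (Real.exp 1) * 2 *
      sliceNorm Set.univ (fun x t => Vx x t + q x t * V x t) 0) := by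
  have h1 := hΨ.enorm_le_horizontal hV hint hx hz
  rw [hVz, enorm_zero, zero_add] at h1
  refine h1.trans ?_
  calc _ ≤ ENNReal.ofReal (Real.exp 1) * (ENNReal.ofReal (2 * ρ) ^ (1 / 2 : ℝ) *
        sliceNorm Set.univ (fun x t => Vx x t + q x t * V x t) 0) := by
        gcongr
        refine lintegral_le_sliceNorm (g := fun x t => Vx x t + q x t * V x t)
          (Set.subset_univ _) ((hΨ.cont_op_fst hV).comp
            (by fun_prop : Continuous fun x : ℝ => (x, (0 : ℝ)))) ?_
        rw [Real.volume_Icc]; ring_nf; rfl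
    _ ≤ ENNReal.ofReal (Real.exp 1) * ((2 * ENNReal.ofReal ρ ^ (1 / 2 : ℝ)) *
        sliceNorm Set.univ (fun x t => Vx x t + q x t * V x t) 0) := by
        gcongr; exact ENNReal.ofReal_two_mul_sqrt_le ρ
    _ = _ := by ring

/-- Estimate when the amplitude vanishes at a later time. -/
theorem IsPhase.enorm_le_of_exit (A : ℝ) : ∃ C : ℝ≥0∞, C ≠ ⊤ ∧ ∀ {m : ℕ} {Ψ q w : ℝ → ℝ → ℝ}
    {V Vx Vt : ℝ → ℝ → ℂ}, IsPhase m Ψ q w → IsAmplitude V Vx Vt → ∀ r ρ t₁ : ℝ,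
      0 < t₁ → t₁ ≤ ρ → ∫ s in (r - ρ)..(r + ρ), |q s 0| ≤ 1 →
      (∀ t ∈ Set.Icc 0 t₁, ∫ s in (r - ρ)..(r + ρ), |q s t| ≤ A) →
      (∀ t ∈ Set.Icc 0 t₁, Ψ r t ≤ Ψ r 0) → (∀ x ∈ Set.Icc (r - ρ) (r + ρ), V x t₁ = 0) →
      ∀ x ∈ Set.Icc (r - ρ) (r + ρ), ‖V x 0‖ₑ ≤ ENNReal.ofReal ρ ^ (1 / 2 : ℝ) * (C *
        (sliceNorm Set.univ (fun x t => Vx x t + q x t * V x t) 0 +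
          timeMean t₁ (sliceNorm Set.univ fun x t => Vt x t + w x t * V x t))) := by
  refine ⟨ENNReal.ofReal (Real.exp 1) * 2 +
    ENNReal.ofReal (Real.exp 1) * ENNReal.ofReal (Real.exp (A + 1)) * 2, by
      simp [ENNReal.mul_eq_top], ?_⟩
  intro m Ψ q w V Vx Vt hΨ hV r ρ t₁ ht₁ htρ hint hA hdir hV0 x hx
  have hρ : 0 < ρ := ht₁.trans_le htρ
  have hrJ : r ∈ Set.Icc (r - ρ) (r + ρ) := ⟨by linarith, by linarith⟩
  have h1 := hΨ.enorm_le_transport hV hint (c := r - ρ) (d := r + ρ) (by linarith) le_rfl le_rfl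
    (t := t₁) (t₁ := t₁) (h := A + 1) ⟨ht₁.le, le_rfl⟩ (fun z hz s hs => by
      have e1 := hΨ.abs_sub_le (t := s) hrJ hz
      have e2 := hΨ.abs_sub_le (t := 0) hrJ hz
      have e3 := hA s hs
      have e4 := hdir s hs
      have e5 := le_abs_self (Ψ z s - Ψ r s)
      have e6 := neg_abs_le (Ψ z 0 - Ψ r 0)
      linarith) hx
  have h2 : ∫⁻ z in Set.Icc (r - ρ) (r + ρ), ‖V z t₁‖ₑ = 0 := by
    rw [setLIntegral_congr_fun measurableSet_Icc (g := fun _ => 0) (fun z hz => by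
      simp only [hV0 z hz, enorm_zero])]
    simp
  rw [h2, zero_add] at h1
  refine h1.trans ?_
  set N₁ := sliceNorm Set.univ (fun x t => Vx x t + q x t * V x t) 0
  set I₂ := ∫⁻ s in Set.Icc 0 t₁, sliceNorm Set.univ (fun x t => Vt x t + w x t * V x t) s
  set E := ENNReal.ofReal (Real.exp 1)
  set H := ENNReal.ofReal (Real.exp (A + 1))
  have h3 : ENNReal.ofReal (r + ρ - (r - ρ))⁻¹ ≤ ENNReal.ofReal t₁⁻¹ := by
    apply ENNReal.ofReal_le_ofReal
    apply inv_anti₀ ht₁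
    linarith
  have h4 := ENNReal.ofReal_two_mul_sqrt_le ρ
  set P := ENNReal.ofReal ρ ^ (1 / 2 : ℝ)
  calc _ ≤ E * (2 * P * N₁) + E * H * ENNReal.ofReal t₁⁻¹ * (2 * P * I₂) := by gcongr
    _ = P * (E * 2 * N₁ + E * H * 2 * (ENNReal.ofReal t₁⁻¹ * I₂)) := by ring
    _ ≤ P * ((E * 2 + E * H * 2) * N₁ + (E * 2 + E * H * 2) * (ENNReal.ofReal t₁⁻¹ * I₂)) :=
        mul_le_mul' le_rfl (add_le_add (mul_le_mul' le_self_add le_rfl)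
          (mul_le_mul' le_add_self le_rfl))
    _ = _ := by rw [timeMean]; ring

theorem IsPhase.continuous_variation (hΨ : IsPhase m Ψ q w) (a b : ℝ) :
    Continuous fun t => ∫ s in a..b, |q s t| := by
  apply intervalIntegral.continuous_parametric_intervalIntegral_of_continuous' (μ := volume)
  simp only [Function.uncurry_def]
  have := hΨ.cont_q
  exact (this.comp continuous_swap).abs

/-- If the variation reaches its maximum `A` at time `t₁`, then it is comparable with `A` on a
large part of `[0, t₁]`. -/
theorem IsPhase.exists_large_variation (m : ℕ) : ∃ K : ℝ, 1 ≤ K ∧ ∀ {Ψ q w : ℝ → ℝ → ℝ},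
    IsPhase m Ψ q w → ∀ a b t₁ A : ℝ, a < b → 0 < t₁ → 0 < A →
      (∀ t ∈ Set.Icc 0 t₁, ∫ s in a..b, |q s t| ≤ A) → ∫ s in a..b, |q s t₁| = A →
        ENNReal.ofReal t₁ ≤ ENNReal.ofReal (2 * K) *
          volume (Set.Icc 0 t₁ ∩ {t | A / (2 * K) ≤ ∫ s in a..b, |q s t|}) := by
  obtain ⟨K, hK, hval⟩ := PolyLE.exists_value_bound_enorm m
  refine ⟨K, hK, fun {Ψ q w} hΨ a b t₁ A hab ht₁ hA hle heq => ?_⟩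
  have hK0 : 0 < K := by positivity
  set S := Set.Icc 0 t₁ ∩ {t | A / (2 * K) ≤ ∫ s in a..b, |q s t|} with hS
  have hSm : MeasurableSet S := measurableSet_Icc.inter
    (measurableSet_le measurable_const (hΨ.continuous_variation a b).measurable)
  have hqm : Measurable (Function.uncurry fun x t => ‖q x t‖ₑ) :=
    Continuous.measurable (by simp only [Function.uncurry_def]; have := hΨ.cont_q; fun_prop)
  have h1 : ENNReal.ofReal (A * t₁) ≤ ENNReal.ofReal K *
      ∫⁻ t in Set.Icc 0 t₁, ENNReal.ofReal (∫ s in a..b, |q s t|) := by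
    calc ENNReal.ofReal (A * t₁) = (∫⁻ x in Set.Icc a b, ‖q x t₁‖ₑ) * ENNReal.ofReal t₁ := by
          rw [lintegral_Icc_enorm_eq (hΨ.cont_q_fst t₁) hab.le, heq, ENNReal.ofReal_mul hA.le]
      _ = ∫⁻ x in Set.Icc a b, ‖q x t₁‖ₑ * ENNReal.ofReal t₁ :=
          (lintegral_mul_const' _ _ ENNReal.ofReal_ne_top).symm
      _ ≤ ∫⁻ x in Set.Icc a b, ENNReal.ofReal K * ∫⁻ t in Set.Icc 0 t₁, ‖q x t‖ₑ := by
          refine lintegral_mono fun x => ?_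
          have := hval _ (hΨ.poly_q x) 0 t₁ ht₁ 1 le_rfl t₁ (by simp [abs_of_pos ht₁])
          simpa using this
      _ = ENNReal.ofReal K * ∫⁻ t in Set.Icc 0 t₁, ∫⁻ x in Set.Icc a b, ‖q x t‖ₑ := by
          rw [lintegral_const_mul' _ _ ENNReal.ofReal_ne_top,
            lintegral_lintegral_swap hqm.aemeasurable]
      _ = _ := by
          congr 1
          exact lintegral_congr fun t => lintegral_Icc_enorm_eq (hΨ.cont_q_fst t) hab.le
  have h2 : ∫⁻ t in Set.Icc 0 t₁, ENNReal.ofReal (∫ s in a..b, |q s t|) ≤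
      ENNReal.ofReal A * volume S + ENNReal.ofReal (A / (2 * K)) * ENNReal.ofReal t₁ := by
    calc _ ≤ ∫⁻ t in Set.Icc 0 t₁, (S.indicator (fun _ => ENNReal.ofReal A) t +
          ENNReal.ofReal (A / (2 * K))) := by
          refine setLIntegral_mono' measurableSet_Icc fun t ht => ?_
          by_cases htS : t ∈ S
          · rw [Set.indicator_of_mem htS]
            exact le_add_right (ENNReal.ofReal_le_ofReal (hle t ht))
          · rw [Set.indicator_of_notMem htS, zero_add]
            apply ENNReal.ofReal_le_ofReal
            by_contra hc
            exact htS ⟨ht, (not_le.1 hc).le⟩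
      _ ≤ _ := by
          rw [lintegral_add_right _ measurable_const, setLIntegral_const, Real.volume_Icc, sub_zero]
          gcongr
          calc _ ≤ ∫⁻ t, S.indicator (fun _ => ENNReal.ofReal A) t :=
                setLIntegral_le_lintegral _ _
            _ = _ := lintegral_indicator_const hSm _
  have h3 : ENNReal.ofReal (A * t₁) = ENNReal.ofReal (A * t₁ / 2) + ENNReal.ofReal (A * t₁ / 2) := by
    rw [← ENNReal.ofReal_add (by positivity) (by positivity)]; ring_nf
  have h4 : ENNReal.ofReal K * (ENNReal.ofReal (A / (2 * K)) * ENNReal.ofReal t₁) =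
      ENNReal.ofReal (A * t₁ / 2) := by
    rw [← ENNReal.ofReal_mul (by positivity), ← ENNReal.ofReal_mul (by positivity)]
    congr 1; field_simp
  have h5 := h1.trans (mul_le_mul' le_rfl h2)
  rw [mul_add, h4, h3] at h5
  have h6 := (ENNReal.add_le_add_iff_right ENNReal.ofReal_ne_top).1 h5
  have h7 : ENNReal.ofReal t₁ = ENNReal.ofReal (2 / A) * ENNReal.ofReal (A * t₁ / 2) := by
    rw [← ENNReal.ofReal_mul (by positivity)]; congr 1; field_simp
  rw [h7]
  refine (mul_le_mul' le_rfl h6).trans (le_of_eq ?_)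
  rw [← mul_assoc, ← mul_assoc, ← ENNReal.ofReal_mul (by positivity),
    ← ENNReal.ofReal_mul (by positivity)]
  congr 2; field_simp

/-- If the variation over an interval is at least one, then a smaller symmetric interval has
variation exactly one. -/
theorem exists_unit_variation {f : ℝ → ℝ} (hf : Continuous f) {r R : ℝ} (hR : 0 ≤ R)
    (h : 1 ≤ ∫ s in (r - R)..(r + R), |f s|) :
    ∃ ρ, 0 < ρ ∧ ρ ≤ R ∧ ∫ s in (r - ρ)..(r + ρ), |f s| = 1 := by
  set F : ℝ → ℝ := fun ρ => ∫ s in (r - ρ)..(r + ρ), |f s| with hF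
  have hFe : ∀ ρ, F ρ = (∫ s in (0 : ℝ)..(r + ρ), |f s|) - ∫ s in (0 : ℝ)..(r - ρ), |f s| :=
    fun ρ => (intervalIntegral.integral_interval_sub_left (hf.abs.intervalIntegrable _ _)
      (hf.abs.intervalIntegrable _ _)).symm
  have hcont : Continuous F := by
    have h1 : Continuous fun x => ∫ s in (0 : ℝ)..x, |f s| :=
      intervalIntegral.continuous_primitive (fun a b => hf.abs.intervalIntegrable a b) 0
    rw [show F = _ from funext hFe]
    exact (h1.comp (by fun_prop : Continuous fun ρ : ℝ => r + ρ)).sub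
      (h1.comp (by fun_prop : Continuous fun ρ : ℝ => r - ρ))
  obtain ⟨ρ, hρ, hρe⟩ := intermediate_value_Icc hR hcont.continuousOn
    (show (1 : ℝ) ∈ Set.Icc (F 0) (F R) from ⟨by simp [hF], h⟩)
  refine ⟨ρ, lt_of_le_of_ne hρ.1 ?_, hρ.2, hρe⟩
  rintro rfl
  simp [hF] at hρe

/-- Where the variation of the phase is large, the amplitude is controlled with a gain. -/
theorem IsPhase.enorm_le_gain (hΨ : IsPhase m Ψ q w) (hV : IsAmplitude V Vx Vt)
    {r ρ t z : ℝ} (hρ : 0 < ρ) (hint : ∫ s in (r - ρ)..(r + ρ), |q s t| = 1)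
    (hz : z ∈ Set.Icc (r - ρ) (r + ρ)) :
    ‖V z t‖ₑ ≤ ENNReal.ofReal (Real.exp 1) * (ENNReal.ofReal (2 * ρ) ^ (1 / 2 : ℝ) *
      (sliceNorm Set.univ (fun x t => q x t * V x t) t +
        sliceNorm Set.univ (fun x t => Vx x t + q x t * V x t) t)) := by
  set J := Set.Icc (r - ρ) (r + ρ)
  have hvJ : volume J ≤ ENNReal.ofReal (2 * ρ) := by
    rw [Real.volume_Icc]; ring_nf; rfl
  have hqc := hΨ.cont_q_fst t
  have hVc := hV.cont_v_fst t
  have hone : ∫⁻ x in J, ‖q x t‖ₑ = 1 := by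
    rw [lintegral_Icc_enorm_eq hqc (by linarith), hint, ENNReal.ofReal_one]
  set I := ∫⁻ s in J, ‖Vx s t + q s t * V s t‖ₑ
  have hI : I ≤ ENNReal.ofReal (2 * ρ) ^ (1 / 2 : ℝ) *
      sliceNorm Set.univ (fun x t => Vx x t + q x t * V x t) t :=
    lintegral_le_sliceNorm (g := fun x t => Vx x t + q x t * V x t) (Set.subset_univ _)
      ((hΨ.cont_op_fst hV).comp (by fun_prop : Continuous fun x : ℝ => (x, t))) hvJ
  have hI' : ∫⁻ x in J, ‖(q x t : ℂ) * V x t‖ₑ ≤ ENNReal.ofReal (2 * ρ) ^ (1 / 2 : ℝ) *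
      sliceNorm Set.univ (fun x t => q x t * V x t) t :=
    lintegral_le_sliceNorm (g := fun x t => q x t * V x t) (Set.subset_univ _)
      (by fun_prop) hvJ
  have hqe : ∀ x, ‖(q x t : ℂ)‖ₑ = ‖q x t‖ₑ := fun x => by
    rw [← ofReal_norm, ← ofReal_norm, Complex.norm_real]
  have hm1 : Measurable fun x => ‖(q x t : ℂ) * V x t‖ₑ := Continuous.measurable (by fun_prop)
  have hm2 : Measurable fun x => ‖q x t‖ₑ := Continuous.measurable (by fun_prop)
  set E := ENNReal.ofReal (Real.exp 1)
  calc ‖V z t‖ₑ = ∫⁻ x in J, ‖q x t‖ₑ * ‖V z t‖ₑ := by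
        rw [lintegral_mul_const _ hm2, hone, one_mul]
    _ ≤ ∫⁻ x in J, E * (‖(q x t : ℂ) * V x t‖ₑ + ‖q x t‖ₑ * I) := by
        refine setLIntegral_mono' measurableSet_Icc fun x hx => ?_
        calc _ ≤ ‖q x t‖ₑ * (E * (‖V x t‖ₑ + I)) := by
              gcongr
              exact hΨ.enorm_le_horizontal hV hint.le hz hx
          _ = _ := by rw [enorm_mul, hqe]; ring
    _ = E * ((∫⁻ x in J, ‖(q x t : ℂ) * V x t‖ₑ) + I) := by
        rw [lintegral_const_mul' _ _ ENNReal.ofReal_ne_top, lintegral_add_left hm1,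
          lintegral_mul_const _ hm2, hone, one_mul]
    _ ≤ _ := by
        rw [mul_add (ENNReal.ofReal (2 * ρ) ^ (1 / 2 : ℝ))]
        exact mul_le_mul' le_rfl (add_le_add hI' hI)

end Local

theorem le_add_timeMean {t₁ : ℝ} (ht₁ : 0 < t₁) {S : Set ℝ} {k v a b : ℝ≥0∞} {G : ℝ → ℝ≥0∞}
    (hS : MeasurableSet (Set.Icc 0 t₁ ∩ S))
    (hk : ENNReal.ofReal t₁ ≤ k * volume (Set.Icc 0 t₁ ∩ S)) (hb : b ≠ ⊤)
    (h : ∀ t ∈ Set.Icc 0 t₁ ∩ S, v ≤ a + b * G t) : v ≤ a + k * b * timeMean t₁ G := by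
  have h1 : (v - a) * volume (Set.Icc 0 t₁ ∩ S) ≤ b * ∫⁻ t in Set.Icc 0 t₁, G t := by
    calc (v - a) * volume (Set.Icc 0 t₁ ∩ S) = ∫⁻ _t in Set.Icc 0 t₁ ∩ S, (v - a) := by
          rw [setLIntegral_const]
      _ ≤ ∫⁻ t in Set.Icc 0 t₁ ∩ S, b * G t :=
          setLIntegral_mono' hS fun t ht => tsub_le_iff_left.2 (h t ht)
      _ = b * ∫⁻ t in Set.Icc 0 t₁ ∩ S, G t := lintegral_const_mul' _ _ hb
      _ ≤ _ := mul_le_mul' le_rfl (lintegral_mono_set Set.inter_subset_left)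
  have h2 : ENNReal.ofReal t₁⁻¹ * ENNReal.ofReal t₁ = 1 := by
    rw [← ENNReal.ofReal_mul (by positivity), inv_mul_cancel₀ ht₁.ne', ENNReal.ofReal_one]
  rw [← tsub_le_iff_left]
  calc v - a = ENNReal.ofReal t₁⁻¹ * (ENNReal.ofReal t₁ * (v - a)) := by
        rw [← mul_assoc, h2, one_mul]
    _ ≤ ENNReal.ofReal t₁⁻¹ * (k * volume (Set.Icc 0 t₁ ∩ S) * (v - a)) :=
        mul_le_mul' le_rfl (mul_le_mul' hk le_rfl)
    _ = ENNReal.ofReal t₁⁻¹ * (k * ((v - a) * volume (Set.Icc 0 t₁ ∩ S))) := by ring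
    _ ≤ ENNReal.ofReal t₁⁻¹ * (k * (b * ∫⁻ t in Set.Icc 0 t₁, G t)) :=
        mul_le_mul' le_rfl (mul_le_mul' le_rfl h1)
    _ = _ := by rw [timeMean]; ring

theorem PolyLE.exists_integral_bound (m : ℕ) : ∃ K : ℝ, 1 ≤ K ∧ ∀ f, PolyLE m f →
    ∀ r ρ : ℝ, 0 < ρ → (∀ x ∈ Set.Icc (r - ρ) (r + ρ), |f x| * (2 * ρ) ≤
      K * ∫ s in (r - ρ)..(r + ρ), |f s|) ∧
    ∀ ε : ℝ, 0 < ε → ε ≤ 1 → ∫ s in (r - ρ)..(r + ρ), |f s| ≤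
      K * (ε ^ (m + 1))⁻¹ * ∫ s in (r - ε * ρ)..(r + ε * ρ), |f s| := by
  obtain ⟨K, hK, h⟩ := PolyLE.exists_value_bound m
  refine ⟨K, hK, fun f hf r ρ hρ => ⟨fun x hx => ?_, fun ε hε hε1 => ?_⟩⟩
  · have := h f hf (r - ρ) (r + ρ) (by linarith) 1 le_rfl x
      (by rw [abs_le]; constructor <;> linarith [hx.1, hx.2])
    have e : r + ρ - (r - ρ) = 2 * ρ := by ring
    rw [e] at this
    calc |f x| * (2 * ρ) ≤ (K * 1 ^ m * ((2 * ρ)⁻¹ * ∫ s in (r - ρ)..(r + ρ), |f s|)) * (2 * ρ) := by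
          gcongr
      _ = _ := by rw [one_pow]; field_simp
  · have hεr : 0 < ε * ρ := by positivity
    have hεr1 : ε * ρ ≤ ρ := by nlinarith
    set I := ∫ s in (r - ε * ρ)..(r + ε * ρ), |f s|
    have hb : ∀ x ∈ Set.Icc (r - ρ) (r + ρ), |f x| ≤ K * ε⁻¹ ^ m * ((2 * (ε * ρ))⁻¹ * I) := by
      intro x hx
      have := h f hf (r - ε * ρ) (r + ε * ρ) (by linarith) ε⁻¹ (by
        rw [le_inv_comm₀ one_pos hε]; simpa using hε1) x (by
        have e : ε⁻¹ * (r + ε * ρ - (r - ε * ρ)) = 2 * ρ := by field_simp; ring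
        rw [e, abs_le]; constructor <;> linarith [hx.1, hx.2])
      have e : r + ε * ρ - (r - ε * ρ) = 2 * (ε * ρ) := by ring
      rwa [e] at this
    calc _ ≤ ∫ s in (r - ρ)..(r + ρ), K * ε⁻¹ ^ m * ((2 * (ε * ρ))⁻¹ * I) :=
          intervalIntegral.integral_mono_on (by linarith)
            (hf.continuous.abs.intervalIntegrable _ _) (by simp) hb
      _ = _ := by
          rw [intervalIntegral.integral_const, smul_eq_mul, pow_succ, mul_inv, inv_pow]
          field_simp
          ring

/-- Estimate when the variation of the phase grows to a large value. -/
theorem IsPhase.enorm_le_of_growth (m : ℕ) : ∃ C₀ : ℝ≥0∞, C₀ ≠ ⊤ ∧ ∀ ε : ℝ, 0 < ε → ε ≤ 1 →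
    ∃ A : ℝ, 1 < A ∧ ∃ C : ℝ≥0∞, C ≠ ⊤ ∧ ∀ {Ψ q w : ℝ → ℝ → ℝ} {V Vx Vt : ℝ → ℝ → ℂ},
      IsPhase m Ψ q w → IsAmplitude V Vx Vt → ∀ r ρ t₁ : ℝ, 0 < t₁ → t₁ ≤ ρ →
      ∫ s in (r - ρ)..(r + ρ), |q s 0| ≤ 1 →
      (∀ t ∈ Set.Icc 0 t₁, ∫ s in (r - ρ)..(r + ρ), |q s t| ≤ A) →
      ∫ s in (r - ρ)..(r + ρ), |q s t₁| = A → (∀ t ∈ Set.Icc 0 t₁, Ψ r t ≤ Ψ r 0) →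
      ∀ x ∈ Set.Icc (r - ρ) (r + ρ), ‖V x 0‖ₑ ≤ ENNReal.ofReal ρ ^ (1 / 2 : ℝ) * (C *
        (sliceNorm Set.univ (fun x t => Vx x t + q x t * V x t) 0 +
          timeMean t₁ (sliceNorm Set.univ fun x t => Vt x t + w x t * V x t)) +
        C₀ * ENNReal.ofReal (2 * ε) ^ (1 / 2 : ℝ) * timeMean t₁ fun t =>
          sliceNorm Set.univ (fun x t => q x t * V x t) t +
            sliceNorm Set.univ (fun x t => Vx x t + q x t * V x t) t) := by
  obtain ⟨K, hK, hpoly⟩ := PolyLE.exists_integral_bound m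
  obtain ⟨K', hK', hlarge⟩ := IsPhase.exists_large_variation m
  set E := ENNReal.ofReal (Real.exp 1) with hE
  have hEt : E ≠ ⊤ := ENNReal.ofReal_ne_top
  refine ⟨ENNReal.ofReal (2 * K') * (E * E * E), by simp [ENNReal.mul_eq_top, hEt], ?_⟩
  intro ε hε hε1
  set A : ℝ := 2 * K * K' * (ε ^ (m + 1))⁻¹ with hA
  have hεp : 1 ≤ (ε ^ (m + 1))⁻¹ := by
    rw [le_inv_comm₀ one_pos (by positivity)]; simpa using pow_le_one₀ hε.le hε1
  have hKK : 1 ≤ K * K' := by nlinarith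
  have hA1 : 1 < A := by
    have : 1 ≤ K * K' * (ε ^ (m + 1))⁻¹ := by nlinarith
    have : A = 2 * (K * K' * (ε ^ (m + 1))⁻¹) := by rw [hA]; ring
    linarith
  have hA0 : 0 < A := by linarith
  have hK0 : 0 < K := by linarith
  set η : ℝ := (2 * K * A)⁻¹ with hη
  have hη0 : 0 < η := by positivity
  have hη1 : η ≤ 1 := by
    rw [hη]; apply inv_le_one_of_one_le₀; nlinarith
  refine ⟨A, hA1, E * 2 + E * E * ENNReal.ofReal η⁻¹ * 2, by
    simp [ENNReal.mul_eq_top, hEt], ?_⟩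
  intro Ψ q w V Vx Vt hΨ hV r ρ t₁ ht₁ htρ hint hle heq hdir x hx
  have hρ : 0 < ρ := ht₁.trans_le htρ
  have hηρ : 0 < η * ρ := by positivity
  have hηρ1 : η * ρ ≤ ρ := by nlinarith
  have hval : ∀ t ∈ Set.Icc 0 t₁, ∀ x ∈ Set.Icc (r - ρ) (r + ρ), |q x t| ≤ K * A / (2 * ρ) := by
    intro t ht x hx
    rw [le_div_iff₀ (by positivity)]
    refine ((hpoly _ (hΨ.poly_q_fst t) r ρ hρ).1 x hx).trans ?_
    have := hle t ht
    gcongr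
  have hshort : ∀ t ∈ Set.Icc 0 t₁, ∀ η', 0 ≤ η' → η' ≤ ρ →
      ∫ s in (r - η')..(r + η'), |q s t| ≤ K * A / ρ * η' := by
    intro t ht η' h0 h1
    calc _ ≤ ∫ s in (r - η')..(r + η'), K * A / (2 * ρ) :=
          intervalIntegral.integral_mono_on (by linarith)
            ((hΨ.cont_q_fst t).abs.intervalIntegrable _ _) (by simp)
            fun x hx => hval t ht x ⟨by linarith [hx.1], by linarith [hx.2]⟩
      _ = _ := by
          rw [intervalIntegral.integral_const, smul_eq_mul]; field_simp; ring
  have hhalf : ∀ t ∈ Set.Icc 0 t₁, ∫ s in (r - η * ρ)..(r + η * ρ), |q s t| ≤ 1 / 2 := by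
    intro t ht
    refine (hshort t ht _ hηρ.le hηρ1).trans (le_of_eq ?_)
    rw [hη]; field_simp
  have hrη : r ∈ Set.Icc (r - η * ρ) (r + η * ρ) := ⟨by linarith, by linarith⟩
  have hvert : ∀ z ∈ Set.Icc (r - η * ρ) (r + η * ρ), ∀ s ∈ Set.Icc 0 t₁, Ψ z s ≤ Ψ z 0 + 1 := by
    intro z hz s hs
    have e1 := hΨ.abs_sub_le (t := s) hrη hz
    have e2 := hΨ.abs_sub_le (t := 0) hrη hz
    have e3 := hhalf s hs
    have e3' := hhalf 0 ⟨le_rfl, ht₁.le⟩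
    have e4 := hdir s hs
    have e5 := le_abs_self (Ψ z s - Ψ r s)
    have e6 := neg_abs_le (Ψ z 0 - Ψ r 0)
    linarith
  set G : ℝ → ℝ≥0∞ := fun t => sliceNorm Set.univ (fun x t => q x t * V x t) t +
            sliceNorm Set.univ (fun x t => Vx x t + q x t * V x t) t
  set N₁ := sliceNorm Set.univ (fun x t => Vx x t + q x t * V x t) 0
  set I₂ := ∫⁻ s in Set.Icc 0 t₁, sliceNorm Set.univ (fun x t => Vt x t + w x t * V x t) s
  set P := ENNReal.ofReal ρ ^ (1 / 2 : ℝ)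
  set P₂ := ENNReal.ofReal (2 * ε) ^ (1 / 2 : ℝ)
  have hgain : ∀ t ∈ Set.Icc 0 t₁ ∩ {t | A / (2 * K') ≤ ∫ s in (r - ρ)..(r + ρ), |q s t|},
      ∀ z ∈ Set.Icc (r - η * ρ) (r + η * ρ), ‖V z t‖ₑ ≤ E * (P * P₂ * G t) := by
    rintro t ⟨ht, htS⟩ z hz
    have h1 : 1 ≤ ∫ s in (r - ε * ρ)..(r + ε * ρ), |q s t| := by
      have h2 := (show A / (2 * K') ≤ _ from htS).trans
        ((hpoly _ (hΨ.poly_q_fst t) r ρ hρ).2 ε hε hε1)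
      have h3 : A / (2 * K') = K * (ε ^ (m + 1))⁻¹ * 1 := by rw [hA]; field_simp
      rw [h3] at h2
      exact le_of_mul_le_mul_left h2 (by positivity)
    obtain ⟨ρ', hρ'0, hρ'ε, hρ'⟩ := exists_unit_variation (hΨ.cont_q_fst t)
      (by positivity : 0 ≤ ε * ρ) h1
    have hρ'ρ : ρ' ≤ ρ := hρ'ε.trans (by nlinarith)
    have hηρ' : η * ρ ≤ ρ' := by
      have h2 := hshort t ht ρ' hρ'0.le hρ'ρ
      rw [hρ'] at h2
      have h3 : η * ρ = (K * A / ρ)⁻¹ / 2 := by rw [hη]; field_simp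
      have h4 : (K * A / ρ)⁻¹ ≤ ρ' := by
        rw [inv_le_iff_one_le_mul₀ (by positivity)]; linarith
      rw [h3]; linarith
    have h5 := hΨ.enorm_le_gain hV (t := t) hρ'0 hρ' (z := z) ⟨by linarith [hz.1],
      by linarith [hz.2]⟩
    refine h5.trans (mul_le_mul' le_rfl (mul_le_mul' ?_ le_rfl))
    rw [← ENNReal.mul_rpow_of_nonneg _ _ (by norm_num), ← ENNReal.ofReal_mul hρ.le]
    refine ENNReal.rpow_le_rpow (ENNReal.ofReal_le_ofReal ?_) (by norm_num)
    nlinarith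
  have hkey : ∀ t ∈ Set.Icc 0 t₁ ∩ {t | A / (2 * K') ≤ ∫ s in (r - ρ)..(r + ρ), |q s t|},
      ‖V x 0‖ₑ ≤ (E * (2 * P * N₁) + E * E * ENNReal.ofReal (η⁻¹ * t₁⁻¹) * (2 * P * I₂)) +
        (E * E * E * (P * P₂)) * G t := by
    intro t ht
    have h1 := hΨ.enorm_le_transport hV hint (c := r - η * ρ) (d := r + η * ρ) (by linarith)
      (by linarith) (by linarith) ht.1 hvert hx
    have h2 : ∫⁻ z in Set.Icc (r - η * ρ) (r + η * ρ), ‖V z t‖ₑ ≤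
        ENNReal.ofReal (r + η * ρ - (r - η * ρ)) * (E * (P * P₂ * G t)) := by
      rw [← Real.volume_Icc, mul_comm (volume _), ← setLIntegral_const]
      exact setLIntegral_mono' measurableSet_Icc (hgain t ht)
    have h3 : ENNReal.ofReal (r + η * ρ - (r - η * ρ))⁻¹ *
        ENNReal.ofReal (r + η * ρ - (r - η * ρ)) = 1 := by
      have : 0 < r + η * ρ - (r - η * ρ) := by linarith
      rw [← ENNReal.ofReal_mul (by positivity), inv_mul_cancel₀ this.ne', ENNReal.ofReal_one]
    have h4 : ENNReal.ofReal (r + η * ρ - (r - η * ρ))⁻¹ ≤ ENNReal.ofReal (η⁻¹ * t₁⁻¹) := by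
      apply ENNReal.ofReal_le_ofReal
      rw [← mul_inv]
      apply inv_anti₀ (by positivity)
      nlinarith
    have h5 := ENNReal.ofReal_two_mul_sqrt_le ρ
    refine h1.trans ?_
    set D := ENNReal.ofReal (r + η * ρ - (r - η * ρ))⁻¹
    set D' := ENNReal.ofReal (r + η * ρ - (r - η * ρ))
    calc _ ≤ E * (2 * P * N₁) + E * E * D * (D' * (E * (P * P₂ * G t)) + 2 * P * I₂) := by
          gcongr
      _ = E * (2 * P * N₁) + E * E * D * (2 * P * I₂) + (E * E * E * (P * P₂)) * (D * D') * G t := by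
          ring
      _ ≤ _ := by
          rw [h3, mul_one]; gcongr
  have hPt : P ≠ ⊤ := ENNReal.rpow_ne_top_of_nonneg (by norm_num) ENNReal.ofReal_ne_top
  have hP2t : P₂ ≠ ⊤ := ENNReal.rpow_ne_top_of_nonneg (by norm_num) ENNReal.ofReal_ne_top
  have hfin := le_add_timeMean ht₁ (measurableSet_Icc.inter
    (measurableSet_le measurable_const (hΨ.continuous_variation _ _).measurable))
    (hlarge hΨ (r - ρ) (r + ρ) t₁ A (by linarith) ht₁ hA0 hle heq)
    (by simp [ENNReal.mul_eq_top, hEt, hPt, hP2t]) hkey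
  refine hfin.trans ?_
  rw [ENNReal.ofReal_mul (by positivity : 0 ≤ η⁻¹)]
  calc _ = P * ((E * 2 * N₁ + E * E * ENNReal.ofReal η⁻¹ * 2 * (ENNReal.ofReal t₁⁻¹ * I₂)) +
        ENNReal.ofReal (2 * K') * (E * E * E) * P₂ * timeMean t₁ G) := by ring
    _ ≤ _ := by
        refine mul_le_mul' le_rfl (add_le_add ?_ le_rfl)
        rw [mul_add]
        exact add_le_add (mul_le_mul' le_self_add le_rfl) (mul_le_mul' le_add_self le_rfl)

theorem ENNReal.le_add_inv_mul {M v a b : ℝ≥0∞} (h0 : M ≠ 0) (ht : M ≠ ⊤)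
    (h : M * v ≤ M * a + b) : v ≤ a + M⁻¹ * b := by
  calc v = M⁻¹ * (M * v) := by rw [← mul_assoc, ENNReal.inv_mul_cancel h0 ht, one_mul]
    _ ≤ M⁻¹ * (M * a + b) := mul_le_mul' le_rfl h
    _ = _ := by rw [mul_add, ← mul_assoc, ENNReal.inv_mul_cancel h0 ht, one_mul]

theorem enorm_le_add_lintegral {v v' : ℝ → ℂ} (hv : ∀ s, HasDerivAt v (v' s) s)
    (hc : Continuous v') {t t₁ : ℝ} (ht : t ∈ Set.Icc 0 t₁) :
    ‖v 0‖ₑ ≤ ‖v t‖ₑ + ∫⁻ s in Set.Icc 0 t₁, ‖v' s‖ₑ := by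
  have h := enorm_le_of_le_add (p := fun _ => 0) (p' := fun _ => 0)
    (fun s => hasDerivAt_const s (0 : ℝ)) hv continuous_const hc (h := 0) (x := 0) (z := t)
    (fun s _ => by simp)
  simp only [Real.exp_zero, ENNReal.ofReal_one, one_mul, Complex.ofReal_zero, zero_mul,
    add_zero] at h
  refine h.trans (add_le_add le_rfl (lintegral_mono_set ?_))
  exact Set.uIoc_subset_uIcc.trans (Set.uIcc_subset_Icc ⟨le_rfl, ht.1.trans ht.2⟩ ht)

/-- Size of the vertical derivative of a phase on a rectangle in terms of its integral over a
subrectangle. -/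
theorem IsPhase.exists_vertical_bound (m : ℕ) {κ : ℝ} (hκ : 0 < κ) (hκ2 : κ ≤ 2) :
    ∃ K : ℝ, 1 ≤ K ∧ ∀ {Ψ q w : ℝ → ℝ → ℝ}, IsPhase m Ψ q w → ∀ r ρ c d : ℝ, 0 < ρ →
      κ * ρ ≤ d - c → Set.Icc c d ⊆ Set.Icc (r - ρ) (r + ρ) →
      ∀ z ∈ Set.Icc (r - ρ) (r + ρ), ∀ t ∈ Set.Icc 0 ρ,
        ‖w z t‖ₑ ≤ ENNReal.ofReal (K * (ρ * ρ)⁻¹) *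
          ∫⁻ z in Set.Icc c d, ∫⁻ t in Set.Icc 0 ρ, ‖w z t‖ₑ := by
  obtain ⟨K, hK, hval⟩ := PolyLE.exists_value_bound_enorm m
  have hL : 1 ≤ 2 / κ := by rw [le_div_iff₀ hκ]; linarith
  have hK0 : 0 < K := by linarith
  refine ⟨max 1 (K * (K * (2 / κ) ^ m) * κ⁻¹), le_max_left _ _, ?_⟩
  intro Ψ q w hΨ r ρ c d hρ hcd hsub z hz t ht
  have hdc : 0 < d - c := by nlinarith
  set M := ∫⁻ z in Set.Icc c d, ∫⁻ t in Set.Icc 0 ρ, ‖w z t‖ₑ with hM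
  have hwm : Measurable (Function.uncurry fun x t => ‖w x t‖ₑ) :=
    Continuous.measurable (by simp only [Function.uncurry_def]; have := hΨ.cont_w; fun_prop)
  have hc := hsub (Set.left_mem_Icc.2 (by linarith))
  have h1 : ‖w z t‖ₑ * ENNReal.ofReal ρ ≤
      ENNReal.ofReal K * ∫⁻ s in Set.Icc 0 ρ, ‖w z s‖ₑ := by
    have := hval _ (hΨ.poly_w_snd z) 0 ρ hρ 1 le_rfl t
      (by rw [sub_zero, sub_zero, one_mul, abs_of_nonneg ht.1]; exact ht.2)
    simpa using this
  have h2 : ∀ s, ‖w z s‖ₑ * ENNReal.ofReal (d - c) ≤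
      ENNReal.ofReal (K * (2 / κ) ^ m) * ∫⁻ z' in Set.Icc c d, ‖w z' s‖ₑ := by
    intro s
    refine hval _ (hΨ.poly_w s) c d (by linarith) (2 / κ) hL z ?_
    have : 2 / κ * (κ * ρ) ≤ 2 / κ * (d - c) := by gcongr
    have e : 2 / κ * (κ * ρ) = 2 * ρ := by field_simp
    rw [abs_le]; constructor <;> linarith [hz.1, hz.2, hc.1, hc.2]
  have h3 : ‖w z t‖ₑ * ENNReal.ofReal ρ * ENNReal.ofReal (d - c) ≤
      ENNReal.ofReal (K * (K * (2 / κ) ^ m)) * M := by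
    calc _ ≤ (ENNReal.ofReal K * ∫⁻ s in Set.Icc 0 ρ, ‖w z s‖ₑ) * ENNReal.ofReal (d - c) :=
          mul_le_mul' h1 le_rfl
      _ = ENNReal.ofReal K * ∫⁻ s in Set.Icc 0 ρ, ‖w z s‖ₑ * ENNReal.ofReal (d - c) := by
          rw [lintegral_mul_const' _ _ ENNReal.ofReal_ne_top, mul_assoc]
      _ ≤ ENNReal.ofReal K * ∫⁻ s in Set.Icc 0 ρ,
          ENNReal.ofReal (K * (2 / κ) ^ m) * ∫⁻ z' in Set.Icc c d, ‖w z' s‖ₑ :=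
          mul_le_mul' le_rfl (lintegral_mono h2)
      _ = _ := by
          rw [lintegral_const_mul' _ _ ENNReal.ofReal_ne_top, hM,
            lintegral_lintegral_swap hwm.aemeasurable,
            ENNReal.ofReal_mul (q := K * (2 / κ) ^ m) hK0.le, mul_assoc]
  calc ‖w z t‖ₑ = ‖w z t‖ₑ * ENNReal.ofReal ρ * ENNReal.ofReal (d - c) *
        ENNReal.ofReal (ρ * (d - c))⁻¹ := by
        rw [mul_assoc ‖w z t‖ₑ, ← ENNReal.ofReal_mul hρ.le, mul_assoc,
          ← ENNReal.ofReal_mul (by positivity), mul_inv_cancel₀ (by positivity),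
          ENNReal.ofReal_one, mul_one]
    _ ≤ ENNReal.ofReal (K * (K * (2 / κ) ^ m)) * M * ENNReal.ofReal (κ⁻¹ * (ρ * ρ)⁻¹) := by
        refine mul_le_mul' h3 (ENNReal.ofReal_le_ofReal ?_)
        rw [← mul_inv]
        apply inv_anti₀ (by positivity)
        nlinarith
    _ = ENNReal.ofReal (K * (K * (2 / κ) ^ m) * κ⁻¹ * (ρ * ρ)⁻¹) * M := by
        rw [mul_right_comm, ← ENNReal.ofReal_mul (by positivity)]; ring_nf
    _ ≤ _ := by gcongr; exact le_max_right _ _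

/-- If `∂ₓΨ` has unit variation at time zero but vanishes at some time over each point of an
interval, then `∂ₜΨ` is not small. -/
theorem IsPhase.exists_vertical_mass (m : ℕ) {κ : ℝ} (hκ : 0 < κ) (hκ2 : κ ≤ 2) :
    ∃ μ : ℝ, 0 < μ ∧ ∀ {Ψ q w : ℝ → ℝ → ℝ}, IsPhase m Ψ q w → ∀ r ρ c d : ℝ, 0 < ρ →
      κ * ρ ≤ d - c → Set.Icc c d ⊆ Set.Icc (r - ρ) (r + ρ) →
      ∫ s in (r - ρ)..(r + ρ), |q s 0| = 1 →
      (∀ z ∈ Set.Icc c d, ∃ t ∈ Set.Icc 0 ρ, q z t = 0) →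
      ENNReal.ofReal (μ * ρ) ≤ ∫⁻ z in Set.Icc c d, ∫⁻ t in Set.Icc 0 ρ, ‖w z t‖ₑ := by
  obtain ⟨K₁, hK₁, hvert⟩ := IsPhase.exists_vertical_bound m hκ hκ2
  obtain ⟨K₂, hK₂, hder⟩ := PolyLE.exists_deriv_bound m
  obtain ⟨K₃, hK₃, hval⟩ := PolyLE.exists_value_bound m
  have hL : 1 ≤ 2 / κ := by rw [le_div_iff₀ hκ]; linarith
  set D := K₁ * K₂ * (K₃ * (2 / κ) ^ m) with hD
  have hD0 : 0 < D := by positivity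
  refine ⟨1 / (2 * D), by positivity, ?_⟩
  intro Ψ q w hΨ r ρ c d hρ hcd hsub hint hzero
  by_contra hcon
  rw [not_le] at hcon
  set μ := 1 / (2 * D) with hμ
  have hμ0 : 0 < μ := by positivity
  have hdc : 0 < d - c := by nlinarith
  have hc := hsub (Set.left_mem_Icc.2 (by linarith))
  have hw : ∀ z ∈ Set.Icc (r - ρ) (r + ρ), ∀ t ∈ Set.Icc 0 ρ, |w z t| ≤ K₁ * μ * ρ⁻¹ := by
    intro z hz t ht
    have h1 := (hvert hΨ r ρ c d hρ hcd hsub z hz t ht).trans (mul_le_mul' le_rfl hcon.le)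
    rw [← ENNReal.ofReal_mul (by positivity), Real.enorm_eq_ofReal_abs,
      ENNReal.ofReal_le_ofReal_iff (by positivity)] at h1
    refine h1.trans (le_of_eq ?_)
    field_simp
  have hΨ0 : ∀ z ∈ Set.Icc (r - ρ) (r + ρ), ∀ t ∈ Set.Icc 0 ρ, |Ψ z t - Ψ z 0| ≤ K₁ * μ := by
    intro z hz t ht
    have h1 := (convex_Icc (0 : ℝ) ρ).norm_image_sub_le_of_norm_hasDerivWithin_le
      (fun s _ => (hΨ.hasDerivAt_snd z s).hasDerivWithinAt) (hw z hz)
      (Set.left_mem_Icc.2 hρ.le) ht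
    rw [Real.norm_eq_abs, Real.norm_eq_abs, sub_zero, abs_of_nonneg ht.1] at h1
    calc _ ≤ K₁ * μ * ρ⁻¹ * t := h1
      _ ≤ K₁ * μ * ρ⁻¹ * ρ := by gcongr; exact ht.2
      _ = _ := by field_simp
  have hq : ∀ z ∈ Set.Icc (r - ρ) (r + ρ), ∀ t ∈ Set.Icc 0 ρ,
      |q z t - q z 0| * (2 * ρ) ≤ K₂ * (K₁ * μ) := by
    intro z hz t ht
    have h1 := hder (fun z => Ψ z t - Ψ z 0) ((hΨ.poly_fst t).sub (hΨ.poly_fst 0)) (r - ρ) (r + ρ)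
      (by linarith) (K₁ * μ) 0 (fun s hs => by simpa using hΨ0 s hs t ht) z hz
    have e' : deriv (fun z => Ψ z t - Ψ z 0) z = q z t - q z 0 :=
      ((hΨ.hasDerivAt_fst z t).sub (hΨ.hasDerivAt_fst z 0)).deriv
    rw [e'] at h1
    have e : r + ρ - (r - ρ) = 2 * ρ := by ring
    rwa [e] at h1
  have hq0 : ∀ z ∈ Set.Icc c d, |q z 0| ≤ K₂ * (K₁ * μ) / (2 * ρ) := by
    intro z hz
    obtain ⟨t, ht, hzt⟩ := hzero z hz
    have := hq z (hsub hz) t ht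
    rw [hzt, zero_sub, abs_neg] at this
    rwa [le_div_iff₀ (by positivity)]
  have hav : (d - c)⁻¹ * ∫ s in c..d, |q s 0| ≤ K₂ * (K₁ * μ) / (2 * ρ) := by
    have : ∫ s in c..d, |q s 0| ≤ ∫ s in c..d, K₂ * (K₁ * μ) / (2 * ρ) :=
      intervalIntegral.integral_mono_on (by linarith)
        ((hΨ.cont_q_fst 0).abs.intervalIntegrable _ _) (by simp) hq0
    rw [intervalIntegral.integral_const, smul_eq_mul] at this
    rwa [inv_mul_le_iff₀ hdc]
  have hall : ∀ x ∈ Set.Icc (r - ρ) (r + ρ),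
      |q x 0| ≤ K₃ * (2 / κ) ^ m * (K₂ * (K₁ * μ) / (2 * ρ)) := by
    intro x hx
    refine (hval _ (hΨ.poly_q_fst 0) c d (by linarith) (2 / κ) hL x ?_).trans
      (by gcongr)
    have : 2 / κ * (κ * ρ) ≤ 2 / κ * (d - c) := by gcongr
    have e : 2 / κ * (κ * ρ) = 2 * ρ := by field_simp
    rw [abs_le]; constructor <;> linarith [hx.1, hx.2, hc.1, hc.2]
  have hone : (1 : ℝ) ≤ 1 / 2 := by
    calc (1 : ℝ) = ∫ s in (r - ρ)..(r + ρ), |q s 0| := hint.symm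
      _ ≤ ∫ s in (r - ρ)..(r + ρ), K₃ * (2 / κ) ^ m * (K₂ * (K₁ * μ) / (2 * ρ)) :=
          intervalIntegral.integral_mono_on (by linarith)
            ((hΨ.cont_q_fst 0).abs.intervalIntegrable _ _) (by simp) hall
      _ = D * μ := by
          rw [intervalIntegral.integral_const, smul_eq_mul, hD]; field_simp; ring
      _ = 1 / 2 := by rw [hμ]; field_simp
  norm_num at hone

/-- Estimate by the amplitude over an interval above each point of which `∂ₓΨ` vanishes. -/
theorem IsPhase.enorm_le_of_vertical_zeros (m : ℕ) {κ : ℝ} (hκ : 0 < κ) (hκ2 : κ ≤ 2) :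
    ∃ C : ℝ≥0∞, C ≠ ⊤ ∧ ∀ {Ψ q w : ℝ → ℝ → ℝ} {V Vx Vt : ℝ → ℝ → ℂ},
      IsPhase m Ψ q w → IsAmplitude V Vx Vt → ∀ (X : Set ℝ) (r ρ c d : ℝ), 0 < ρ →
      κ * ρ ≤ d - c → Set.Icc c d ⊆ Set.Icc (r - ρ) (r + ρ) → Set.Icc c d ⊆ X →
      ∫ s in (r - ρ)..(r + ρ), |q s 0| = 1 →
      (∀ z ∈ Set.Icc c d, ∃ t ∈ Set.Icc 0 ρ, q z t = 0) →
      ∀ x ∈ Set.Icc (r - ρ) (r + ρ), ‖V x 0‖ₑ ≤ ENNReal.ofReal ρ ^ (1 / 2 : ℝ) * (C *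
        (sliceNorm Set.univ (fun x t => Vx x t + q x t * V x t) 0 +
          timeMean ρ (sliceNorm X fun x t => w x t * V x t) +
          timeMean ρ (sliceNorm X Vt))) := by
  obtain ⟨K, hK, hvert⟩ := IsPhase.exists_vertical_bound m hκ hκ2
  obtain ⟨μ, hμ, hmass⟩ := IsPhase.exists_vertical_mass m hκ hκ2
  set E := ENNReal.ofReal (Real.exp 1) with hE
  have hEt : E ≠ ⊤ := ENNReal.ofReal_ne_top
  refine ⟨E * 2 * (1 + ENNReal.ofReal K + ENNReal.ofReal μ⁻¹), by
    simp [ENNReal.mul_eq_top, hEt], ?_⟩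
  intro Ψ q w V Vx Vt hΨ hV X r ρ c d hρ hcd hsub hX hint hzero x hx
  set M := ∫⁻ z in Set.Icc c d, ∫⁻ t in Set.Icc 0 ρ, ‖w z t‖ₑ with hM
  have hMge : ENNReal.ofReal (μ * ρ) ≤ M := hmass hΨ r ρ c d hρ hcd hsub hint hzero
  have hM0 : M ≠ 0 := fun h => by
    rw [h, nonpos_iff_eq_zero, ENNReal.ofReal_eq_zero] at hMge
    have : 0 < μ * ρ := by positivity
    linarith
  have hwm : Measurable (Function.uncurry fun x t => ‖w x t‖ₑ) :=
    Continuous.measurable (by simp only [Function.uncurry_def]; have := hΨ.cont_w; fun_prop)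
  have hwVm : Measurable (Function.uncurry fun x t => ‖(w x t : ℂ) * V x t‖ₑ) :=
    Continuous.measurable (by
      simp only [Function.uncurry_def]; have := hΨ.cont_w; have := hV.cont; fun_prop)
  have hVtm : Measurable (Function.uncurry fun x t => ‖Vt x t‖ₑ) :=
    Continuous.measurable (by simp only [Function.uncurry_def]; have := hV.cont_snd; fun_prop)
  have hMt : M ≠ ⊤ := by
    obtain ⟨B, hB⟩ := ((isCompact_Icc (a := c) (b := d)).prod
      (isCompact_Icc (a := (0 : ℝ)) (b := ρ))).exists_bound_of_continuousOn hΨ.cont_w.continuousOn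
    refine ne_top_of_le_ne_top (b := ENNReal.ofReal B * volume (Set.Icc 0 ρ) * volume (Set.Icc c d))
      (by simp [ENNReal.mul_eq_top]) ?_
    rw [← setLIntegral_const]
    refine setLIntegral_mono' measurableSet_Icc fun z hz => ?_
    rw [← setLIntegral_const]
    refine setLIntegral_mono' measurableSet_Icc fun t ht => ?_
    rw [← ofReal_norm]
    exact ENNReal.ofReal_le_ofReal (hB (z, t) ⟨hz, ht⟩)
  have hvJ : volume (Set.Icc (r - ρ) (r + ρ)) ≤ ENNReal.ofReal (2 * ρ) := by
    rw [Real.volume_Icc]; ring_nf; rfl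
  have hvJ' : volume (Set.Icc c d) ≤ ENNReal.ofReal (2 * ρ) := (measure_mono hsub).trans hvJ
  set N₁ := sliceNorm Set.univ (fun x t => Vx x t + q x t * V x t) 0
  set N₂ := sliceNorm X fun x t => (w x t : ℂ) * V x t
  set N₃ := sliceNorm X Vt
  set P := ENNReal.ofReal ρ ^ (1 / 2 : ℝ) with hP
  set I := ∫⁻ s in Set.Icc (r - ρ) (r + ρ), ‖Vx s 0 + q s 0 * V s 0‖ₑ
  have hI : I ≤ 2 * P * N₁ :=
    (lintegral_le_sliceNorm (g := fun x t => Vx x t + q x t * V x t) (Set.subset_univ _)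
      ((hΨ.cont_op_fst hV).comp (by fun_prop : Continuous fun x : ℝ => (x, (0 : ℝ)))) hvJ).trans
      (mul_le_mul' (ENNReal.ofReal_two_mul_sqrt_le ρ) le_rfl)
  set T : ℝ → ℝ≥0∞ := fun z => ∫⁻ s in Set.Icc 0 ρ, ‖Vt z s‖ₑ with hT
  have hTm : Measurable T := hVtm.lintegral_prod_right'
  have hqe : ∀ x t, ‖(w x t : ℂ)‖ₑ = ‖w x t‖ₑ := fun x t => by
    rw [← ofReal_norm, ← ofReal_norm, Complex.norm_real]
  have hpt : ∀ z ∈ Set.Icc c d, ∀ t ∈ Set.Icc 0 ρ, ‖w z t‖ₑ * ‖V x 0‖ₑ ≤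
      E * ‖(w z t : ℂ) * V z t‖ₑ + ‖w z t‖ₑ * (E * (T z + I)) := by
    intro z hz t ht
    calc ‖w z t‖ₑ * ‖V x 0‖ₑ ≤ ‖w z t‖ₑ * (E * (‖V z t‖ₑ + T z + I)) := by
          refine mul_le_mul' le_rfl ((hΨ.enorm_le_horizontal hV hint.le hx (hsub hz)).trans ?_)
          exact mul_le_mul' le_rfl (add_le_add (enorm_le_add_lintegral
            (fun s => hV.hasDerivAt_snd z s) (hV.cont_vt_snd z) ht) le_rfl)
      _ = _ := by rw [enorm_mul, hqe]; ring
  have hwint : ∀ z ∈ Set.Icc c d, ∫⁻ t in Set.Icc 0 ρ, ‖w z t‖ₑ ≤ ENNReal.ofReal (K * ρ⁻¹) * M := by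
    intro z hz
    calc _ ≤ ∫⁻ _t in Set.Icc 0 ρ, ENNReal.ofReal (K * (ρ * ρ)⁻¹) * M :=
          setLIntegral_mono' measurableSet_Icc (hvert hΨ r ρ c d hρ hcd hsub z (hsub hz))
      _ = _ := by
          rw [setLIntegral_const, Real.volume_Icc, sub_zero, mul_right_comm,
            ← ENNReal.ofReal_mul (by positivity)]
          congr 2; field_simp
  set W := ∫⁻ z in Set.Icc c d, ∫⁻ t in Set.Icc 0 ρ, ‖(w z t : ℂ) * V z t‖ₑ
  have hWle : W ≤ 2 * P * ∫⁻ t in Set.Icc 0 ρ, N₂ t :=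
    (lintegral_lintegral_le_sliceNorm (g := fun x t => (w x t : ℂ) * V x t) hX (by
      have := hΨ.cont_w; have := hV.cont; fun_prop) hvJ').trans
      (mul_le_mul' (ENNReal.ofReal_two_mul_sqrt_le ρ) le_rfl)
  have hTle : ∫⁻ z in Set.Icc c d, T z ≤ 2 * P * ∫⁻ t in Set.Icc 0 ρ, N₃ t :=
    (lintegral_lintegral_le_sliceNorm hX hV.cont_snd hvJ').trans
      (mul_le_mul' (ENNReal.ofReal_two_mul_sqrt_le ρ) le_rfl)
  have hmain : M * ‖V x 0‖ₑ ≤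
      M * (E * I + E * ENNReal.ofReal (K * ρ⁻¹) * ∫⁻ z in Set.Icc c d, T z) + E * W := by
    calc M * ‖V x 0‖ₑ = ∫⁻ z in Set.Icc c d, ∫⁻ t in Set.Icc 0 ρ, ‖w z t‖ₑ * ‖V x 0‖ₑ := by
          have hm1 : Measurable fun z => ∫⁻ t in Set.Icc 0 ρ, ‖w z t‖ₑ :=
            hwm.lintegral_prod_right'
          rw [hM, ← lintegral_mul_const _ hm1]
          refine lintegral_congr fun z => ?_
          have hm2 : Measurable fun t => ‖w z t‖ₑ := hwm.comp measurable_prodMk_left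
          rw [← lintegral_mul_const _ hm2]
      _ ≤ ∫⁻ z in Set.Icc c d, ∫⁻ t in Set.Icc 0 ρ,
          (E * ‖(w z t : ℂ) * V z t‖ₑ + ‖w z t‖ₑ * (E * (T z + I))) :=
          setLIntegral_mono' measurableSet_Icc fun z hz =>
            setLIntegral_mono' measurableSet_Icc (hpt z hz)
      _ = ∫⁻ z in Set.Icc c d, (E * (∫⁻ t in Set.Icc 0 ρ, ‖(w z t : ℂ) * V z t‖ₑ) +
          ((∫⁻ t in Set.Icc 0 ρ, ‖w z t‖ₑ) * (E * I) +
            (∫⁻ t in Set.Icc 0 ρ, ‖w z t‖ₑ) * (E * T z))) := by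
          refine lintegral_congr fun z => ?_
          have hm1 : Measurable fun t => ‖w z t‖ₑ := hwm.comp measurable_prodMk_left
          have hm2 : Measurable fun t => ‖(w z t : ℂ) * V z t‖ₑ :=
            hwVm.comp measurable_prodMk_left
          rw [lintegral_add_left (hm2.const_mul _), lintegral_const_mul _ hm2,
            lintegral_mul_const _ hm1]
          ring
      _ ≤ ∫⁻ z in Set.Icc c d, (E * (∫⁻ t in Set.Icc 0 ρ, ‖(w z t : ℂ) * V z t‖ₑ) +
          ((∫⁻ t in Set.Icc 0 ρ, ‖w z t‖ₑ) * (E * I) +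
            (ENNReal.ofReal (K * ρ⁻¹) * M * E) * T z)) := by
          refine setLIntegral_mono' measurableSet_Icc fun z hz => ?_
          refine add_le_add le_rfl (add_le_add le_rfl ?_)
          rw [mul_assoc _ E (T z)]
          exact mul_le_mul' (hwint z hz) le_rfl
      _ = _ := by
          have hm1 : Measurable fun z => ∫⁻ t in Set.Icc 0 ρ, ‖w z t‖ₑ :=
            hwm.lintegral_prod_right'
          have hm2 : Measurable fun z => ∫⁻ t in Set.Icc 0 ρ, ‖(w z t : ℂ) * V z t‖ₑ :=
            hwVm.lintegral_prod_right'
          rw [lintegral_add_left (hm2.const_mul _), lintegral_add_left (hm1.mul_const _),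
            lintegral_const_mul _ hm2, lintegral_mul_const _ hm1, lintegral_const_mul _ hTm]
          ring
  refine (ENNReal.le_add_inv_mul hM0 hMt hmain).trans ?_
  have hMinv : M⁻¹ ≤ ENNReal.ofReal μ⁻¹ * ENNReal.ofReal ρ⁻¹ := by
    rw [← ENNReal.ofReal_mul (by positivity), ← mul_inv, ENNReal.ofReal_inv_of_pos (by positivity)]
    exact ENNReal.inv_le_inv.2 hMge
  rw [ENNReal.ofReal_mul (by positivity : 0 ≤ K)]
  set m₂ := ∫⁻ t in Set.Icc 0 ρ, N₂ t
  set m₃ := ∫⁻ t in Set.Icc 0 ρ, N₃ t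
  set k := ENNReal.ofReal K
  set u := ENNReal.ofReal μ⁻¹
  set o := ENNReal.ofReal ρ⁻¹
  have e2 : timeMean ρ N₂ = o * m₂ := rfl
  have e3 : timeMean ρ N₃ = o * m₃ := rfl
  rw [e2, e3]
  calc _ ≤ E * (2 * P * N₁) + E * (k * o) * (2 * P * m₃) + u * o * (E * (2 * P * m₂)) := by
        refine add_le_add (add_le_add (mul_le_mul' le_rfl hI) (mul_le_mul' le_rfl hTle))
          (mul_le_mul' hMinv (mul_le_mul' le_rfl hWle))
    _ = P * (E * 2 * (N₁ + u * (o * m₂) + k * (o * m₃))) := by ring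
    _ ≤ P * (E * 2 * ((1 + k + u) * N₁ + (1 + k + u) * (o * m₂) + (1 + k + u) * (o * m₃))) := by
        refine mul_le_mul' le_rfl (mul_le_mul' le_rfl (add_le_add (add_le_add ?_ ?_) ?_))
        · rw [add_assoc, add_mul, one_mul]; exact le_self_add
        · exact mul_le_mul' le_add_self le_rfl
        · exact mul_le_mul' (le_add_self.trans le_self_add) le_rfl
    _ = _ := by ring

theorem NoDeepValley.mono {p : ℝ → ℝ} {h h' a b : ℝ} (H : NoDeepValley p h a b) (hh : h ≤ h') :
    NoDeepValley p h' a b :=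
  fun s x t h1 h2 h3 h4 => (H s x t h1 h2 h3 h4).trans (by linarith)

theorem NoDeepValley.comp_neg {p : ℝ → ℝ} {h a b : ℝ} (H : NoDeepValley p h a b) :
    NoDeepValley (fun x => p (-x)) h (-b) (-a) := fun s x t h1 h2 h3 h4 => by
  rw [min_comm]
  exact H (-t) (-x) (-s) (by linarith) (by linarith) (by linarith) (by linarith)

theorem exists_deriv_neg {p q : ℝ → ℝ} (hp : ∀ x, HasDerivAt p (q x) x) {s x : ℝ} (hsx : s < x)
    (h : p x < p s) : ∃ y ∈ Set.Ioo s x, q y < 0 := by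
  obtain ⟨y, hy, he⟩ := exists_hasDerivAt_eq_slope p q hsx
    (fun z _ => (hp z).continuousAt.continuousWithinAt) (fun z _ => hp z)
  refine ⟨y, hy, ?_⟩
  rw [he]
  exact div_neg_of_neg_of_pos (by linarith) (by linarith)

theorem exists_deriv_pos {p q : ℝ → ℝ} (hp : ∀ x, HasDerivAt p (q x) x) {s x : ℝ} (hsx : s < x)
    (h : p s < p x) : ∃ y ∈ Set.Ioo s x, 0 < q y := by
  obtain ⟨y, hy, he⟩ := exists_hasDerivAt_eq_slope p q hsx
    (fun z _ => (hp z).continuousAt.continuousWithinAt) (fun z _ => hp z)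
  refine ⟨y, hy, ?_⟩
  rw [he]
  exact div_pos (by linarith) (by linarith)

theorem NoSignChange.noDeepValley {p q : ℝ → ℝ} (hp : ∀ x, HasDerivAt p (q x) x) {a b : ℝ}
    (h : NoSignChange q (Set.Ioo a b)) : NoDeepValley p 0 a b := by
  intro s x t h1 h2 h3 h4
  by_contra hc
  rw [not_le, add_zero, lt_min_iff] at hc
  obtain ⟨y, hy, hy'⟩ := exists_deriv_neg hp h2 hc.1
  obtain ⟨z, hz, hz'⟩ := exists_deriv_pos hp h3 hc.2
  have := h y ⟨h1.trans hy.1, by linarith [hy.2]⟩ z ⟨by linarith [hz.1], hz.2.trans h4⟩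
    (hy.2.trans hz.1) hy'
  linarith

/-- A phase whose derivative is not too negative to the left of its only possible valley has no
deep valley. -/
theorem noDeepValley_of_left (m : ℕ) : ∃ ε : ℝ, 0 < ε ∧ ε ≤ 1 ∧ ∀ p q : ℝ → ℝ,
    (∀ x, HasDerivAt p (q x) x) → PolyLE m q → ∀ a b r ρ : ℝ, 0 < ρ →
    Set.Icc (r - ρ) (r + ρ) ⊆ Set.Ioo a b → ∫ s in (r - ρ)..(r + ρ), |q s| = 1 →
    (∀ s ∈ Set.Ioo a b, ∀ t ∈ Set.Ioo a b, s < t → q s < 0 → 0 < q t → s ≤ r ∧ r ≤ t) →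
    (∀ x ∈ Set.Icc (r - ρ) r, -ε ≤ q x * ρ) → NoDeepValley p 1 a b := by
  obtain ⟨K, hK, hval⟩ := PolyLE.exists_value_bound m
  have h2m : (1 : ℝ) ≤ 2 ^ m := one_le_pow₀ (by norm_num)
  have hKm : 1 ≤ K * 2 ^ m := by nlinarith
  refine ⟨1 / (4 * (K * 2 ^ m)), by positivity, by
    rw [div_le_one (by positivity)]; linarith, ?_⟩
  set ε := 1 / (4 * (K * 2 ^ m)) with hε
  have hε0 : 0 < ε := by positivity
  have hε1 : ε ≤ 1 := by rw [hε, div_le_one (by positivity)]; linarith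
  intro p q hp hq a b r ρ hρ hJ hint hstr hleft
  have hqc : Continuous q := hq.continuous
  have hpos : ∃ x ∈ Set.Ioo (r - ρ) r, 0 < q x := by
    by_contra! hcon
    have h1 : ∫ s in (r - ρ)..r, |q s| ≤ ε := by
      calc _ ≤ ∫ s in (r - ρ)..r, ε / ρ :=
            intervalIntegral.integral_mono_on_of_le_Ioo (by linarith)
              (hqc.abs.intervalIntegrable _ _) (by simp) fun x hx => by
                have e1 := hleft x ⟨hx.1.le, hx.2.le⟩
                rw [abs_of_nonpos (hcon x hx), le_div_iff₀ hρ]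
                linarith
        _ = ε := by
            rw [intervalIntegral.integral_const, smul_eq_mul]; field_simp; ring
    have h2 : ∀ x ∈ Set.Icc (r - ρ) (r + ρ), |q x| ≤ K * 2 ^ m * (ρ⁻¹ * ε) := by
      intro x hx
      have := hval q hq (r - ρ) r (by linarith) 2 (by norm_num) x
        (by rw [abs_le]; constructor <;> linarith [hx.1, hx.2])
      have e : r - (r - ρ) = ρ := by ring
      rw [e] at this
      refine this.trans ?_
      gcongr
    have h3 : (1 : ℝ) ≤ 1 / 2 := by
      calc (1 : ℝ) = ∫ s in (r - ρ)..(r + ρ), |q s| := hint.symm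
        _ ≤ ∫ s in (r - ρ)..(r + ρ), K * 2 ^ m * (ρ⁻¹ * ε) :=
            intervalIntegral.integral_mono_on (by linarith)
              (hqc.abs.intervalIntegrable _ _) (by simp) h2
        _ = 1 / 2 := by
            rw [intervalIntegral.integral_const, smul_eq_mul, hε]; field_simp; ring
    norm_num at h3
  obtain ⟨y₀, hy₀, hqy₀⟩ := hpos
  have hy₀Ω : y₀ ∈ Set.Ioo a b := hJ ⟨hy₀.1.le, by linarith [hy₀.2]⟩
  intro s x t h1 h2 h3 h4
  by_contra hc
  rw [not_le, lt_min_iff] at hc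
  obtain ⟨z, hz, hz'⟩ := exists_deriv_pos hp h3 (by linarith)
  have hbd : ∀ y ∈ Set.Ioc s x, -q y ≤ (Set.Icc (r - ρ) r).indicator (fun _ => ε / ρ) y := by
    intro y hy
    have hyΩ : y ∈ Set.Ioo a b := ⟨by linarith [hy.1], by linarith [hy.2]⟩
    by_cases hyJ : y ∈ Set.Icc (r - ρ) r
    · rw [Set.indicator_of_mem hyJ, le_div_iff₀ hρ]
      linarith [hleft y hyJ]
    · rw [Set.indicator_of_notMem hyJ]
      by_contra hneg
      have hneg : q y < 0 := by linarith
      have e1 := hstr y hyΩ z ⟨by linarith [hz.1], by linarith [hz.2]⟩ (by linarith [hy.2, hz.1])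
        hneg hz'
      have e2 : y < r - ρ := by
        by_contra e2
        exact hyJ ⟨not_lt.1 e2, e1.1⟩
      have e3 := hstr y hyΩ y₀ hy₀Ω (by linarith [hy₀.1]) hneg hqy₀
      linarith [hy₀.2, e3.2]
  have hfin : p s - p x ≤ ε := by
    have e1 : p x - p s = ∫ y in s..x, q y :=
      (intervalIntegral.integral_eq_sub_of_hasDerivAt (fun y _ => hp y)
        (hqc.intervalIntegrable _ _)).symm
    have e2 : p s - p x = ∫ y in Set.Ioc s x, -q y := by
      rw [integral_neg, ← intervalIntegral.integral_of_le h2.le, ← e1]; ring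
    rw [e2]
    have hi : Integrable ((Set.Icc (r - ρ) r).indicator fun _ : ℝ => ε / ρ) :=
      (integrable_indicator_iff measurableSet_Icc).2 (by simp)
    calc _ ≤ ∫ y in Set.Ioc s x, (Set.Icc (r - ρ) r).indicator (fun _ => ε / ρ) y :=
          setIntegral_mono_on (hqc.neg.integrableOn_Icc.mono_set Set.Ioc_subset_Icc_self)
            hi.integrableOn measurableSet_Ioc hbd
      _ ≤ ∫ y, (Set.Icc (r - ρ) r).indicator (fun _ => ε / ρ) y :=
          setIntegral_le_integral hi (Filter.Eventually.of_forall fun y =>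
            Set.indicator_nonneg (fun _ _ => by positivity) y)
      _ = ε := by
          rw [integral_indicator measurableSet_Icc, setIntegral_const, smul_eq_mul,
            Measure.real, Real.volume_Icc, ENNReal.toReal_ofReal (by linarith)]
          field_simp; ring
  linarith [hc.1]

theorem noDeepValley_of_left_or_right (m : ℕ) : ∃ ε : ℝ, 0 < ε ∧ ε ≤ 1 ∧ ∀ p q : ℝ → ℝ,
    (∀ x, HasDerivAt p (q x) x) → PolyLE m q → ∀ a b r ρ : ℝ, 0 < ρ →
    Set.Icc (r - ρ) (r + ρ) ⊆ Set.Ioo a b → ∫ s in (r - ρ)..(r + ρ), |q s| = 1 →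
    (∀ s ∈ Set.Ioo a b, ∀ t ∈ Set.Ioo a b, s < t → q s < 0 → 0 < q t → s ≤ r ∧ r ≤ t) →
    ((∀ x ∈ Set.Icc (r - ρ) r, -ε ≤ q x * ρ) ∨ ∀ x ∈ Set.Icc r (r + ρ), q x * ρ ≤ ε) →
    NoDeepValley p 1 a b := by
  obtain ⟨ε, hε, hε1, h⟩ := noDeepValley_of_left m
  refine ⟨ε, hε, hε1, fun p q hp hq a b r ρ hρ hJ hint hstr hor => ?_⟩
  rcases hor with hl | hr
  · exact h p q hp hq a b r ρ hρ hJ hint hstr hl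
  · have hq' : PolyLE m fun x => -q (-x) := by
      have h0 := (PolyLE.const m 0).sub (hq.comp_affine 0 (-1))
      simpa using h0
    have := (h (fun x => p (-x)) (fun x => -q (-x)) (fun x => by
      have := (hp (-x)).comp x (hasDerivAt_neg x)
      rwa [mul_neg_one] at this) hq' (-b) (-a) (-r) ρ hρ
      (fun x hx => by
        have := hJ (a := -x) ⟨by linarith [hx.2], by linarith [hx.1]⟩
        exact ⟨by linarith [this.2], by linarith [this.1]⟩)
      (by
        simp only [abs_neg]
        rw [intervalIntegral.integral_comp_neg (fun x => |q x|), ← hint]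
        congr 1 <;> ring)
      (fun s hs t ht hst h1 h2 => by
        have := hstr (-t) ⟨by linarith [ht.2], by linarith [ht.1]⟩ (-s)
          ⟨by linarith [hs.2], by linarith [hs.1]⟩ (by linarith) (by linarith) (by linarith)
        exact ⟨by linarith, by linarith⟩)
      (fun x hx => by
        have := hr (-x) ⟨by linarith [hx.2], by linarith [hx.1]⟩
        linarith)).comp_neg
    simpa using this

theorem IsPhase.exists_persistence (m : ℕ) {A ε : ℝ} (hA : 1 ≤ A) (hε : 0 < ε) (hε1 : ε ≤ 1) :
    ∃ τ : ℝ, 0 < τ ∧ τ ≤ 1 ∧ ∀ {Ψ q w : ℝ → ℝ → ℝ}, IsPhase m Ψ q w → ∀ r ρ : ℝ, 0 < ρ →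
      (∀ t ∈ Set.Icc 0 ρ, ∫ s in (r - ρ)..(r + ρ), |q s t| ≤ A) →
      ∀ x ∈ Set.Icc (r - ρ) (r + ρ), ∀ t ∈ Set.Icc 0 (τ * ρ), |q x t - q x 0| * ρ ≤ ε / 2 := by
  obtain ⟨K, hK, hpoly⟩ := PolyLE.exists_integral_bound m
  obtain ⟨K₂, hK₂, hder⟩ := PolyLE.exists_deriv_bound m
  have hKK : 1 ≤ K₂ * K := by nlinarith
  have hKKA : 1 ≤ K₂ * K * A := by nlinarith
  refine ⟨ε / (K₂ * K * A), by positivity, by rw [div_le_one (by positivity)]; linarith, ?_⟩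
  intro Ψ q w hΨ r ρ hρ hN x hx t ht
  have hτ : ε / (K₂ * K * A) ≤ 1 := by rw [div_le_one (by positivity)]; linarith
  have hb : ∀ s ∈ Set.Icc 0 ρ, |q x s - 0| ≤ K * A / (2 * ρ) := by
    intro s hs
    rw [sub_zero, le_div_iff₀ (by positivity)]
    refine ((hpoly _ (hΨ.poly_q_fst s) r ρ hρ).1 x hx).trans ?_
    have := hN s hs
    gcongr
  have hd := hder (fun t => q x t) (hΨ.poly_q x) 0 ρ hρ _ 0 hb
  have htρ : t ≤ ρ := ht.2.trans (by nlinarith)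
  have h1 := (convex_Icc (0 : ℝ) ρ).norm_image_sub_le_of_norm_hasDerivWithin_le
    (f := fun t => q x t) (C := K₂ * (K * A / (2 * ρ)) / ρ)
    (fun s _ => ((hΨ.poly_q x).differentiable s).hasDerivAt.hasDerivWithinAt)
    (fun s hs => by
      rw [Real.norm_eq_abs, le_div_iff₀ hρ]
      simpa using hd s hs) (Set.left_mem_Icc.2 hρ.le) (⟨ht.1, htρ⟩ : t ∈ Set.Icc 0 ρ)
  rw [Real.norm_eq_abs, Real.norm_eq_abs, sub_zero, abs_of_nonneg ht.1] at h1
  calc |q x t - q x 0| * ρ ≤ (K₂ * (K * A / (2 * ρ)) / ρ * (ε / (K₂ * K * A) * ρ)) * ρ := by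
        refine mul_le_mul_of_nonneg_right (h1.trans ?_) hρ.le
        exact mul_le_mul_of_nonneg_left ht.2 (by positivity)
    _ = ε / 2 := by field_simp

/-- The function `f` takes a negative value and, further right, a positive one. -/
def HasPair (f : ℝ → ℝ) (I : Set ℝ) : Prop :=
  ∃ a ∈ I, ∃ b ∈ I, a < b ∧ f a < 0 ∧ 0 < f b

/-- Every passage of `f` from a negative to a positive value surrounds `r`. -/
def Straddle (f : ℝ → ℝ) (I : Set ℝ) (r : ℝ) : Prop :=
  ∀ a ∈ I, ∀ b ∈ I, a < b → f a < 0 → 0 < f b → a ≤ r ∧ r ≤ b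

theorem Straddle.noSignChange_left {f : ℝ → ℝ} {a b r : ℝ} (h : Straddle f (Set.Ioo a b) r)
    (hr : r < b) : NoSignChange f (Set.Ioo a r) := by
  intro s hs t ht hst h1
  by_contra! h2
  have := h s ⟨hs.1, hs.2.trans hr⟩ t ⟨ht.1, ht.2.trans hr⟩ hst h1 h2
  linarith [ht.2, this.2]

theorem Straddle.noSignChange_right {f : ℝ → ℝ} {a b r : ℝ} (h : Straddle f (Set.Ioo a b) r)
    (hr : a < r) : NoSignChange f (Set.Ioo r b) := by
  intro s hs t ht hst h1
  by_contra! h2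
  have := h s ⟨hr.trans hs.1, hs.2⟩ t ⟨hr.trans ht.1, ht.2⟩ hst h1 h2
  linarith [hs.1, this.1]

theorem exists_first_time {N : ℝ → ℝ} (hN : Continuous N) {t₁ A : ℝ} (h0 : N 0 < A)
    (h : ∃ t ∈ Set.Icc 0 t₁, A < N t) :
    ∃ t, 0 < t ∧ t ≤ t₁ ∧ N t = A ∧ ∀ s ∈ Set.Icc 0 t, N s ≤ A := by
  obtain ⟨t', ht', hAt'⟩ := h
  obtain ⟨t, ⟨ht, hAt⟩, hleast⟩ := (isCompact_Icc.inter_right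
    (isClosed_le continuous_const hN) : IsCompact (Set.Icc 0 t₁ ∩ {t | A ≤ N t})).exists_isLeast
      ⟨t', ht', hAt'.le⟩
  have hpos : 0 < t := lt_of_le_of_ne ht.1 (by rintro rfl; exact absurd h0 (not_lt.2 hAt))
  have hlt : ∀ s ∈ Set.Icc 0 t, s ≠ t → N s < A := by
    intro s hs hst
    by_contra! hc
    exact hst (le_antisymm hs.2 (hleast ⟨⟨hs.1, hs.2.trans ht.2⟩, hc⟩))
  have heq : N t = A := by
    obtain ⟨s, hs, hsA⟩ := intermediate_value_Icc ht.1 hN.continuousOn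
      (show A ∈ Set.Icc (N 0) (N t) from ⟨h0.le, hAt⟩)
    by_cases hst : s = t
    · rwa [← hst]
    · exact absurd hsA (hlt s hs hst).ne
  refine ⟨t, hpos, ht.2, heq, fun s hs => ?_⟩
  by_cases hst : s = t
  · rw [hst, heq]
  · exact (hlt s hs hst).le

theorem IsPhase.sliceNorm_le_of_noDeepValley (m : ℕ) : ∃ D : ℝ≥0∞, D ≠ ⊤ ∧
    ∀ {Ψ q w : ℝ → ℝ → ℝ} {V Vx Vt : ℝ → ℝ → ℂ}, IsPhase m Ψ q w → IsAmplitude V Vx Vt →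
      ∀ t a b : ℝ, NoDeepValley (fun x => Ψ x t) 1 a b → (∀ x ∉ Set.Ioo a b, V x t = 0) →
      sliceNorm Set.univ (fun x t => q x t * V x t) t ≤
        D * sliceNorm Set.univ (fun x t => Vx x t + q x t * V x t) t := by
  obtain ⟨C, hC, h⟩ := NoDeepValley.lintegral_le m
  refine ⟨1 + C, by simp [hC], fun {Ψ q w V Vx Vt} hΨ hV t a b hval hsupp => ?_⟩
  apply ENNReal.le_of_sq_le_sq
  have h1 := h _ (hΨ.poly_fst t) a b hval (fun x => V x t) (fun x => Vx x t)
    (fun s => hV.hasDerivAt_fst s t) (hV.cont_vx_fst t) hsupp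
  rw [hΨ.deriv_fst] at h1
  rw [mul_pow, sliceNorm_sq, sliceNorm_sq, setLIntegral_univ, setLIntegral_univ]
  have e : ∀ x, ‖(q x t : ℂ) * V x t‖ₑ = ‖q x t‖ₑ * ‖V x t‖ₑ := fun x => by
    rw [enorm_mul, ← ofReal_norm (q x t : ℂ), ← ofReal_norm (q x t), Complex.norm_real]
  simp only [e]
  refine h1.trans (mul_le_mul' ?_ le_rfl)
  calc C ≤ 1 + C := le_add_self
    _ = 1 * (1 + C) := (one_mul _).symm
    _ ≤ (1 + C) * (1 + C) := mul_le_mul' le_self_add le_rfl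
    _ = _ := (sq _).symm

theorem IsPhase.sliceNorm_le_of_valley (m : ℕ) : ∃ D : ℝ≥0∞, D ≠ ⊤ ∧
    ∀ {Ψ q w : ℝ → ℝ → ℝ} {V Vx Vt : ℝ → ℝ → ℂ}, IsPhase m Ψ q w → IsAmplitude V Vx Vt →
      ∀ t a r b ρ : ℝ, NoDeepValley (fun x => Ψ x t) 1 a r → NoDeepValley (fun x => Ψ x t) 1 r b →
      0 < ρ → ∫ s in (r - ρ)..(r + ρ), |q s t| ≤ 1 → (∀ x ∉ Set.Ioo a b, V x t = 0) →
      ∀ Q : ℝ≥0∞, (∀ x ∈ Set.Icc (r - ρ) (r + ρ), ‖V x t‖ₑ ≤ ENNReal.ofReal ρ ^ (1 / 2 : ℝ) * Q) →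
      sliceNorm Set.univ (fun x t => q x t * V x t) t ≤
        D * (sliceNorm Set.univ (fun x t => Vx x t + q x t * V x t) t + Q) := by
  obtain ⟨C, hC, h⟩ := lintegral_valley_le m
  refine ⟨2 * (1 + C), by simp [hC, ENNReal.mul_eq_top],
    fun {Ψ q w V Vx Vt} hΨ hV t a r b ρ hl hr hρ hint hsupp Q hQ => ?_⟩
  apply ENNReal.le_of_sq_le_sq
  have h1 := h _ (hΨ.poly_fst t) a r b ρ hl hr hρ (by rw [hΨ.deriv_fst]; exact hint)
    (fun x => V x t) (fun x => Vx x t) (fun s => hV.hasDerivAt_fst s t) (hV.cont_vx_fst t) hsupp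
  rw [hΨ.deriv_fst] at h1
  have e : ∀ x, ‖(q x t : ℂ) * V x t‖ₑ = ‖q x t‖ₑ * ‖V x t‖ₑ := fun x => by
    rw [enorm_mul, ← ofReal_norm (q x t : ℂ), ← ofReal_norm (q x t), Complex.norm_real]
  have h2 : ENNReal.ofReal ρ⁻¹ ^ 2 * ∫⁻ x in Set.Icc (r - ρ) (r + ρ), ‖V x t‖ₑ ^ 2 ≤ 2 * Q ^ 2 := by
    calc _ ≤ ENNReal.ofReal ρ⁻¹ ^ 2 * ∫⁻ x in Set.Icc (r - ρ) (r + ρ),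
          (ENNReal.ofReal ρ * Q ^ 2) := by
          refine mul_le_mul' le_rfl (setLIntegral_mono' measurableSet_Icc fun x hx => ?_)
          rw [← ENNReal.sqrt_sq (ENNReal.ofReal ρ), ← mul_pow]
          exact pow_le_pow_left' (hQ x hx) 2
      _ = (ENNReal.ofReal ρ⁻¹ * ENNReal.ofReal ρ) ^ 2 * (2 * Q ^ 2) := by
          rw [setLIntegral_const, Real.volume_Icc]
          have : r + ρ - (r - ρ) = 2 * ρ := by ring
          rw [this, ENNReal.ofReal_mul (by norm_num), ENNReal.ofReal_ofNat]
          ring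
      _ = _ := by
          rw [← ENNReal.ofReal_mul (by positivity), inv_mul_cancel₀ hρ.ne', ENNReal.ofReal_one,
            one_pow, one_mul]
  rw [mul_pow, sliceNorm_sq, setLIntegral_univ]
  simp only [e]
  set N₁ := sliceNorm Set.univ (fun x t => Vx x t + q x t * V x t) t with hN₁
  have h3 : ∫⁻ x, ‖Vx x t + q x t * V x t‖ₑ ^ 2 = N₁ ^ 2 := by
    rw [hN₁, sliceNorm_sq, setLIntegral_univ]
  rw [h3] at h1
  calc _ ≤ C * (N₁ ^ 2 + 2 * Q ^ 2) := h1.trans (mul_le_mul' le_rfl (add_le_add le_rfl h2))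
    _ ≤ ((1 + C) * (1 + C)) * (4 * (N₁ + Q) ^ 2) := by
        refine mul_le_mul' ?_ ?_
        · calc C ≤ 1 + C := le_add_self
            _ = 1 * (1 + C) := (one_mul _).symm
            _ ≤ (1 + C) * (1 + C) := mul_le_mul' le_self_add le_rfl
        · have : 4 * (N₁ + Q) ^ 2 = (N₁ ^ 2 + 2 * Q ^ 2) + (3 * N₁ ^ 2 + 8 * N₁ * Q + 2 * Q ^ 2) := by
            ring
          rw [this]
          exact le_self_add
    _ = _ := by ring

/-- The geometric situation at one height: the curve `R` of sign changes starts at `r`, moves with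
speed at least `α`, and the phase decreases along the vertical line through `r` up to time `T`. -/
structure IsValley (m : ℕ) (α : ℝ) (Ψ q : ℝ → ℝ → ℝ) (V : ℝ → ℝ → ℂ) (X : Set ℝ) (R : ℝ → ℝ)
    (T : ℝ) : Prop where
  pos : 0 < T
  hasPair : HasPair (fun x => q x 0) (Set.Ioo (-1) 1)
  eq_zero : ∀ t, ∀ x ∉ Set.Ioo (-1 : ℝ) 1, V x t = 0
  eq_zero_end : ∀ x, V x T = 0
  mem : R 0 ∈ Set.Ioo (-1 : ℝ) 1
  le : ∀ t ∈ Set.Icc 0 T, Ψ (R 0) t ≤ Ψ (R 0) 0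
  straddle : ∀ t ∈ Set.Ico 0 T, HasPair (fun x => q x t) (Set.Ioo (-1) 1) →
    Straddle (fun x => q x t) (Set.Ioo (-1) 1) (R t)
  mem_X : ∀ t ∈ Set.Ico 0 T, HasPair (fun x => q x t) (Set.Ioo (-1) 1) → R t ∈ X
  root : ∀ t ∈ Set.Ico 0 T, HasPair (fun x => q x t) (Set.Ioo (-1) 1) → q (R t) t = 0
  continuousAt : ∀ t ∈ Set.Ico 0 T, HasPair (fun x => q x t) (Set.Ioo (-1) 1) → ContinuousAt R t
  slope : ∃ E : Set ℝ, E.Finite ∧ ∀ t ∈ Set.Ioo 0 T, HasPair (fun x => q x t) (Set.Ioo (-1) 1) →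
    t ∉ E → ∃ e, HasDerivAt R e t ∧ α ≤ |e|

/-- When the curve of sign changes stays in the interval for a definite time, it sweeps out a
definite portion of it. -/
theorem IsValley.exists_interval {m : ℕ} {α : ℝ} {Ψ q w : ℝ → ℝ → ℝ} {V : ℝ → ℝ → ℂ} {X : Set ℝ}
    {R : ℝ → ℝ} {T : ℝ} (hΨ : IsPhase m Ψ q w) (hv : IsValley m α Ψ q V X R T) (hα : 0 < α)
    {a b t₁ : ℝ} (ht₁ : 0 < t₁) (ht₁T : t₁ < T) (hab : a < b) (ha : a ∈ Set.Ioo (-1 : ℝ) 1)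
    (hb : b ∈ Set.Ioo (-1 : ℝ) 1) (hqa : ∀ t ∈ Set.Icc 0 t₁, q a t < 0)
    (hqb : ∀ t ∈ Set.Icc 0 t₁, 0 < q b t) :
    ∃ c d, α * t₁ ≤ m * (d - c) ∧ c ≤ d ∧ Set.Icc c d ⊆ Set.Icc a b ∧
      ∀ z ∈ Set.Icc c d, z ∈ X ∧ ∃ t ∈ Set.Icc 0 t₁, q z t = 0 := by
  have hpair : ∀ t ∈ Set.Icc 0 t₁, HasPair (fun x => q x t) (Set.Ioo (-1) 1) := fun t ht =>
    ⟨a, ha, b, hb, hab, hqa t ht, hqb t ht⟩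
  have hT : ∀ t ∈ Set.Icc 0 t₁, t ∈ Set.Ico 0 T := fun t ht => ⟨ht.1, ht.2.trans_lt ht₁T⟩
  have hRab : ∀ t ∈ Set.Icc 0 t₁, R t ∈ Set.Icc a b := fun t ht =>
    hv.straddle t (hT t ht) (hpair t ht) a ha b hb hab (hqa t ht) (hqb t ht)
  have hcont : ContinuousOn R (Set.Icc 0 t₁) := fun t ht =>
    (hv.continuousAt t (hT t ht) (hpair t ht)).continuousWithinAt
  obtain ⟨E, hE, hslope⟩ := hv.slope
  have hq0 : ∃ x, q x 0 ≠ 0 := ⟨a, (hqa 0 ⟨le_rfl, ht₁.le⟩).ne⟩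
  have himg := (isCompact_Icc (a := (0 : ℝ)) (b := t₁)).image_of_continuousOn hcont
  have hconn := (isPreconnected_Icc (a := (0 : ℝ)) (b := t₁)).image R hcont
  have hne : (R '' Set.Icc 0 t₁).Nonempty := ⟨R 0, 0, ⟨le_rfl, ht₁.le⟩, rfl⟩
  obtain ⟨c, hc, hcl⟩ := himg.exists_isLeast hne
  obtain ⟨d, hd, hdl⟩ := himg.exists_isGreatest hne
  have hsub : Set.Icc c d ⊆ R '' Set.Icc 0 t₁ := hconn.ordConnected.out hc hd
  refine ⟨c, d, ?_, hcl hd, ?_, ?_⟩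
  · have := length_le_of_slope (m := m) (Z := {x | q x 0 = 0}) ht₁ (hcl hd) hα.le hcont hE
      ((hΨ.poly_q_fst 0).finite_zeros hq0) (fun t ht => ⟨hcl ⟨t, ht, rfl⟩, hdl ⟨t, ht, rfl⟩⟩)
      (fun t ht htE => hslope t ⟨ht.1, ht.2.trans ht₁T⟩ (hpair t ⟨ht.1.le, ht.2.le⟩) htE)
      (fun x hx s hs => (hΨ.poly_q x).card_zeros_le ⟨0, hx⟩ s fun t ht => by
        have := hs t ht
        rw [← this.2]
        exact hv.root t (hT t this.1) (hpair t this.1))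
    simpa using this
  · intro z hz
    obtain ⟨t, ht, rfl⟩ := hsub hz
    exact hRab t ht
  · intro z hz
    obtain ⟨t, ht, rfl⟩ := hsub hz
    exact ⟨hv.mem_X t (hT t ht) (hpair t ht), t, ht, hv.root t (hT t ht) (hpair t ht)⟩

/-- Estimate of `(∂ₓΨ)V` at time zero by time means, in the presence of a moving valley. -/
theorem IsValley.sliceNorm_le (m : ℕ) {α : ℝ} (hα : 0 < α) : ∃ C₀ : ℝ≥0∞, C₀ ≠ ⊤ ∧
    ∀ ε : ℝ, 0 < ε → ε ≤ 1 → ∃ C : ℝ≥0∞, C ≠ ⊤ ∧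
    ∀ {Ψ q w : ℝ → ℝ → ℝ} {V Vx Vt : ℝ → ℝ → ℂ} {X : Set ℝ} {R : ℝ → ℝ} {T : ℝ},
      IsPhase m Ψ q w → IsAmplitude V Vx Vt → IsValley m α Ψ q V X R T → ∀ B B' : ℝ≥0∞,
      (∀ t₁, 0 < t₁ → t₁ ≤ 2 →
        timeMean t₁ (sliceNorm Set.univ fun x t => Vt x t + w x t * V x t) ≤ B) →
      (∀ t₁, 0 < t₁ → t₁ ≤ 2 → timeMean t₁ (sliceNorm X fun x t => w x t * V x t) ≤ B) →
      (∀ t₁, 0 < t₁ → t₁ ≤ 2 → timeMean t₁ (sliceNorm X Vt) ≤ B) →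
      (∀ t₁, 0 < t₁ → t₁ ≤ 2 → (timeMean t₁ fun t =>
        sliceNorm Set.univ (fun x t => q x t * V x t) t +
          sliceNorm Set.univ (fun x t => Vx x t + q x t * V x t) t) ≤ B') →
      sliceNorm Set.univ (fun x t => q x t * V x t) 0 ≤
        C * (sliceNorm Set.univ (fun x t => Vx x t + q x t * V x t) 0 + B) +
          C₀ * ENNReal.ofReal (2 * ε) ^ (1 / 2 : ℝ) * B' := by
  obtain ⟨D, hD, hvalley⟩ := IsPhase.sliceNorm_le_of_valley m
  obtain ⟨D', hD', hnovalley⟩ := IsPhase.sliceNorm_le_of_noDeepValley m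
  obtain ⟨C₀, hC₀, hgrowth⟩ := IsPhase.enorm_le_of_growth m
  obtain ⟨ε₁, hε₁, hε₁1, hshallow⟩ := noDeepValley_of_left_or_right m
  refine ⟨D * C₀, ENNReal.mul_ne_top hD hC₀, fun ε hε hε1 => ?_⟩
  obtain ⟨A, hA, C₁, hC₁, hgrowth⟩ := hgrowth ε hε hε1
  obtain ⟨C₂, hC₂, hexit⟩ := IsPhase.enorm_le_of_exit A
  obtain ⟨τ, hτ, hτ1, hpers⟩ := IsPhase.exists_persistence m hA.le hε₁ hε₁1
  set κ := min (α * τ / (m + 1)) 2 with hκ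
  have hκ0 : 0 < κ := lt_min (by positivity) (by norm_num)
  obtain ⟨C₃, hC₃, hzeros⟩ := IsPhase.enorm_le_of_vertical_zeros m hκ0 (min_le_right _ _)
  set E := ENNReal.ofReal (Real.exp 1) * 2
  have hEt : E ≠ ⊤ := ENNReal.mul_ne_top ENNReal.ofReal_ne_top (by norm_num)
  set C₄ := E + C₁ + C₂ + 2 * C₃
  refine ⟨D * (1 + C₄) + D', by simp [C₄, hD, hD', hC₁, hC₂, hC₃, hEt, ENNReal.mul_eq_top], ?_⟩
  intro Ψ q w V Vx Vt X R T hΨ hV hv B B' hB₁ hB₂ hB₃ hB'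
  set r := R 0 with hr
  set N₁ := sliceNorm Set.univ (fun x t => Vx x t + q x t * V x t) 0
  set P₂ := ENNReal.ofReal (2 * ε) ^ (1 / 2 : ℝ)
  have hstr := hv.straddle 0 ⟨le_rfl, hv.pos⟩ hv.hasPair
  have hr1 := hv.mem
  have hl1 : NoDeepValley (fun x => Ψ x 0) 1 (-1) r :=
    ((hstr.noSignChange_left hr1.2).noDeepValley fun x => hΨ.hasDerivAt_fst x 0).mono zero_le_one
  have hl2 : NoDeepValley (fun x => Ψ x 0) 1 r 1 :=
    ((hstr.noSignChange_right hr1.1).noDeepValley fun x => hΨ.hasDerivAt_fst x 0).mono zero_le_one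
  have hfin : ∀ ρ, 0 < ρ → ∫ s in (r - ρ)..(r + ρ), |q s 0| ≤ 1 →
      (∀ x ∈ Set.Icc (r - ρ) (r + ρ), ‖V x 0‖ₑ ≤ ENNReal.ofReal ρ ^ (1 / 2 : ℝ) *
        (C₄ * (N₁ + B) + C₀ * P₂ * B')) →
      sliceNorm Set.univ (fun x t => q x t * V x t) 0 ≤
        (D * (1 + C₄) + D') * (N₁ + B) + D * C₀ * P₂ * B' := by
    intro ρ hρ hint hQ
    refine (hvalley hΨ hV 0 (-1) r 1 ρ hl1 hl2 hρ hint (hv.eq_zero 0) _ hQ).trans ?_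
    calc _ = D * (N₁ + C₄ * (N₁ + B)) + D * C₀ * P₂ * B' := by ring
      _ ≤ D * ((N₁ + B) + C₄ * (N₁ + B)) + D * C₀ * P₂ * B' :=
          add_le_add (mul_le_mul' le_rfl (add_le_add le_self_add le_rfl)) le_rfl
      _ = D * (1 + C₄) * (N₁ + B) + D * C₀ * P₂ * B' := by ring
      _ ≤ _ := add_le_add (mul_le_mul' le_self_add le_rfl) le_rfl
  have hC₄E : E ≤ C₄ := by
    simp only [C₄, add_assoc]; exact le_self_add
  have hC₄1 : C₁ ≤ C₄ := by
    simp only [C₄]; exact le_add_self.trans (le_self_add.trans le_self_add)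
  have hC₄2 : C₂ ≤ C₄ := by
    simp only [C₄]; exact le_add_self.trans le_self_add
  have hC₄3 : 2 * C₃ ≤ C₄ := le_add_self
  have houtside : ∀ ρ z, 0 < ρ → ∫ s in (r - ρ)..(r + ρ), |q s 0| ≤ 1 →
      z ∈ Set.Icc (r - ρ) (r + ρ) → z ∉ Set.Ioo (-1 : ℝ) 1 →
      sliceNorm Set.univ (fun x t => q x t * V x t) 0 ≤
        (D * (1 + C₄) + D') * (N₁ + B) + D * C₀ * P₂ * B' := by
    intro ρ z hρ hint hz hzΩ
    refine hfin ρ hρ hint fun x hx => ?_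
    refine (hΨ.enorm_le_of_eq_zero hV hint hz (hv.eq_zero 0 z hzΩ) hx).trans ?_
    exact mul_le_mul' le_rfl ((mul_le_mul' hC₄E le_self_add).trans le_self_add)
  by_cases hbig : 1 ≤ ∫ s in (r - 2)..(r + 2), |q s 0|
  swap
  · exact houtside 2 (r + 2) two_pos (not_le.1 hbig).le ⟨by linarith, le_rfl⟩
      fun h => by linarith [h.2, hr1.1]
  obtain ⟨ρ, hρ, hρ2, hint⟩ := exists_unit_variation (hΨ.cont_q_fst 0) zero_le_two hbig
  by_cases hJr : r + ρ < 1
  swap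
  · exact houtside ρ (r + ρ) hρ hint.le ⟨by linarith, le_rfl⟩ fun h => hJr h.2
  by_cases hJl : -1 < r - ρ
  swap
  · exact houtside ρ (r - ρ) hρ hint.le ⟨le_rfl, by linarith⟩ fun h => hJl h.1
  have hJ : Set.Icc (r - ρ) (r + ρ) ⊆ Set.Ioo (-1 : ℝ) 1 := fun x hx =>
    ⟨hJl.trans_le hx.1, hx.2.trans_lt hJr⟩
  have hN := hΨ.continuous_variation (r - ρ) (r + ρ)
  by_cases hgr : ∃ t ∈ Set.Icc 0 (min ρ T), A < ∫ s in (r - ρ)..(r + ρ), |q s t|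
  · obtain ⟨t, ht0, htmin, htA, htle⟩ := exists_first_time hN (by simpa [hint] using hA) hgr
    have htρ : t ≤ ρ := htmin.trans (min_le_left _ _)
    have htT : t ≤ T := htmin.trans (min_le_right _ _)
    refine hfin ρ hρ hint.le fun x hx => ?_
    refine (hgrowth hΨ hV r ρ t ht0 htρ hint.le htle htA
      (fun s hs => hv.le s ⟨hs.1, hs.2.trans htT⟩) x hx).trans ?_
    exact mul_le_mul' le_rfl (add_le_add (mul_le_mul' hC₄1 (add_le_add le_rfl
      (hB₁ t ht0 (htρ.trans hρ2)))) (mul_le_mul' le_rfl (hB' t ht0 (htρ.trans hρ2))))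
  push Not at hgr
  by_cases hTρ : T ≤ ρ
  · rw [min_eq_right hTρ] at hgr
    refine hfin ρ hρ hint.le fun x hx => ?_
    refine (hexit hΨ hV r ρ T hv.pos hTρ hint.le hgr hv.le (fun x _ => hv.eq_zero_end x) x hx).trans
      ?_
    exact mul_le_mul' le_rfl ((mul_le_mul' hC₄2 (add_le_add le_rfl
      (hB₁ T hv.pos (hTρ.trans hρ2)))).trans le_self_add)
  rw [not_le] at hTρ
  rw [min_eq_left hTρ.le] at hgr
  by_cases hsh : (∀ x ∈ Set.Icc (r - ρ) r, -ε₁ ≤ q x 0 * ρ) ∨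
      ∀ x ∈ Set.Icc r (r + ρ), q x 0 * ρ ≤ ε₁
  · have hno := hshallow (fun x => Ψ x 0) (fun x => q x 0) (fun x => hΨ.hasDerivAt_fst x 0)
      (hΨ.poly_q_fst 0) (-1) 1 r ρ hρ hJ hint hstr hsh
    refine (hnovalley hΨ hV 0 (-1) 1 hno (hv.eq_zero 0)).trans ?_
    exact (mul_le_mul' le_add_self le_self_add).trans le_self_add
  push Not at hsh
  obtain ⟨⟨a, ha, hqa⟩, b, hb, hqb⟩ := hsh
  have haJ : a ∈ Set.Icc (r - ρ) (r + ρ) := ⟨ha.1, ha.2.trans (by linarith)⟩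
  have hbJ : b ∈ Set.Icc (r - ρ) (r + ρ) := ⟨by linarith [hb.1], hb.2⟩
  have hτρ : τ * ρ ≤ ρ := by nlinarith
  have hqa' : ∀ t ∈ Set.Icc 0 (τ * ρ), q a t < 0 := by
    intro t ht
    have h1 := hpers hΨ r ρ hρ hgr a haJ t ht
    have h2 := mul_le_mul_of_nonneg_right (le_abs_self (q a t - q a 0)) hρ.le
    by_contra! h3
    have := mul_nonneg h3 hρ.le
    nlinarith
  have hqb' : ∀ t ∈ Set.Icc 0 (τ * ρ), 0 < q b t := by
    intro t ht
    have h1 := hpers hΨ r ρ hρ hgr b hbJ t ht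
    have h2 := mul_le_mul_of_nonneg_right (neg_abs_le (q b t - q b 0)) hρ.le
    by_contra! h3
    have := mul_nonpos_of_nonpos_of_nonneg h3 hρ.le
    nlinarith
  have hab : a < b := by
    refine lt_of_le_of_ne (ha.2.trans hb.1) ?_
    rintro rfl
    have h0 : (0 : ℝ) ∈ Set.Icc 0 (τ * ρ) := ⟨le_rfl, by positivity⟩
    linarith [hqa' 0 h0, hqb' 0 h0]
  obtain ⟨c, d, hlen, hcd, hsub, hz⟩ := hv.exists_interval hΨ hα (by positivity : 0 < τ * ρ)
    (hτρ.trans_lt hTρ) hab (hJ haJ) (hJ hbJ) hqa' hqb'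
  have hκρ : κ * ρ ≤ d - c := by
    have h1 : κ * ρ ≤ α * τ / (m + 1) * ρ := by gcongr; exact min_le_left _ _
    refine h1.trans ?_
    rw [div_mul_eq_mul_div, div_le_iff₀ (by positivity)]
    nlinarith
  refine hfin ρ hρ hint.le fun x hx => ?_
  refine (hzeros hΨ hV X r ρ c d hρ hκρ
    (hsub.trans (Set.Icc_subset_Icc haJ.1 hbJ.2)) (fun z hzz => (hz z hzz).1) hint
    (fun z hzz => by
      obtain ⟨t, ht, he⟩ := (hz z hzz).2
      exact ⟨t, ⟨ht.1, ht.2.trans hτρ⟩, he⟩) x hx).trans ?_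
  refine mul_le_mul' le_rfl (le_trans ?_ le_self_add)
  calc _ ≤ C₃ * (N₁ + B + B) := mul_le_mul' le_rfl (add_le_add (add_le_add le_rfl
        (hB₂ ρ hρ hρ2)) (hB₃ ρ hρ hρ2))
    _ ≤ C₃ * (N₁ + B + (N₁ + B)) := mul_le_mul' le_rfl (add_le_add le_rfl le_add_self)
    _ = 2 * C₃ * (N₁ + B) := by ring
    _ ≤ _ := mul_le_mul' hC₄3 le_rfl

theorem MvPolynomial.totalDegree_pderiv_le {σ : Type*} (i : σ) (p : MvPolynomial σ ℝ) :
    (MvPolynomial.pderiv i p).totalDegree ≤ p.totalDegree := by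
  conv_lhs => rw [p.as_sum, map_sum]
  refine (MvPolynomial.totalDegree_finsetSum _ _).trans (Finset.sup_le fun s hs => ?_)
  rw [MvPolynomial.pderiv_monomial]
  refine (MvPolynomial.totalDegree_monomial_le _ _).trans (le_trans ?_
    (MvPolynomial.le_totalDegree hs))
  exact Finsupp.degree_mono tsub_le_self

theorem MvPolynomial.hasDerivAt_eval_fst (p : MvPolynomial (Fin 2) ℝ) (x y : ℝ) :
    HasDerivAt (fun x => MvPolynomial.eval ![x, y] p)
      (MvPolynomial.eval ![x, y] (MvPolynomial.pderiv 0 p)) x := by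
  induction p using MvPolynomial.induction_on with
  | C a => simpa using hasDerivAt_const x a
  | add p q hp hq => simpa using hp.fun_add hq
  | mul_X p n hp =>
    fin_cases n
    · simpa [MvPolynomial.pderiv_X, mul_comm, add_comm] using hp.fun_mul (hasDerivAt_id' x)
    · simpa [MvPolynomial.pderiv_X, mul_comm, add_comm] using hp.fun_mul (hasDerivAt_const x y)

theorem MvPolynomial.hasDerivAt_eval_snd (p : MvPolynomial (Fin 2) ℝ) (x y : ℝ) :
    HasDerivAt (fun y => MvPolynomial.eval ![x, y] p)
      (MvPolynomial.eval ![x, y] (MvPolynomial.pderiv 1 p)) y := by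
  induction p using MvPolynomial.induction_on with
  | C a => simpa using hasDerivAt_const y a
  | add p q hp hq => simpa using hp.fun_add hq
  | mul_X p n hp =>
    fin_cases n
    · simpa [MvPolynomial.pderiv_X, mul_comm, add_comm] using hp.fun_mul (hasDerivAt_const y x)
    · simpa [MvPolynomial.pderiv_X, mul_comm, add_comm] using hp.fun_mul (hasDerivAt_id' y)

theorem MvPolynomial.continuous_eval_pair (p : MvPolynomial (Fin 2) ℝ) :
    Continuous fun z : ℝ × ℝ => MvPolynomial.eval ![z.1, z.2] p := by
  refine p.continuous_eval.comp (continuous_pi fun i => ?_)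
  fin_cases i
  · exact continuous_fst
  · exact continuous_snd

theorem MvPolynomial.polyLE_eval_fst {m : ℕ} {p : MvPolynomial (Fin 2) ℝ} (hp : p.totalDegree ≤ m)
    (y : ℝ) : PolyLE m fun x => MvPolynomial.eval ![x, y] p := by
  refine ⟨MvPolynomial.aeval ![Polynomial.X, Polynomial.C y] p, ?_, fun x => ?_⟩
  · refine (MvPolynomial.aeval_natDegree_le p hp _ (n := 1) fun i => ?_).trans (by simp)
    fin_cases i <;> simp
  · rw [← Polynomial.coe_evalRingHom, MvPolynomial.aeval_def, MvPolynomial.hom_eval₂]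
    have e1 : (Polynomial.evalRingHom x).comp (algebraMap ℝ (Polynomial ℝ)) = RingHom.id ℝ := by
      ext; simp
    rw [e1]
    change MvPolynomial.eval₂ _ _ _ = _
    congr 1
    ext i
    fin_cases i <;> simp

theorem MvPolynomial.polyLE_eval_snd {m : ℕ} {p : MvPolynomial (Fin 2) ℝ} (hp : p.totalDegree ≤ m)
    (x : ℝ) : PolyLE m fun y => MvPolynomial.eval ![x, y] p := by
  refine ⟨MvPolynomial.aeval ![Polynomial.C x, Polynomial.X] p, ?_, fun y => ?_⟩
  · refine (MvPolynomial.aeval_natDegree_le p hp _ (n := 1) fun i => ?_).trans (by simp)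
    fin_cases i <;> simp
  · rw [← Polynomial.coe_evalRingHom, MvPolynomial.aeval_def, MvPolynomial.hom_eval₂]
    have e1 : (Polynomial.evalRingHom y).comp (algebraMap ℝ (Polynomial ℝ)) = RingHom.id ℝ := by
      ext; simp
    rw [e1]
    change MvPolynomial.eval₂ _ _ _ = _
    congr 1
    ext i
    fin_cases i <;> simp

theorem MvPolynomial.isPhase {m : ℕ} {p : MvPolynomial (Fin 2) ℝ} (hp : p.totalDegree ≤ m) :
    IsPhase m (fun x y => MvPolynomial.eval ![x, y] p) (polyDx p) (polyDy p) where
  hasDerivAt_fst x y := p.hasDerivAt_eval_fst x y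
  hasDerivAt_snd x y := p.hasDerivAt_eval_snd x y
  poly_fst := MvPolynomial.polyLE_eval_fst hp
  poly_snd := MvPolynomial.polyLE_eval_snd hp
  poly_q := MvPolynomial.polyLE_eval_snd ((MvPolynomial.totalDegree_pderiv_le 0 p).trans hp)
  poly_w := MvPolynomial.polyLE_eval_fst ((MvPolynomial.totalDegree_pderiv_le 1 p).trans hp)
  cont_q := MvPolynomial.continuous_eval_pair _
  cont_w := MvPolynomial.continuous_eval_pair _

theorem MvPolynomial.exists_evalEval_eq (p : MvPolynomial (Fin 2) ℝ) :
    ∃ Q : Polynomial (Polynomial ℝ), ∀ x y, Q.evalEval y x = MvPolynomial.eval ![x, y] p := by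
  refine ⟨MvPolynomial.aeval ![Polynomial.X, Polynomial.C Polynomial.X] p, fun x y => ?_⟩
  rw [← Polynomial.coe_evalEvalRingHom, MvPolynomial.aeval_def, MvPolynomial.hom_eval₂]
  have e1 : (Polynomial.evalEvalRingHom y x).comp
      (algebraMap ℝ (Polynomial (Polynomial ℝ))) = RingHom.id ℝ := by
    ext a
    simp
  rw [e1]
  change MvPolynomial.eval₂ _ _ _ = _
  congr 1
  ext i
  fin_cases i <;> simp

theorem PolyLE.const_mul {m : ℕ} {f : ℝ → ℝ} (hf : PolyLE m f) (c : ℝ) :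
    PolyLE m fun x => c * f x := by
  obtain ⟨P, hP, h⟩ := hf
  exact ⟨Polynomial.C c * P, (Polynomial.natDegree_C_mul_le _ _).trans hP, fun x => by simp [h]⟩

theorem IsPhase.comp_affine {m : ℕ} {Ψ q w : ℝ → ℝ → ℝ} (h : IsPhase m Ψ q w) (y σ : ℝ) :
    IsPhase m (fun x t => Ψ x (y + σ * t)) (fun x t => q x (y + σ * t))
      (fun x t => σ * w x (y + σ * t)) where
  hasDerivAt_fst x t := h.hasDerivAt_fst x _
  hasDerivAt_snd x t := by
    have h1 : HasDerivAt (fun t => y + σ * t) σ t := by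
      simpa using ((hasDerivAt_id t).const_mul σ).const_add y
    have := (h.hasDerivAt_snd x (y + σ * t)).comp t h1
    rwa [mul_comm] at this
  poly_fst t := h.poly_fst _
  poly_snd x := (h.poly_snd x).comp_affine y σ
  poly_q x := (h.poly_q x).comp_affine y σ
  poly_w t := (h.poly_w _).const_mul σ
  cont_q := h.cont_q.comp (by fun_prop : Continuous fun z : ℝ × ℝ => (z.1, y + σ * z.2))
  cont_w := continuous_const.mul
    (h.cont_w.comp (by fun_prop : Continuous fun z : ℝ × ℝ => (z.1, y + σ * z.2)))

theorem IsAmplitude.comp_affine {V Vx Vt : ℝ → ℝ → ℂ} (h : IsAmplitude V Vx Vt) (y σ : ℝ) :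
    IsAmplitude (fun x t => V x (y + σ * t)) (fun x t => Vx x (y + σ * t))
      (fun x t => σ * Vt x (y + σ * t)) where
  hasDerivAt_fst x t := h.hasDerivAt_fst x _
  hasDerivAt_snd x t := by
    have h1 : HasDerivAt (fun t => y + σ * t) σ t := by
      simpa using ((hasDerivAt_id t).const_mul σ).const_add y
    have := (h.hasDerivAt_snd x (y + σ * t)).scomp t h1
    rwa [Complex.real_smul] at this
  cont := h.cont.comp (by fun_prop : Continuous fun z : ℝ × ℝ => (z.1, y + σ * z.2))
  cont_fst := h.cont_fst.comp (by fun_prop : Continuous fun z : ℝ × ℝ => (z.1, y + σ * z.2))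
  cont_snd := continuous_const.mul
    (h.cont_snd.comp (by fun_prop : Continuous fun z : ℝ × ℝ => (z.1, y + σ * z.2)))

section Curve

variable {f : ℝ → ℝ} {m : ℕ} {a b r r' : ℝ}

theorem Straddle.exists_near (hf : PolyLE m f) (hp : HasPair f (Set.Ioo a b))
    (hs : Straddle f (Set.Ioo a b) r) {ε : ℝ} (hε : 0 < ε) :
    (∃ s ∈ Set.Ioo (r - ε) r ∩ Set.Ioo a b, f s < 0) ∧
      ∃ t ∈ Set.Ioo r (r + ε) ∩ Set.Ioo a b, 0 < f t := by
  obtain ⟨s, hsI, t, htI, hst, hfs, hft⟩ := hp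
  obtain ⟨h1, h2⟩ := hs s hsI t htI hst hfs hft
  have hne : ∃ x, f x ≠ 0 := ⟨s, hfs.ne⟩
  have hc := hf.continuous
  have hsr : f r < 0 → False := by
    intro h
    have hrt : r < t := lt_of_le_of_ne h2 (by rintro rfl; linarith)
    obtain ⟨x, hx1, hx2⟩ := (((hc.continuousAt.eventually_lt_const h).filter_mono
      nhdsWithin_le_nhds).and (Ioo_mem_nhdsGT hrt)).exists
    have := hs x ⟨by linarith [hsI.1, hx2.1], by linarith [hx2.2, htI.2]⟩ t htI hx2.2 hx1 hft
    linarith [hx2.1, this.1]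
  have hrt : 0 < f r → False := by
    intro h
    have hrs : s < r := lt_of_le_of_ne h1 (by rintro rfl; linarith)
    obtain ⟨x, hx1, hx2⟩ := (((hc.continuousAt.eventually_const_lt h).filter_mono
      nhdsWithin_le_nhds).and (Ioo_mem_nhdsLT hrs)).exists
    have := hs s hsI x ⟨by linarith [hsI.1, hx2.1], by linarith [hx2.2, htI.2]⟩ hx2.1 hfs hx1
    linarith [hx2.2, this.2]
  have hr0 : f r = 0 := le_antisymm (not_lt.1 hrt) (not_lt.1 hsr)
  have hsr' : s < r := lt_of_le_of_ne h1 (by rintro rfl; linarith)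
  have hrt' : r < t := lt_of_le_of_ne h2 (by rintro rfl; linarith)
  constructor
  · obtain ⟨x, hx, hx0⟩ := hf.exists_ne_zero hne (a := max s (r - ε)) (b := r)
      (max_lt hsr' (by linarith))
    have hx1 : s < x := (le_max_left _ _).trans_lt hx.1
    have hx2 : r - ε < x := (le_max_right _ _).trans_lt hx.1
    have hxI : x ∈ Set.Ioo a b := ⟨by linarith [hsI.1], by linarith [hx.2, htI.2]⟩
    refine ⟨x, ⟨⟨hx2, hx.2⟩, hxI⟩, lt_of_le_of_ne ?_ hx0⟩
    by_contra! hpos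
    have := hs s hsI x hxI hx1 hfs hpos
    linarith [hx.2, this.2]
  · obtain ⟨x, hx, hx0⟩ := hf.exists_ne_zero hne (a := r) (b := min t (r + ε))
      (lt_min hrt' (by linarith))
    have hx1 : x < t := hx.2.trans_le (min_le_left _ _)
    have hx2 : x < r + ε := hx.2.trans_le (min_le_right _ _)
    have hxI : x ∈ Set.Ioo a b := ⟨by linarith [hsI.1, hx.1], by linarith [htI.2]⟩
    refine ⟨x, ⟨⟨hx.1, hx2⟩, hxI⟩, lt_of_le_of_ne ?_ hx0.symm⟩
    by_contra! hneg
    have := hs x hxI t htI hx1 hneg hft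
    linarith [hx.1, this.1]

theorem Straddle.mem (hp : HasPair f (Set.Ioo a b)) (hs : Straddle f (Set.Ioo a b) r) :
    r ∈ Set.Ioo a b := by
  obtain ⟨s, hsI, t, htI, hst, hfs, hft⟩ := hp
  obtain ⟨h1, h2⟩ := hs s hsI t htI hst hfs hft
  exact ⟨hsI.1.trans_le h1, h2.trans_lt htI.2⟩

theorem Straddle.unique (hf : PolyLE m f) (hp : HasPair f (Set.Ioo a b))
    (hs : Straddle f (Set.Ioo a b) r) (hs' : Straddle f (Set.Ioo a b) r') : r = r' := by
  by_contra hne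
  wlog h : r < r' generalizing r r'
  · exact this hs' hs (Ne.symm hne) (lt_of_le_of_ne (not_lt.1 h) (Ne.symm hne))
  obtain ⟨⟨s, hs1, hs2⟩, t, ht1, ht2⟩ := hs.exists_near hf hp (sub_pos.2 h)
  have := hs' s hs1.2 t ht1.2 (hs1.1.2.trans ht1.1.1) hs2 ht2
  linarith [ht1.1.2, this.2]

theorem Straddle.eq_zero (hf : PolyLE m f) (hp : HasPair f (Set.Ioo a b))
    (hs : Straddle f (Set.Ioo a b) r) : f r = 0 := by
  have hc := hf.continuous
  refine le_antisymm ?_ ?_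
  · by_contra! h
    obtain ⟨ε, hε, hε'⟩ := Metric.eventually_nhds_iff.1 (hc.continuousAt.eventually_const_lt h)
    obtain ⟨⟨s, hs1, hs2⟩, -⟩ := hs.exists_near hf hp hε
    have := hε' (y := s) (by rw [Real.dist_eq, abs_lt]; constructor <;> linarith [hs1.1.1, hs1.1.2])
    linarith
  · by_contra! h
    obtain ⟨ε, hε, hε'⟩ := Metric.eventually_nhds_iff.1 (hc.continuousAt.eventually_lt_const h)
    obtain ⟨-, s, hs1, hs2⟩ := hs.exists_near hf hp hε
    have := hε' (y := s) (by rw [Real.dist_eq, abs_lt]; constructor <;> linarith [hs1.1.1, hs1.1.2])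
    linarith

end Curve

theorem eventually_hasPair {q : ℝ → ℝ → ℝ} (hq : ∀ x, Continuous fun y => q x y) {I : Set ℝ} {y : ℝ}
    (h : HasPair (fun x => q x y) I) : ∀ᶠ y' in nhds y, HasPair (fun x => q x y') I := by
  obtain ⟨a, ha, b, hb, hab, h1, h2⟩ := h
  filter_upwards [(hq a).continuousAt.eventually_lt_const h1,
    (hq b).continuousAt.eventually_const_lt h2] with y' h1' h2'
  exact ⟨a, ha, b, hb, hab, h1', h2'⟩

theorem isClosed_setOf_noSignChange {w : ℝ → ℝ → ℝ} (hw : ∀ y, Continuous fun x => w x y)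
    (I : Set ℝ) : IsClosed {x | NoSignChange (fun y => w x y) I} := by
  rw [← isOpen_compl_iff, isOpen_iff_mem_nhds]
  intro x hx
  simp only [NoSignChange, Set.mem_compl_iff, Set.mem_ofPred_eq] at hx
  push Not at hx
  obtain ⟨a, ha, b, hb, hab, h1, h2⟩ := hx
  filter_upwards [(hw a).continuousAt.eventually_lt_const h1,
    (hw b).continuousAt.eventually_const_lt h2] with x' h1' h2' h
  exact absurd (h a ha b hb hab h1') (not_le.2 h2')

/-- At height `y`, the curve `R` passes through the point where `∂ₓφ` changes sign from `-` to `+`,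
with speed at least `α` unless `y` lies in the exceptional set `E`. -/
structure IsCurve (α : ℝ) (q w : ℝ → ℝ → ℝ) (R : ℝ → ℝ) (E : Set ℝ) (y : ℝ) : Prop where
  straddle : Straddle (fun x => q x y) (Set.Ioo (-1) 1) (R y)
  noSignChange : NoSignChange (fun s => w (R y) s) (Set.Ioo (-1) 1)
  continuousAt : ContinuousAt R y
  slope : y ∉ E → ∃ e, HasDerivAt R e y ∧ α ≤ |e|

theorem exists_straddle_of_assumptionH1 {α : ℝ} {φ : MvPolynomial (Fin 2) ℝ}
    (H : AssumptionH1 α φ (Set.Ioo (-1) 1) (Set.Ioo (-1) 1)) {y : ℝ} (hy : y ∈ Set.Ioo (-1 : ℝ) 1)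
    (hp : HasPair (fun x => polyDx φ x y) (Set.Ioo (-1) 1)) :
    ∃ r, Straddle (fun x => polyDx φ x y) (Set.Ioo (-1) 1) r ∧
      NoSignChange (fun s => polyDy φ r s) (Set.Ioo (-1) 1) := by
  obtain ⟨N, W, r, hWo, -, -, hcl, hsign, -⟩ := H
  have hφ := MvPolynomial.isPhase (le_refl φ.totalDegree)
  have hq : ∀ x, Continuous fun y => polyDx φ x y := fun x => (hφ.poly_q x).continuous
  obtain ⟨j, hj⟩ := Set.mem_iUnion.1 (hcl.symm ▸ subset_closure hy : y ∈ ⋃ j, closure (W j))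
  obtain ⟨u, huW, hu⟩ := mem_closure_iff_seq_limit.1 hj
  have hstr : ∀ n, HasPair (fun x => polyDx φ x (u n)) (Set.Ioo (-1) 1) →
      Straddle (fun x => polyDx φ x (u n)) (Set.Ioo (-1) 1) (r j (u n)) ∧
        NoSignChange (fun s => polyDy φ (r j (u n)) s) (Set.Ioo (-1) 1) := by
    intro n ⟨a, ha, b, hb, hab, h1, h2⟩
    rcases hsign j (u n) (huW n) with h | ⟨h, h'⟩
    · exact absurd (h a ha b hb hab h1) (not_le.2 h2)
    · exact ⟨fun a ha b hb hab h1 h2 => ⟨(h.2.2 a ha b hb hab h1 h2).1.le,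
        (h.2.2 a ha b hb hab h1 h2).2.le⟩, h'⟩
  have hev := hu.eventually (eventually_hasPair hq hp)
  have hpairs : ∀ a ∈ Set.Ioo (-1 : ℝ) 1, ∀ b ∈ Set.Ioo (-1 : ℝ) 1, a < b → polyDx φ a y < 0 →
      0 < polyDx φ b y → ∀ᶠ n in Filter.atTop, r j (u n) ∈ Set.Icc a b := by
    intro a ha b hb hab h1 h2
    filter_upwards [hev, hu.eventually ((hq a).continuousAt.eventually_lt_const h1),
      hu.eventually ((hq b).continuousAt.eventually_const_lt h2)] with n hn h1' h2'
    exact (hstr n hn).1 a ha b hb hab h1' h2'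
  obtain ⟨a, ha, b, hb, hab, h1, h2⟩ := hp
  obtain ⟨ρ, -, g, hg, hlim⟩ := isCompact_Icc.tendsto_subseq'
    (hpairs a ha b hb hab h1 h2).frequently
  refine ⟨ρ, fun a ha b hb hab h1 h2 => ?_, ?_⟩
  · have := hg.tendsto_atTop.eventually (hpairs a ha b hb hab h1 h2)
    exact isClosed_Icc.mem_of_tendsto hlim this
  · have hcl := isClosed_setOf_noSignChange (w := polyDy φ)
      (fun y => (hφ.poly_w y).continuous) (Set.Ioo (-1) 1)
    exact hcl.mem_of_tendsto hlim ((hg.tendsto_atTop.eventually hev).mono fun n hn => (hstr _ hn).2)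

theorem exists_isCurve {α : ℝ} {φ : MvPolynomial (Fin 2) ℝ}
    (H : AssumptionH1 α φ (Set.Ioo (-1) 1) (Set.Ioo (-1) 1)) :
    ∃ (R : ℝ → ℝ) (E : Set ℝ), E.Finite ∧ ∀ y ∈ Set.Ioo (-1 : ℝ) 1,
      HasPair (fun x => polyDx φ x y) (Set.Ioo (-1) 1) → IsCurve α (polyDx φ) (polyDy φ) R E y := by
  classical
  by_cases hne : ∃ x y, polyDx φ x y ≠ 0
  swap
  · push Not at hne
    exact ⟨0, ∅, Set.finite_empty, fun y _ ⟨a, _, b, _, _, h1, _⟩ =>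
      absurd (hne a y) (ne_of_lt h1)⟩
  have hφ := MvPolynomial.isPhase (le_refl φ.totalDegree)
  have hq : ∀ x, Continuous fun y => polyDx φ x y := fun x => (hφ.poly_q x).continuous
  set Ω := Set.Ioo (-1 : ℝ) 1 with hΩ
  set R : ℝ → ℝ := fun y => if h : ∃ r, Straddle (fun x => polyDx φ x y) Ω r ∧
      NoSignChange (fun s => polyDy φ r s) Ω then h.choose else 0 with hR
  have hspec : ∀ y ∈ Ω, HasPair (fun x => polyDx φ x y) Ω →
      Straddle (fun x => polyDx φ x y) Ω (R y) ∧ NoSignChange (fun s => polyDy φ (R y) s) Ω := by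
    intro y hy hp
    have h := exists_straddle_of_assumptionH1 H hy hp
    have e : R y = h.choose := dif_pos h
    rw [e]
    exact h.choose_spec
  have hΩo : ∀ y ∈ Ω, ∀ᶠ y' in nhds y, y' ∈ Ω := fun y hy => isOpen_Ioo.mem_nhds hy
  have hcont : ∀ y ∈ Ω, HasPair (fun x => polyDx φ x y) Ω → ContinuousAt R y := by
    intro y hy hp
    rw [Metric.continuousAt_iff']
    intro ε hε
    obtain ⟨⟨s, hs, hs'⟩, t, ht, ht'⟩ := (hspec y hy hp).1.exists_near (hφ.poly_q_fst y) hp hε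
    filter_upwards [hΩo y hy, (hq s).continuousAt.eventually_lt_const hs',
      (hq t).continuousAt.eventually_const_lt ht'] with y' hy' h1 h2
    have hst : s < t := hs.1.2.trans ht.1.1
    have := (hspec y' hy' ⟨s, hs.2, t, ht.2, hst, h1, h2⟩).1 s hs.2 t ht.2 hst h1 h2
    rw [Real.dist_eq, abs_lt]
    constructor <;> linarith [this.1, this.2, hs.1.1, ht.1.2]
  obtain ⟨Q, hQ⟩ := MvPolynomial.exists_evalEval_eq (MvPolynomial.pderiv 0 φ)
  have hQ0 : Q ≠ 0 := by
    rintro rfl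
    obtain ⟨x, y, hxy⟩ := hne
    exact hxy (by rw [polyDx, ← hQ]; simp)
  obtain ⟨G, c, hc, hG⟩ := exists_simple_zeros hQ0
  refine ⟨R, {y | c.eval y = 0}, ?_, fun y hy hp => ⟨(hspec y hy hp).1, (hspec y hy hp).2,
    hcont y hy hp, fun hyE => ?_⟩⟩
  · refine (c.roots.toFinset.finite_toSet).subset fun y hy => ?_
    simpa [hc] using hy
  have hroot : ∀ y ∈ Ω, HasPair (fun x => polyDx φ x y) Ω → Q.evalEval y (R y) = 0 :=
    fun y hy hp => by
      rw [hQ]; exact (hspec y hy hp).1.eq_zero (hφ.poly_q_fst y) hp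
  have hcev : ∀ᶠ y' in nhds y, c.eval y' ≠ 0 := c.continuous.continuousAt.eventually_ne hyE
  have hpev := eventually_hasPair hq hp
  refine exists_hasDerivAt_of_simple_zeros G ?_ ?_ (hG y hyE _ (hroot y hy hp)).2 ?_
  · filter_upwards [hΩo y hy, hpev] with y' h1 h2 using hcont y' h1 h2
  · filter_upwards [hΩo y hy, hpev, hcev] with y' h1 h2 h3
    exact (hG y' h3 _ (hroot y' h1 h2)).1
  obtain ⟨N, W, r, hWo, -, hrC, hcl, hsign, hslope⟩ := H
  obtain ⟨j, hj⟩ := Set.mem_iUnion.1 (hcl.symm ▸ subset_closure hy : y ∈ ⋃ j, closure (W j))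
  have heq : ∀ y' ∈ W j, y' ∈ Ω → HasPair (fun x => polyDx φ x y') Ω → R y' = r j y' := by
    intro y' hW hyΩ hp'
    refine (hspec y' hyΩ hp').1.unique (hφ.poly_q_fst y') hp' ?_
    obtain ⟨a, ha, b, hb, hab, h1, h2⟩ := hp'
    rcases hsign j y' hW with h | ⟨h, -⟩
    · exact absurd (h a ha b hb hab h1) (not_le.2 h2)
    · exact fun a ha b hb hab h1 h2 => ⟨(h.2.2 a ha b hb hab h1 h2).1.le,
        (h.2.2 a ha b hb hab h1 h2).2.le⟩
  refine (mem_closure_iff_frequently.1 hj).mp ?_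
  filter_upwards [hΩo y hy, hpev] with y' h1 h2 hW
  refine ⟨deriv (r j) y', ?_, hslope j y' hW⟩
  have hd : HasDerivAt (r j) (deriv (r j) y') y' :=
    (((hrC j).contDiffAt ((hWo j).mem_nhds hW)).differentiableAt (by simp)).hasDerivAt
  refine hd.congr_of_eventuallyEq ?_
  filter_upwards [(hWo j).mem_nhds hW, hΩo y' h1, eventually_hasPair hq h2] with z hz1 hz2 hz3
  exact heq z hz1 hz2 hz3

theorem timeMean_comp_le_maxFn {t₁ : ℝ} (ht₁ : 0 < t₁) (ht₂ : t₁ ≤ 2) {σ : ℝ} (hσ : σ = 1 ∨ σ = -1)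
    (S : ℝ → ℝ≥0∞) (y : ℝ) : timeMean t₁ (fun t => S (y + σ * t)) ≤ 4 * maxFn S y := by
  have key : ∫⁻ t in Set.Icc 0 t₁, S (y + σ * t) ≤ ENNReal.ofReal (2 * t₁) * maxFn S y := by
    rcases hσ with rfl | rfl
    · have h1 : MeasurePreserving (fun t : ℝ => y + 1 * t) volume volume := by
        simpa using measurePreserving_add_left volume y
      have h2 : MeasurableEmbedding (fun t : ℝ => y + 1 * t) := by
        simpa using measurableEmbedding_addLeft y
      have h3 : (fun t : ℝ => y + 1 * t) ⁻¹' Set.Icc y (y + t₁) = Set.Icc 0 t₁ := by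
        ext t; simp
      rw [← h3, h1.setLIntegral_comp_preimage_emb h2]
      refine (setLIntegral_le_maxFn S (y := y) (by linarith) (by linarith)
        ⟨le_rfl, by linarith⟩).trans (le_of_eq ?_)
      congr 2; ring
    · have e : (fun t : ℝ => y + -1 * t) = fun t => y - t := by ext t; ring
      have h1 : MeasurePreserving (fun t : ℝ => y + -1 * t) volume volume := by
        rw [e]; exact Measure.measurePreserving_sub_left volume y
      have h2 : MeasurableEmbedding (fun t : ℝ => y + -1 * t) := by
        rw [e]; exact (MeasurableEquiv.subLeft y).measurableEmbedding
      have h3 : (fun t : ℝ => y + -1 * t) ⁻¹' Set.Icc (y - t₁) y = Set.Icc 0 t₁ := by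
        ext t
        simp only [Set.mem_preimage, Set.mem_Icc]
        constructor <;> rintro ⟨h, h'⟩ <;> constructor <;> linarith
      rw [← h3, h1.setLIntegral_comp_preimage_emb h2]
      refine (setLIntegral_le_maxFn S (y := y) (by linarith) (by linarith)
        ⟨by linarith, le_rfl⟩).trans (le_of_eq ?_)
      congr 2; ring
  calc timeMean t₁ (fun t => S (y + σ * t)) ≤
        ENNReal.ofReal t₁⁻¹ * (ENNReal.ofReal (2 * t₁) * maxFn S y) := mul_le_mul' le_rfl key
    _ = ENNReal.ofReal (t₁⁻¹ * (2 * t₁)) * maxFn S y := by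
        rw [← mul_assoc, ← ENNReal.ofReal_mul (by positivity)]
    _ = 2 * maxFn S y := by
        have : t₁⁻¹ * (2 * t₁) = 2 := by field_simp
        rw [this, ENNReal.ofReal_ofNat]
    _ ≤ _ := by gcongr; norm_num

/-- The points `x` above which `∂_yφ` does not change sign from `-` to `+`. -/
def goodLines (w : ℝ → ℝ → ℝ) : Set ℝ := {x | NoSignChange (fun y => w x y) (Set.Ioo (-1) 1)}

theorem isValley_of_isCurve {m : ℕ} {α : ℝ} {Φ q w : ℝ → ℝ → ℝ} {V : ℝ → ℝ → ℂ} {R : ℝ → ℝ}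
    {E : Set ℝ} (hΦ : IsPhase m Φ q w) (hE : E.Finite)
    (hcurve : ∀ y ∈ Set.Ioo (-1 : ℝ) 1, HasPair (fun x => q x y) (Set.Ioo (-1) 1) →
      IsCurve α q w R E y)
    (hV₁ : ∀ x ∉ Set.Ioo (-1 : ℝ) 1, ∀ y, V x y = 0) (hV₂ : ∀ x, ∀ y ∉ Set.Ioo (-1 : ℝ) 1, V x y = 0)
    {y T σ : ℝ} (hσ : σ = 1 ∨ σ = -1) (hT : 0 < T)
    (hpair : HasPair (fun x => q x y) (Set.Ioo (-1) 1))
    (hin : ∀ t ∈ Set.Ico 0 T, y + σ * t ∈ Set.Ioo (-1 : ℝ) 1)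
    (hout : y + σ * T ∉ Set.Ioo (-1 : ℝ) 1)
    (hle : ∀ t ∈ Set.Ico 0 T, Φ (R y) (y + σ * t) ≤ Φ (R y) y) :
    IsValley m α (fun x t => Φ x (y + σ * t)) (fun x t => q x (y + σ * t))
      (fun x t => V x (y + σ * t)) (goodLines w) (fun t => R (y + σ * t)) T := by
  have hσ0 : σ ≠ 0 := by rcases hσ with rfl | rfl <;> norm_num
  have hσa : |σ| = 1 := by rcases hσ with rfl | rfl <;> simp
  have hy0 : y + σ * 0 = y := by ring
  have hy : y ∈ Set.Ioo (-1 : ℝ) 1 := by simpa using hin 0 ⟨le_rfl, hT⟩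
  have hcv : ∀ t ∈ Set.Ico 0 T, HasPair (fun x => q x (y + σ * t)) (Set.Ioo (-1) 1) →
      IsCurve α q w R E (y + σ * t) := fun t ht hp => hcurve _ (hin t ht) hp
  refine ⟨hT, by simpa using hpair, fun t x hx => hV₁ x hx _, fun x => hV₂ x _ hout, ?_, ?_,
    fun t ht hp => (hcv t ht hp).straddle, fun t ht hp => (hcv t ht hp).noSignChange,
    fun t ht hp => ?_, fun t ht hp => ?_, (fun t => y + σ * t) ⁻¹' E, ?_, fun t ht hp hE => ?_⟩
  · simpa using (hcurve y hy hpair).straddle.mem hpair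
  · intro t ht
    simp only [hy0]
    have hcl : IsClosed {t : ℝ | Φ (R y) (y + σ * t) ≤ Φ (R y) y} :=
      isClosed_le ((hΦ.poly_snd (R y)).continuous.comp (by fun_prop)) continuous_const
    have : Set.Icc 0 T ⊆ {t : ℝ | Φ (R y) (y + σ * t) ≤ Φ (R y) y} := by
      rw [← closure_Ico hT.ne]
      exact hcl.closure_subset_iff.2 hle
    exact this ht
  · exact Straddle.eq_zero (f := fun x => q x (y + σ * t)) (hΦ.poly_q_fst _) hp
      (hcv t ht hp).straddle
  · exact ContinuousAt.comp (f := fun t : ℝ => y + σ * t) (hcv t ht hp).continuousAt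
      (by fun_prop)
  · exact hE.preimage fun s _ t _ hst => by
      have : σ * s = σ * t := by simpa using hst
      exact mul_left_cancel₀ hσ0 this
  · obtain ⟨e, he, hαe⟩ := (hcv t ⟨ht.1.le, ht.2⟩ hp).slope hE
    have h1 : HasDerivAt (fun t => y + σ * t) σ t := by
      simpa using ((hasDerivAt_id t).const_mul σ).const_add y
    exact ⟨e * σ, he.comp t h1, by rwa [abs_mul, hσa, mul_one]⟩

theorem exists_isValley {m : ℕ} {α : ℝ} {Φ q w : ℝ → ℝ → ℝ} {V : ℝ → ℝ → ℂ} {R : ℝ → ℝ}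
    {E : Set ℝ} (hΦ : IsPhase m Φ q w) (hE : E.Finite)
    (hcurve : ∀ y ∈ Set.Ioo (-1 : ℝ) 1, HasPair (fun x => q x y) (Set.Ioo (-1) 1) →
      IsCurve α q w R E y)
    (hV₁ : ∀ x ∉ Set.Ioo (-1 : ℝ) 1, ∀ y, V x y = 0) (hV₂ : ∀ x, ∀ y ∉ Set.Ioo (-1 : ℝ) 1, V x y = 0)
    {y : ℝ} (hy : y ∈ Set.Ioo (-1 : ℝ) 1) (hpair : HasPair (fun x => q x y) (Set.Ioo (-1) 1)) :
    ∃ σ T : ℝ, (σ = 1 ∨ σ = -1) ∧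
      IsValley m α (fun x t => Φ x (y + σ * t)) (fun x t => q x (y + σ * t))
        (fun x t => V x (y + σ * t)) (goodLines w) (fun t => R (y + σ * t)) T := by
  have hval := (hcurve y hy hpair).noSignChange.noDeepValley (fun s => hΦ.hasDerivAt_snd (R y) s)
  rcases hval.left_or_right y with h | h
  · refine ⟨-1, y + 1, Or.inr rfl, isValley_of_isCurve hΦ hE hcurve hV₁ hV₂ (Or.inr rfl)
      (by linarith [hy.1]) hpair (fun t ht => ⟨by linarith [ht.2], by linarith [ht.1, hy.2]⟩)
      (fun hc => by linarith [hc.1]) fun t ht => ?_⟩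
    rcases eq_or_lt_of_le ht.1 with rfl | h0
    · simp
    · simpa using h (y + -1 * t) (by linarith [ht.2]) (by linarith)
  · refine ⟨1, 1 - y, Or.inl rfl, isValley_of_isCurve hΦ hE hcurve hV₁ hV₂ (Or.inl rfl)
      (by linarith [hy.2]) hpair (fun t ht => ⟨by linarith [ht.1, hy.1], by linarith [ht.2]⟩)
      (fun hc => by linarith [hc.2]) fun t ht => ?_⟩
    rcases eq_or_lt_of_le ht.1 with rfl | h0
    · simp
    · simpa using h (y + 1 * t) (by linarith) (by linarith [ht.2])

theorem enorm_real_sign {σ : ℝ} (hσ : σ = 1 ∨ σ = -1) : ‖(σ : ℂ)‖ₑ = 1 := by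
  rcases hσ with rfl | rfl <;> simp

/-- Pointwise estimate of `(∂ₓΦ)V` by maximal functions. -/
theorem sliceNorm_le_maxFn (m : ℕ) {α : ℝ} (hα : 0 < α) : ∃ C₀ : ℝ≥0∞, C₀ ≠ ⊤ ∧
    ∀ ε : ℝ, 0 < ε → ε ≤ 1 → ∃ C : ℝ≥0∞, C ≠ ⊤ ∧
    ∀ {Φ q w : ℝ → ℝ → ℝ} {V Vx Vy : ℝ → ℝ → ℂ} {R : ℝ → ℝ} {E : Set ℝ},
      IsPhase m Φ q w → IsAmplitude V Vx Vy → E.Finite →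
      (∀ y ∈ Set.Ioo (-1 : ℝ) 1, HasPair (fun x => q x y) (Set.Ioo (-1) 1) →
        IsCurve α q w R E y) →
      (∀ x ∉ Set.Ioo (-1 : ℝ) 1, ∀ y, V x y = 0) → (∀ x, ∀ y ∉ Set.Ioo (-1 : ℝ) 1, V x y = 0) →
      ∀ y, sliceNorm Set.univ (fun x t => q x t * V x t) y ≤
        C * (sliceNorm Set.univ (fun x t => Vx x t + q x t * V x t) y +
          (maxFn (sliceNorm Set.univ fun x t => Vy x t + w x t * V x t) y +
            maxFn (sliceNorm (goodLines w) fun x t => w x t * V x t) y +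
            maxFn (sliceNorm (goodLines w) Vy) y)) +
        C₀ * ENNReal.ofReal (2 * ε) ^ (1 / 2 : ℝ) *
          maxFn (fun t => sliceNorm Set.univ (fun x t => q x t * V x t) t +
            sliceNorm Set.univ (fun x t => Vx x t + q x t * V x t) t) y := by
  obtain ⟨C₀, hC₀, hmain⟩ := IsValley.sliceNorm_le m hα
  obtain ⟨D, hD, hno⟩ := IsPhase.sliceNorm_le_of_noDeepValley m
  refine ⟨4 * C₀, by simp [ENNReal.mul_eq_top, hC₀], fun ε hε hε1 => ?_⟩
  obtain ⟨C, hC, hmain⟩ := hmain ε hε hε1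
  refine ⟨4 * C + D, by simp [ENNReal.mul_eq_top, hC, hD], ?_⟩
  intro Φ q w V Vx Vy R E hΦ hV hE hcurve hV₁ hV₂ y
  by_cases hy : y ∈ Set.Ioo (-1 : ℝ) 1
  swap
  · have : sliceNorm Set.univ (fun x t => q x t * V x t) y = 0 := by
      simp [sliceNorm, hV₂ _ y hy]
    rw [this]; exact zero_le
  by_cases hpair : HasPair (fun x => q x y) (Set.Ioo (-1) 1)
  swap
  · have hns : NoSignChange (fun x => q x y) (Set.Ioo (-1) 1) := by
      intro a ha b hb hab h1
      by_contra! h2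
      exact hpair ⟨a, ha, b, hb, hab, h1, h2⟩
    refine (hno hΦ hV y (-1) 1 ((hns.noDeepValley fun x => hΦ.hasDerivAt_fst x y).mono zero_le_one)
      fun x hx => hV₁ x hx y).trans ?_
    exact (mul_le_mul' le_add_self le_self_add).trans le_self_add
  obtain ⟨σ, T, hσ, hv⟩ := exists_isValley hΦ hE hcurve hV₁ hV₂ hy hpair
  have hΨ := hΦ.comp_affine y σ
  have hU := hV.comp_affine y σ
  set S₂ := sliceNorm Set.univ fun x t => Vy x t + w x t * V x t with hS₂
  set S₃ := sliceNorm (goodLines w) fun x t => (w x t : ℂ) * V x t with hS₃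
  set S₄ := sliceNorm (goodLines w) Vy with hS₄
  set S₅ : ℝ → ℝ≥0∞ := fun t => sliceNorm Set.univ (fun x t => q x t * V x t) t +
            sliceNorm Set.univ (fun x t => Vx x t + q x t * V x t) t with hS₅
  have e2 : (sliceNorm Set.univ fun x t => (σ : ℂ) * Vy x (y + σ * t) +
      ((σ * w x (y + σ * t) : ℝ) : ℂ) * V x (y + σ * t)) = fun t => S₂ (y + σ * t) := by
    ext t
    simp only [hS₂, sliceNorm]
    congr 1
    refine lintegral_congr fun x => ?_
    rw [Complex.ofReal_mul, mul_assoc, ← mul_add, enorm_mul, enorm_real_sign hσ, one_mul]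
  have e3 : (sliceNorm (goodLines w) fun x t =>
      ((σ * w x (y + σ * t) : ℝ) : ℂ) * V x (y + σ * t)) = fun t => S₃ (y + σ * t) := by
    ext t
    simp only [hS₃, sliceNorm]
    congr 1
    refine lintegral_congr fun x => ?_
    rw [Complex.ofReal_mul, mul_assoc, enorm_mul, enorm_real_sign hσ, one_mul]
  have e4 : (sliceNorm (goodLines w) fun x t => (σ : ℂ) * Vy x (y + σ * t)) =
      fun t => S₄ (y + σ * t) := by
    ext t
    simp only [hS₄, sliceNorm]
    congr 1
    refine lintegral_congr fun x => ?_
    rw [enorm_mul, enorm_real_sign hσ, one_mul]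
  set B := 4 * (maxFn S₂ y + maxFn S₃ y + maxFn S₄ y) with hB
  have hB2 : 4 * maxFn S₂ y ≤ B := mul_le_mul' le_rfl (le_self_add.trans le_self_add)
  have hB3 : 4 * maxFn S₃ y ≤ B := mul_le_mul' le_rfl (le_add_self.trans le_self_add)
  have hB4 : 4 * maxFn S₄ y ≤ B := mul_le_mul' le_rfl le_add_self
  have h := hmain hΨ hU hv B (4 * maxFn S₅ y)
    (fun t₁ h1 h2 => by
      rw [e2]; exact (timeMean_comp_le_maxFn h1 h2 hσ S₂ y).trans hB2)
    (fun t₁ h1 h2 => by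
      rw [e3]; exact (timeMean_comp_le_maxFn h1 h2 hσ S₃ y).trans hB3)
    (fun t₁ h1 h2 => by
      rw [e4]; exact (timeMean_comp_le_maxFn h1 h2 hσ S₄ y).trans hB4)
    (fun t₁ h1 h2 => timeMean_comp_le_maxFn h1 h2 hσ S₅ y)
  have e0 : sliceNorm Set.univ (fun x t => (q x (y + σ * t) : ℂ) * V x (y + σ * t)) 0 =
      sliceNorm Set.univ (fun x t => q x t * V x t) y := by simp [sliceNorm]
  have e1 : sliceNorm Set.univ (fun x t => Vx x (y + σ * t) +
      (q x (y + σ * t) : ℂ) * V x (y + σ * t)) 0 =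
      sliceNorm Set.univ (fun x t => Vx x t + q x t * V x t) y := by simp [sliceNorm]
  rw [e0, e1] at h
  refine h.trans ?_
  set N₁ := sliceNorm Set.univ (fun x t => Vx x t + q x t * V x t) y
  set Mx := maxFn S₂ y + maxFn S₃ y + maxFn S₄ y
  refine add_le_add ?_ (le_of_eq (by ring))
  calc C * (N₁ + B) ≤ C * (4 * N₁ + B) := by
        refine mul_le_mul' le_rfl (add_le_add ?_ le_rfl)
        calc N₁ = 1 * N₁ := (one_mul _).symm
          _ ≤ 4 * N₁ := mul_le_mul' (by norm_num) le_rfl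
    _ = 4 * C * (N₁ + Mx) := by rw [hB]; ring
    _ ≤ _ := mul_le_mul' le_self_add le_rfl

theorem measurable_sliceNorm (X : Set ℝ) {g : ℝ → ℝ → ℂ}
    (hg : Continuous fun z : ℝ × ℝ => g z.1 z.2) : Measurable (sliceNorm X g) := by
  have hm : Measurable (Function.uncurry fun x t => ‖g x t‖ₑ ^ 2) :=
    Continuous.measurable (by simp only [Function.uncurry_def]; fun_prop)
  exact (hm.lintegral_prod_left').pow_const _

theorem ENNReal.add₅_sq_le (a b c d e : ℝ≥0∞) :
    (a + (b + c + d) + e) ^ 2 ≤ 16 * (a ^ 2 + b ^ 2 + c ^ 2 + d ^ 2) + 2 * e ^ 2 := by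
  have h1 := ENNReal.add_sq_le (a + (b + c + d)) e
  have h2 := ENNReal.add_sq_le a (b + c + d)
  have h3 := ENNReal.add_sq_le (b + c) d
  have h4 := ENNReal.add_sq_le b c
  calc _ ≤ 2 * ((2 * (a ^ 2 + 2 * (2 * (b ^ 2 + c ^ 2) + d ^ 2))) + e ^ 2) :=
        h1.trans (mul_le_mul' le_rfl (add_le_add (h2.trans (mul_le_mul' le_rfl (add_le_add le_rfl
          (h3.trans (mul_le_mul' le_rfl (add_le_add h4 le_rfl)))))) le_rfl))
    _ = 4 * a ^ 2 + 16 * b ^ 2 + 16 * c ^ 2 + 8 * d ^ 2 + 2 * e ^ 2 := by ring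
    _ ≤ 16 * a ^ 2 + 16 * b ^ 2 + 16 * c ^ 2 + 16 * d ^ 2 + 2 * e ^ 2 := by
        gcongr <;> norm_num
    _ = _ := by ring

/-- The estimates in `y` on the lines along which `∂_yΦ` does not change sign from `-` to `+`. -/
theorem lintegral_goodLines_le (m : ℕ) : ∃ C : ℝ≥0∞, C ≠ ⊤ ∧
    ∀ {Φ q w : ℝ → ℝ → ℝ} {V Vx Vy : ℝ → ℝ → ℂ}, IsPhase m Φ q w → IsAmplitude V Vx Vy →
      (∀ x, ∀ y ∉ Set.Ioo (-1 : ℝ) 1, V x y = 0) →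
      (∫⁻ y, sliceNorm (goodLines w) (fun x t => w x t * V x t) y ^ 2 ≤
        C * ∫⁻ y, sliceNorm Set.univ (fun x t => Vy x t + w x t * V x t) y ^ 2) ∧
      ∫⁻ y, sliceNorm (goodLines w) Vy y ^ 2 ≤
        C * ∫⁻ y, sliceNorm Set.univ (fun x t => Vy x t + w x t * V x t) y ^ 2 := by
  obtain ⟨C, hC, h⟩ := NoDeepValley.lintegral_le m
  refine ⟨2 * (1 + C), by simp [ENNReal.mul_eq_top, hC], fun {Φ q w V Vx Vy} hΦ hV hsupp => ?_⟩
  have hc2 := hΦ.cont_op_snd hV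
  have hcw : Continuous fun z : ℝ × ℝ => (w z.1 z.2 : ℂ) * V z.1 z.2 := by
    have := hΦ.cont_w; have := hV.cont; fun_prop
  have hcl : MeasurableSet (goodLines w) :=
    (isClosed_setOf_noSignChange (fun y => (hΦ.poly_w y).continuous) _).measurableSet
  have hm2 : Measurable (Function.uncurry fun x t => ‖Vy x t + w x t * V x t‖ₑ ^ 2) :=
    Continuous.measurable (by simp only [Function.uncurry_def]; fun_prop)
  have hmw : Measurable (Function.uncurry fun x t => ‖(w x t : ℂ) * V x t‖ₑ ^ 2) :=
    Continuous.measurable (by simp only [Function.uncurry_def]; fun_prop)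
  have key : ∫⁻ y, sliceNorm (goodLines w) (fun x t => w x t * V x t) y ^ 2 ≤
        C * ∫⁻ y, sliceNorm Set.univ (fun x t => Vy x t + w x t * V x t) y ^ 2 := by
    simp only [sliceNorm_sq, setLIntegral_univ]
    rw [← lintegral_lintegral_swap hmw.aemeasurable, ← lintegral_lintegral_swap hm2.aemeasurable,
      ← lintegral_const_mul' _ _ hC]
    refine (setLIntegral_mono' hcl fun x hx => ?_).trans (setLIntegral_le_lintegral _ _)
    have hns : NoSignChange (fun y => w x y) (Set.Ioo (-1) 1) := hx
    have h1 := h _ (hΦ.poly_snd x) (-1) 1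
      ((hns.noDeepValley fun s => hΦ.hasDerivAt_snd x s).mono zero_le_one) (fun t => V x t)
      (fun t => Vy x t) (fun s => hV.hasDerivAt_snd x s) (hV.cont_vt_snd x) (hsupp x)
    have e : deriv (fun t => Φ x t) = fun t => w x t :=
      funext fun t => (hΦ.hasDerivAt_snd x t).deriv
    rw [e] at h1
    have e' : ∀ t, ‖(w x t : ℂ) * V x t‖ₑ = ‖w x t‖ₑ * ‖V x t‖ₑ := fun t => by
      rw [enorm_mul, ← ofReal_norm (w x t : ℂ), ← ofReal_norm (w x t), Complex.norm_real]
    simpa only [e'] using h1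
  refine ⟨key.trans (mul_le_mul' ?_ le_rfl), ?_⟩
  · calc C ≤ 1 + C := le_add_self
      _ = 1 * (1 + C) := (one_mul _).symm
      _ ≤ 2 * (1 + C) := by gcongr; norm_num
  set S₂ := sliceNorm Set.univ fun x t => Vy x t + w x t * V x t
  have hle : ∀ y, sliceNorm (goodLines w) Vy y ^ 2 ≤ 2 * (S₂ y ^ 2 +
      sliceNorm (goodLines w) (fun x t => w x t * V x t) y ^ 2) := by
    intro y
    simp only [S₂, sliceNorm_sq, setLIntegral_univ]
    have hc2' : Continuous fun x => Vy x y + w x y * V x y :=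
      hc2.comp (by fun_prop : Continuous fun x : ℝ => (x, y))
    have hm2' : Measurable fun x => ‖Vy x y + w x y * V x y‖ₑ ^ 2 :=
      Continuous.measurable (by fun_prop)
    calc _ ≤ ∫⁻ x in goodLines w,
          2 * (‖Vy x y + w x y * V x y‖ₑ ^ 2 + ‖(w x y : ℂ) * V x y‖ₑ ^ 2) := by
          refine lintegral_mono fun x => ?_
          refine le_trans ?_ (ENNReal.add_sq_le _ _)
          refine pow_le_pow_left' ?_ 2
          calc ‖Vy x y‖ₑ = ‖(Vy x y + w x y * V x y) - w x y * V x y‖ₑ := by ring_nf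
            _ ≤ _ := enorm_sub_le
      _ ≤ _ := by
          rw [lintegral_const_mul' _ _ (by norm_num), lintegral_add_left hm2']
          gcongr
          exact Measure.restrict_le_self
  have hmS₂ : Measurable S₂ := measurable_sliceNorm _ hc2
  calc _ ≤ ∫⁻ y, 2 * (S₂ y ^ 2 + sliceNorm (goodLines w) (fun x t => w x t * V x t) y ^ 2) :=
        lintegral_mono hle
    _ = 2 * ((∫⁻ y, S₂ y ^ 2) +
        ∫⁻ y, sliceNorm (goodLines w) (fun x t => w x t * V x t) y ^ 2) := by
        rw [lintegral_const_mul' _ _ (by norm_num), lintegral_add_left (hmS₂.pow_const 2)]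
    _ ≤ 2 * ((∫⁻ y, S₂ y ^ 2) + C * ∫⁻ y, S₂ y ^ 2) :=
        mul_le_mul' le_rfl (add_le_add le_rfl key)
    _ = _ := by ring

theorem ENNReal.le_two_mul_of_le_add_half {a b : ℝ≥0∞} (ha : a ≠ ⊤) (h : a ≤ b + 2⁻¹ * a) :
    a ≤ 2 * b := by
  have h1 : 2⁻¹ * a + 2⁻¹ * a = a := by
    rw [← add_mul, ENNReal.inv_two_add_inv_two, one_mul]
  have h2 : 2⁻¹ * a + 2⁻¹ * a ≤ b + 2⁻¹ * a := h1.le.trans h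
  have h3 : 2⁻¹ * a ≤ b :=
    (ENNReal.add_le_add_iff_right (ENNReal.mul_ne_top (by simp) ha)).1 h2
  calc a = 2 * (2⁻¹ * a) := by
        rw [← mul_assoc, ENNReal.mul_inv_cancel (by norm_num) (by norm_num), one_mul]
    _ ≤ _ := mul_le_mul' le_rfl h3

theorem exists_small_constant {C₀ : ℝ≥0∞} (hC₀ : C₀ ≠ ⊤) : ∃ ε : ℝ, 0 < ε ∧ ε ≤ 1 ∧
    128 * (C₀ * ENNReal.ofReal (2 * ε) ^ (1 / 2 : ℝ)) ^ 2 ≤ 2⁻¹ := by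
  set c := C₀.toReal with hc
  have hc0 : 0 ≤ c := ENNReal.toReal_nonneg
  refine ⟨1 / (512 * (c ^ 2 + 1)), by positivity, by
    rw [div_le_one (by positivity)]; nlinarith, ?_⟩
  rw [mul_pow, ENNReal.sqrt_sq, ← ENNReal.ofReal_toReal hC₀, ← hc, ← ENNReal.ofReal_pow hc0,
    ← ENNReal.ofReal_mul (by positivity), ← ENNReal.ofReal_ofNat 128,
    ← ENNReal.ofReal_mul (by norm_num), ← ENNReal.ofReal_ofNat 2,
    ← ENNReal.ofReal_inv_of_pos (by norm_num)]
  apply ENNReal.ofReal_le_ofReal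
  have : (128 : ℝ) * (c ^ 2 * (2 * (1 / (512 * (c ^ 2 + 1))))) = (c ^ 2 / (c ^ 2 + 1)) * 2⁻¹ := by
    field_simp; ring
  rw [this]
  have h1 : c ^ 2 / (c ^ 2 + 1) ≤ 1 := by rw [div_le_one (by positivity)]; linarith
  linarith

/-- The `L²` estimate for amplitudes supported in the square. -/
theorem lintegral_sliceNorm_sq_le (m : ℕ) {α : ℝ} (hα : 0 < α) : ∃ C : ℝ≥0∞, C ≠ ⊤ ∧
    ∀ {Φ q w : ℝ → ℝ → ℝ} {V Vx Vy : ℝ → ℝ → ℂ} {R : ℝ → ℝ} {E : Set ℝ},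
      IsPhase m Φ q w → IsAmplitude V Vx Vy → E.Finite →
      (∀ y ∈ Set.Ioo (-1 : ℝ) 1, HasPair (fun x => q x y) (Set.Ioo (-1) 1) →
        IsCurve α q w R E y) →
      (∀ x ∉ Set.Ioo (-1 : ℝ) 1, ∀ y, V x y = 0) → (∀ x, ∀ y ∉ Set.Ioo (-1 : ℝ) 1, V x y = 0) →
      ∫⁻ y, sliceNorm Set.univ (fun x t => q x t * V x t) y ^ 2 ≠ ⊤ →
      ∫⁻ y, sliceNorm Set.univ (fun x t => q x t * V x t) y ^ 2 ≤
        C * ((∫⁻ y, sliceNorm Set.univ (fun x t => Vx x t + q x t * V x t) y ^ 2) +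
          ∫⁻ y, sliceNorm Set.univ (fun x t => Vy x t + w x t * V x t) y ^ 2) := by
  obtain ⟨C₀, hC₀, hpt⟩ := sliceNorm_le_maxFn m hα
  obtain ⟨ε, hε, hε1, hsmall⟩ := exists_small_constant hC₀
  obtain ⟨C, hC, hpt⟩ := hpt ε hε hε1
  obtain ⟨D, hD, hlines⟩ := lintegral_goodLines_le m
  set θ := C₀ * ENNReal.ofReal (2 * ε) ^ (1 / 2 : ℝ) with hθ
  refine ⟨2 * (16 * C ^ 2 * 32 * (1 + 2 * D) + 1), by simp [ENNReal.mul_eq_top, hC, hD], ?_⟩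
  intro Φ q w V Vx Vy R E hΦ hV hE hcurve hV₁ hV₂ hfin
  have hpt := hpt hΦ hV hE hcurve hV₁ hV₂
  obtain ⟨h3, h4⟩ := hlines hΦ hV hV₂
  have hcw : Continuous fun z : ℝ × ℝ => (w z.1 z.2 : ℂ) * V z.1 z.2 := by
    have := hΦ.cont_w; have := hV.cont; fun_prop
  have hcq : Continuous fun z : ℝ × ℝ => (q z.1 z.2 : ℂ) * V z.1 z.2 := by
    have := hΦ.cont_q; have := hV.cont; fun_prop
  set S₀ := sliceNorm Set.univ fun x t => (q x t : ℂ) * V x t with hS₀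
  set S₁ := sliceNorm Set.univ fun x t => Vx x t + q x t * V x t with hS₁
  set S₂ := sliceNorm Set.univ fun x t => Vy x t + w x t * V x t with hS₂
  set S₃ := sliceNorm (goodLines w) fun x t => (w x t : ℂ) * V x t with hS₃
  set S₄ := sliceNorm (goodLines w) Vy with hS₄
  have m0 : Measurable S₀ := measurable_sliceNorm _ hcq
  have m1 : Measurable S₁ := measurable_sliceNorm _ (hΦ.cont_op_fst hV)
  have m2 : Measurable S₂ := measurable_sliceNorm _ (hΦ.cont_op_snd hV)
  have m3 : Measurable S₃ := measurable_sliceNorm _ hcw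
  have m4 : Measurable S₄ := measurable_sliceNorm _ hV.cont_snd
  have hsq : ∀ y, S₀ y ^ 2 ≤ 16 * C ^ 2 * (S₁ y ^ 2 + maxFn S₂ y ^ 2 + maxFn S₃ y ^ 2 +
      maxFn S₄ y ^ 2) + 2 * θ ^ 2 * maxFn (fun t => S₀ t + S₁ t) y ^ 2 := by
    intro y
    refine (pow_le_pow_left' (hpt y) 2).trans ?_
    refine le_trans (le_of_eq ?_) ((ENNReal.add₅_sq_le (C * S₁ y) (C * maxFn S₂ y) (C * maxFn S₃ y)
      (C * maxFn S₄ y) (θ * maxFn (fun t => S₀ t + S₁ t) y)).trans (le_of_eq ?_))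
    · ring
    · ring
  have M2 := lintegral_maxFn_sq_le m2
  have M3 := lintegral_maxFn_sq_le m3
  have M4 := lintegral_maxFn_sq_le m4
  have M5 : ∫⁻ y, maxFn (fun t => S₀ t + S₁ t) y ^ 2 ≤
      64 * ((∫⁻ y, S₀ y ^ 2) + ∫⁻ y, S₁ y ^ 2) := by
    refine (lintegral_maxFn_sq_le (m0.add m1)).trans ?_
    calc _ ≤ 32 * ∫⁻ y, 2 * (S₀ y ^ 2 + S₁ y ^ 2) :=
          mul_le_mul' le_rfl (lintegral_mono fun y => ENNReal.add_sq_le _ _)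
      _ = _ := by
          rw [lintegral_const_mul' _ _ (by norm_num), lintegral_add_left (m0.pow_const 2)]
          ring
  set I₀ := ∫⁻ y, S₀ y ^ 2
  set I₁ := ∫⁻ y, S₁ y ^ 2
  set I₂ := ∫⁻ y, S₂ y ^ 2
  have hθt : θ ≠ ⊤ := ENNReal.mul_ne_top hC₀
    (ENNReal.rpow_ne_top_of_nonneg (by norm_num) ENNReal.ofReal_ne_top)
  have hint : I₀ ≤ 16 * C ^ 2 * (I₁ + 32 * I₂ + 32 * (D * I₂) + 32 * (D * I₂)) +
      2 * θ ^ 2 * (64 * (I₀ + I₁)) := by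
    have n2 := (measurable_maxFn S₂).pow_const 2
    have n3 := (measurable_maxFn S₃).pow_const 2
    have n4 := (measurable_maxFn S₄).pow_const 2
    have n1 := m1.pow_const 2
    have k1 : Measurable fun y => S₁ y ^ 2 + maxFn S₂ y ^ 2 := n1.add n2
    have k2 : Measurable fun y => S₁ y ^ 2 + maxFn S₂ y ^ 2 + maxFn S₃ y ^ 2 := k1.add n3
    have k3 : Measurable fun y => 16 * C ^ 2 * (S₁ y ^ 2 + maxFn S₂ y ^ 2 + maxFn S₃ y ^ 2 +
      maxFn S₄ y ^ 2) := (k2.add n4).const_mul _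
    calc I₀ ≤ _ := lintegral_mono hsq
      _ = 16 * C ^ 2 * (I₁ + (∫⁻ y, maxFn S₂ y ^ 2) + (∫⁻ y, maxFn S₃ y ^ 2) +
          ∫⁻ y, maxFn S₄ y ^ 2) + 2 * θ ^ 2 * ∫⁻ y, maxFn (fun t => S₀ t + S₁ t) y ^ 2 := by
          rw [lintegral_add_left k3,
            lintegral_const_mul' _ _ (by simp [ENNReal.mul_eq_top, hC]),
            lintegral_const_mul' _ _ (by simp [ENNReal.mul_eq_top, hθt]),
            lintegral_add_left k2, lintegral_add_left k1,
            lintegral_add_left n1]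
      _ ≤ _ := by
          refine add_le_add (mul_le_mul' le_rfl (add_le_add (add_le_add (add_le_add le_rfl M2)
            (M3.trans (mul_le_mul' le_rfl h3))) (M4.trans (mul_le_mul' le_rfl h4))))
            (mul_le_mul' le_rfl M5)
  have hθ' : 2 * θ ^ 2 * (64 * (I₀ + I₁)) ≤ I₁ + 2⁻¹ * I₀ := by
    calc _ = 128 * θ ^ 2 * I₁ + 128 * θ ^ 2 * I₀ := by ring
      _ ≤ 2⁻¹ * I₁ + 2⁻¹ * I₀ := add_le_add (mul_le_mul' hsmall le_rfl) (mul_le_mul' hsmall le_rfl)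
      _ ≤ 1 * I₁ + 2⁻¹ * I₀ := add_le_add (mul_le_mul' (by norm_num) le_rfl) le_rfl
      _ = _ := by rw [one_mul]
  have hfinal : I₀ ≤ (16 * C ^ 2 * 32 * (1 + 2 * D) + 1) * (I₁ + I₂) + 2⁻¹ * I₀ := by
    refine (hint.trans (add_le_add le_rfl hθ')).trans ?_
    rw [← add_assoc]
    refine add_le_add ?_ le_rfl
    calc 16 * C ^ 2 * (I₁ + 32 * I₂ + 32 * (D * I₂) + 32 * (D * I₂)) + I₁
        ≤ 16 * C ^ 2 * (I₁ + 32 * I₂ + 32 * (D * I₂) + 32 * (D * I₂)) + I₁ +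
          (16 * C ^ 2 * (31 * I₁ + 64 * D * I₁) + I₂) := le_self_add
      _ = _ := by ring
  calc I₀ ≤ 2 * ((16 * C ^ 2 * 32 * (1 + 2 * D) + 1) * (I₁ + I₂)) :=
        ENNReal.le_two_mul_of_le_add_half hfin hfinal
    _ = _ := by ring

theorem normL2_sq (f : ℝ × ℝ → ℂ) : normL2 f ^ 2 = ∫⁻ z, ‖f z‖ₑ ^ 2 := by
  rw [normL2, eLpNorm_eq_lintegral_rpow_enorm_toReal (by norm_num) (by norm_num)]
  rw [← ENNReal.rpow_natCast, ← ENNReal.rpow_mul]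
  norm_num

theorem normL2_sq_eq_lintegral_sliceNorm {f : ℝ × ℝ → ℂ} (hf : Continuous f) :
    normL2 f ^ 2 = ∫⁻ y, sliceNorm Set.univ (fun x t => f (x, t)) y ^ 2 := by
  have hm : Measurable fun z => ‖f z‖ₑ ^ 2 := Continuous.measurable (by fun_prop)
  rw [normL2_sq, Measure.volume_eq_prod, lintegral_prod_symm' _ hm]
  simp only [sliceNorm_sq, setLIntegral_univ]

theorem isAmplitude_of_contDiff {u : ℝ × ℝ → ℂ} (hu : ContDiff ℝ ∞ u) :
    IsAmplitude (fun x y => u (x, y)) (fun x y => funDx u (x, y)) (fun x y => funDy u (x, y)) where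
  hasDerivAt_fst x t := by
    have h1 : HasDerivAt (fun x : ℝ => (x, t)) ((1 : ℝ), (0 : ℝ)) x :=
      (hasDerivAt_id x).prodMk (hasDerivAt_const x t)
    exact ((hu.differentiable (by simp)) (x, t)).hasFDerivAt.comp_hasDerivAt x h1
  hasDerivAt_snd x t := by
    have h1 : HasDerivAt (fun t : ℝ => (x, t)) ((0 : ℝ), (1 : ℝ)) t :=
      (hasDerivAt_const t x).prodMk (hasDerivAt_id t)
    exact ((hu.differentiable (by simp)) (x, t)).hasFDerivAt.comp_hasDerivAt t h1
  cont := hu.continuous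
  cont_fst := (hu.continuous_fderiv (by simp)).clm_apply continuous_const
  cont_snd := (hu.continuous_fderiv (by simp)).clm_apply continuous_const

theorem AssumptionH1.C_mul {α lam : ℝ} (hlam : 0 < lam) {φ : MvPolynomial (Fin 2) ℝ} {I J : Set ℝ}
    (h : AssumptionH1 α φ I J) : AssumptionH1 α (MvPolynomial.C lam * φ) I J := by
  obtain ⟨N, W, r, h1, h2, h3, h4, h5, h6⟩ := h
  have ex : ∀ x y, polyDx (MvPolynomial.C lam * φ) x y = lam * polyDx φ x y := fun x y => by
    simp [polyDx]
  have ey : ∀ x y, polyDy (MvPolynomial.C lam * φ) x y = lam * polyDy φ x y := fun x y => by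
    simp [polyDy]
  have hneg : ∀ z : ℝ, lam * z < 0 ↔ z < 0 := fun z => by
    constructor <;> intro hz <;> nlinarith
  have hpos : ∀ z : ℝ, 0 < lam * z ↔ 0 < z := fun z => mul_pos_iff_of_pos_left hlam
  have hle : ∀ z : ℝ, lam * z ≤ 0 ↔ z ≤ 0 := fun z => by
    rw [← not_lt, ← not_lt, hpos]
  refine ⟨N, W, r, h1, h2, h3, h4, fun j y hy => ?_, h6⟩
  have := h5 j y hy
  simpa only [NoSignChange, SignChangeOnlyAt, ex, ey, hneg, hpos, hle] using this

/-- The estimate under `H₁(α)`, with the parameter absorbed in the polynomial. -/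
theorem exists_normL2_le (m : ℕ) {α : ℝ} (hα : 0 < α) : ∃ C : ℝ, 0 < C ∧
    ∀ φ : MvPolynomial (Fin 2) ℝ, φ.totalDegree ≤ m →
      AssumptionH1 α φ (Set.Ioo (-1) 1) (Set.Ioo (-1) 1) → ∀ u : ℝ × ℝ → ℂ,
        IsTestFunction (Set.Ioo (-1) 1 ×ˢ Set.Ioo (-1) 1) u →
          normL2 (funDx u) + normL2 (mulDx φ 1 u) ≤
            ENNReal.ofReal C * (normL2 (opL1 φ 1 u) + normL2 (opL2 φ 1 u)) := by
  obtain ⟨D, hD, hmain⟩ := lintegral_sliceNorm_sq_le m hα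
  set d := (1 + D).toReal with hd
  have hDt : 1 + D ≠ ⊤ := by simp [hD]
  have hd0 : 0 ≤ d := ENNReal.toReal_nonneg
  refine ⟨1 + 2 * d, by positivity, fun φ hφm H u ⟨hu, hcs, hsupp⟩ => ?_⟩
  have hφ := MvPolynomial.isPhase hφm
  have hV := isAmplitude_of_contDiff hu
  obtain ⟨R, E, hE, hcurve⟩ := exists_isCurve H
  have hzero : ∀ z, z ∉ Set.Ioo (-1 : ℝ) 1 ×ˢ Set.Ioo (-1 : ℝ) 1 → u z = 0 := fun z hz =>
    image_eq_zero_of_notMem_tsupport fun h => hz (hsupp h)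
  have hmul : mulDx φ 1 u = fun z => (polyDx φ z.1 z.2 : ℂ) * u z := by
    ext z; simp [mulDx]
  have hop1 : opL1 φ 1 u = fun z => funDx u z + (polyDx φ z.1 z.2 : ℂ) * u z := by
    ext z; simp [opL1, mulDx]
  have hop2 : opL2 φ 1 u = fun z => funDy u z + (polyDy φ z.1 z.2 : ℂ) * u z := by
    ext z; simp [opL2, mulDy]
  have hc0 : Continuous (mulDx φ 1 u) := by
    rw [hmul]
    have := hφ.cont_q; have := hu.continuous; fun_prop
  have hc1 : Continuous (opL1 φ 1 u) := by rw [hop1]; exact hφ.cont_op_fst hV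
  have hc2 : Continuous (opL2 φ 1 u) := by rw [hop2]; exact hφ.cont_op_snd hV
  have hcdx : Continuous (funDx u) := hV.cont_fst
  have hfin : normL2 (mulDx φ 1 u) ≠ ⊤ := by
    have hcs' : HasCompactSupport (mulDx φ 1 u) := by
      rw [hmul]; exact hcs.mul_left
    exact (hc0.memLp_of_hasCompactSupport hcs').eLpNorm_ne_top
  have e0 := normL2_sq_eq_lintegral_sliceNorm hc0
  have e1 := normL2_sq_eq_lintegral_sliceNorm hc1
  have e2 := normL2_sq_eq_lintegral_sliceNorm hc2
  simp only [hmul] at e0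
  simp only [hop1] at e1
  simp only [hop2] at e2
  have h := hmain hφ hV hE hcurve (fun x hx y => hzero _ fun h => hx h.1)
    (fun x y hy => hzero _ fun h => hy h.2) (by
      rw [← e0, ← hmul]; exact ENNReal.pow_ne_top hfin)
  rw [← e0, ← e1, ← e2, ← hmul, ← hop1, ← hop2] at h
  set n0 := normL2 (mulDx φ 1 u)
  set n1 := normL2 (opL1 φ 1 u)
  set n2 := normL2 (opL2 φ 1 u)
  have h0 : n0 ≤ (1 + D) * (n1 + n2) := by
    apply ENNReal.le_of_sq_le_sq
    refine h.trans ?_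
    calc D * (n1 ^ 2 + n2 ^ 2) ≤ ((1 + D) * (1 + D)) * (n1 + n2) ^ 2 := by
          refine mul_le_mul' ?_ ?_
          · calc D ≤ 1 + D := le_add_self
              _ = 1 * (1 + D) := (one_mul _).symm
              _ ≤ (1 + D) * (1 + D) := mul_le_mul' le_self_add le_rfl
          · have : (n1 + n2) ^ 2 = n1 ^ 2 + n2 ^ 2 + 2 * n1 * n2 := by ring
            rw [this]; exact le_self_add
      _ = _ := by ring
  have hdx : normL2 (funDx u) ≤ n1 + n0 := by
    have e : funDx u = opL1 φ 1 u - mulDx φ 1 u := by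
      ext z; simp [opL1]
    rw [e]
    exact eLpNorm_sub_le hc1.aestronglyMeasurable hc0.aestronglyMeasurable (by norm_num)
  have hC : ENNReal.ofReal (1 + 2 * d) = 1 + 2 * (1 + D) := by
    rw [ENNReal.ofReal_add (by norm_num) (by positivity), ENNReal.ofReal_mul (by norm_num), hd,
      ENNReal.ofReal_toReal hDt, ENNReal.ofReal_one, ENNReal.ofReal_ofNat]
  rw [hC]
  calc normL2 (funDx u) + n0 ≤ (n1 + n0) + n0 := add_le_add hdx le_rfl
    _ ≤ ((n1 + n2) + (1 + D) * (n1 + n2)) + (1 + D) * (n1 + n2) :=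
        add_le_add (add_le_add le_self_add h0) h0
    _ = _ := by ring

theorem normL2_le_of_assumptionH1 (m : ℕ) {α : ℝ} (hα : 0 < α) : ∃ C : ℝ, 0 < C ∧
    ∀ φ : MvPolynomial (Fin 2) ℝ, φ.totalDegree ≤ m →
      AssumptionH1 α φ (Set.Ioo (-1) 1) (Set.Ioo (-1) 1) → ∀ lam : ℝ, 0 < lam → ∀ u : ℝ × ℝ → ℂ,
        IsTestFunction (Set.Ioo (-1) 1 ×ˢ Set.Ioo (-1) 1) u →
          normL2 (funDx u) + normL2 (mulDx φ lam u) ≤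
            ENNReal.ofReal C * (normL2 (opL1 φ lam u) + normL2 (opL2 φ lam u)) := by
  obtain ⟨C, hC, h⟩ := exists_normL2_le m hα
  refine ⟨C, hC, fun φ hφ H lam hlam u hu => ?_⟩
  have hdeg : (MvPolynomial.C lam * φ).totalDegree ≤ m := by
    refine (MvPolynomial.totalDegree_mul _ _).trans ?_
    simpa using hφ
  have ex : mulDx (MvPolynomial.C lam * φ) 1 u = mulDx φ lam u := by
    ext z; simp [mulDx, polyDx]
  have ey : mulDy (MvPolynomial.C lam * φ) 1 u = mulDy φ lam u := by
    ext z; simp [mulDy, polyDy]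
  have e1 : opL1 (MvPolynomial.C lam * φ) 1 u = opL1 φ lam u := by
    ext z; rw [opL1, opL1, ex]
  have e2 : opL2 (MvPolynomial.C lam * φ) 1 u = opL2 φ lam u := by
    ext z; rw [opL2, opL2, ey]
  have := h _ hdeg (H.C_mul hlam) u hu
  rwa [ex, e1, e2] at this

section Swap

/-- The polynomial with the two variables exchanged. -/
noncomputable def swapVars (φ : MvPolynomial (Fin 2) ℝ) : MvPolynomial (Fin 2) ℝ :=
  MvPolynomial.rename (Equiv.swap 0 1) φ

theorem eval_swapVars (φ : MvPolynomial (Fin 2) ℝ) (x y : ℝ) :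
    MvPolynomial.eval ![x, y] (swapVars φ) = MvPolynomial.eval ![y, x] φ := by
  rw [swapVars, MvPolynomial.eval_rename]
  congr 2
  ext i
  fin_cases i <;> simp

theorem polyDx_swapVars (φ : MvPolynomial (Fin 2) ℝ) (x y : ℝ) :
    polyDx (swapVars φ) x y = polyDy φ y x := by
  have h := MvPolynomial.pderiv_rename (Equiv.swap (0 : Fin 2) 1).injective 1 φ
  rw [Equiv.swap_apply_right] at h
  rw [polyDx, swapVars, h, polyDy]
  exact eval_swapVars _ x y

theorem polyDy_swapVars (φ : MvPolynomial (Fin 2) ℝ) (x y : ℝ) :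
    polyDy (swapVars φ) x y = polyDx φ y x := by
  have h := MvPolynomial.pderiv_rename (Equiv.swap (0 : Fin 2) 1).injective 0 φ
  rw [Equiv.swap_apply_left] at h
  rw [polyDy, swapVars, h, polyDx]
  exact eval_swapVars _ x y

theorem AssumptionH2.swapVars {α : ℝ} {φ : MvPolynomial (Fin 2) ℝ} {I J : Set ℝ}
    (h : AssumptionH2 α φ I J) : AssumptionH1 α (swapVars φ) J I := by
  obtain ⟨N, W, r, h1, h2, h3, h4, h5, h6⟩ := h
  exact ⟨N, W, r, h1, h2, h3, h4, by simpa only [polyDx_swapVars, polyDy_swapVars] using h5, h6⟩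

theorem normL2_comp_swap (f : ℝ × ℝ → ℂ) : normL2 (fun z => f z.swap) = normL2 f := by
  have hmp : MeasurePreserving (Prod.swap : ℝ × ℝ → ℝ × ℝ) volume volume :=
    Measure.measurePreserving_swap
  have := hmp.map_eq
  rw [normL2, normL2]
  conv_rhs => rw [← this]
  exact (MeasurableEquiv.prodComm.measurableEmbedding.eLpNorm_map_measure).symm

theorem fderiv_comp_swap {u : ℝ × ℝ → ℂ} (hu : Differentiable ℝ u) (z v : ℝ × ℝ) :
    fderiv ℝ (fun z => u z.swap) z v = fderiv ℝ u z.swap v.swap := by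
  have h1 : HasFDerivAt (Prod.swap : ℝ × ℝ → ℝ × ℝ)
      (ContinuousLinearEquiv.prodComm ℝ ℝ ℝ : ℝ × ℝ →L[ℝ] ℝ × ℝ) z :=
    (ContinuousLinearEquiv.prodComm ℝ ℝ ℝ).hasFDerivAt
  have h2 := (hu z.swap).hasFDerivAt.comp z h1
  have h3 : fderiv ℝ (fun z => u z.swap) z = _ := h2.fderiv
  rw [h3]
  rfl

end Swap

theorem theorem1p1 (m : ℕ) :
    ∃ δ : ℝ, 0 < δ ∧ ∀ α : ℝ, 0 < α →
      ∃ lam₀ C : ℝ, 0 < lam₀ ∧ 0 < C ∧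
        ∀ φ : MvPolynomial (Fin 2) ℝ, φ.totalDegree ≤ m →
          (AssumptionH1 α φ (Set.Ioo (-δ) δ) (Set.Ioo (-δ) δ) →
            ∀ lam : ℝ, lam₀ ≤ lam → ∀ u : ℝ × ℝ → ℂ,
              IsTestFunction (Set.Ioo (-δ) δ ×ˢ Set.Ioo (-δ) δ) u →
                normL2 (funDx u) + normL2 (mulDx φ lam u) ≤
                  ENNReal.ofReal C * (normL2 (opL1 φ lam u) + normL2 (opL2 φ lam u))) ∧
          (AssumptionH2 α φ (Set.Ioo (-δ) δ) (Set.Ioo (-δ) δ) →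
            ∀ lam : ℝ, lam₀ ≤ lam → ∀ u : ℝ × ℝ → ℂ,
              IsTestFunction (Set.Ioo (-δ) δ ×ˢ Set.Ioo (-δ) δ) u →
                normL2 (funDy u) + normL2 (mulDy φ lam u) ≤
                  ENNReal.ofReal C * (normL2 (opL1 φ lam u) + normL2 (opL2 φ lam u))) := by
  refine ⟨1, one_pos, fun α hα => ?_⟩
  obtain ⟨C, hC, h⟩ := normL2_le_of_assumptionH1 m hα
  refine ⟨1, C, one_pos, hC, fun φ hφ => ⟨fun H lam hlam u hu =>
    h φ hφ H lam (one_pos.trans_le hlam) u hu, fun H lam hlam u hu => ?_⟩⟩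
  have hdeg : (swapVars φ).totalDegree ≤ m := (MvPolynomial.totalDegree_rename_le _ _).trans hφ
  obtain ⟨hu1, hu2, hu3⟩ := hu
  have hsw : IsTestFunction (Set.Ioo (-1) 1 ×ˢ Set.Ioo (-1) 1) fun z => u z.swap := by
    refine ⟨hu1.comp (contDiff_snd.prodMk contDiff_fst),
      hu2.comp_homeomorph (Homeomorph.prodComm ℝ ℝ), fun z hz => ?_⟩
    have : z.swap ∈ tsupport u := by
      have := tsupport_comp_subset_preimage u continuous_swap hz
      exact this
    have := hu3 this
    exact ⟨this.2, this.1⟩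
  have hd := hu1.differentiable (by simp)
  have edx : funDx (fun z => u z.swap) = fun z => funDy u z.swap := by
    ext z; exact fderiv_comp_swap hd z (1, 0)
  have edy : funDy (fun z => u z.swap) = fun z => funDx u z.swap := by
    ext z; exact fderiv_comp_swap hd z (0, 1)
  have emx : mulDx (swapVars φ) lam (fun z => u z.swap) = fun z => mulDy φ lam u z.swap := by
    ext z; simp only [mulDx, mulDy, polyDx_swapVars, Prod.fst_swap, Prod.snd_swap]
  have emy : mulDy (swapVars φ) lam (fun z => u z.swap) = fun z => mulDx φ lam u z.swap := by
    ext z; simp only [mulDx, mulDy, polyDy_swapVars, Prod.fst_swap, Prod.snd_swap]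
  have e1 : opL1 (swapVars φ) lam (fun z => u z.swap) = fun z => opL2 φ lam u z.swap := by
    ext z; rw [opL1, edx, emx, opL2]
  have e2 : opL2 (swapVars φ) lam (fun z => u z.swap) = fun z => opL1 φ lam u z.swap := by
    ext z; rw [opL2, edy, emy, opL1]
  have := h _ hdeg H.swapVars lam (one_pos.trans_le hlam) _ hsw
  rw [edx, emx, e1, e2] at this
  simp only [normL2_comp_swap] at this
  rwa [add_comm (normL2 (opL2 φ lam u))] at this
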